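/- For each odd integer $k \ge 7$ there exists $n_0$ such that the following holds for all $n \ge n_0$. If $G$ is a $C_{k-2}$-free graph on $n$ vertices which has the maximum number of $k$-cycles among all $C_{k-2}$-free graphs on $n$ vertices, then $G$ is a balanced blow-up of $C_k$, that is, $G$ is obtained from $C_k$ by replacing its vertices with independent sets whose sizes differ by at most one from each other and replacing its edges by complete bipartite graphs between the corresponding independent sets. In particular, for all $n \ge n_0$ we have $\mathrm{ex}(n, C_k, C_{k-2}) \le (n/k)^k$, where $\mathrm{ex}(n,T,H)$ denotes the maximum number of copies of $T$ in an $H$-free graph on $n$ vertices. (Graphs are finite and simple, and $H$-free means containing no subgraph, not necessarily induced, isomorphic to $H$.) -/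

import Mathlib

namespace GeneralizedTuran

/-- The generalized Turán number `ex(n, T, H)`: the maximum number of (unlabelled) copies of `T`
in an `H`-free graph on `n` vertices (`0` if there is no `H`-free graph on `n` vertices). -/
noncomputable def genExtremalNumber {α β : Type*} (n : ℕ) (T : SimpleGraph α)
    (H : SimpleGraph β) : ℕ := by
  classical
  exact (Finset.univ.filter fun G : SimpleGraph (Fin n) => H.Free G).sup fun G => G.copyCount T

/-- `G` is an `H`-free graph that has the maximum number of copies of `T` among all `H`-free
graphs on the same (finite) vertex set. -/
def IsMaximizer {V α β : Type*} [Fintype V] (G : SimpleGraph V) (T : SimpleGraph α)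
    (H : SimpleGraph β) : Prop :=
  H.Free G ∧ ∀ G' : SimpleGraph V, H.Free G' → G'.copyCount T ≤ G.copyCount T

/-- `G` is a balanced blow-up of `F`: the vertex `a` of `F` is replaced by the set of all `v` with
`part v = a`, two vertices of `G` are adjacent exactly when their parts are adjacent in `F` (so each
part is independent), and the sizes of any two parts differ by at most one. -/
def IsBalancedBlowup {V W : Type*} (G : SimpleGraph V) (F : SimpleGraph W) : Prop :=
  ∃ part : V → W,
    (∀ v w : V, G.Adj v w ↔ F.Adj (part v) (part w)) ∧
    ∀ a b : W, {v | part v = a}.ncard ≤ {v | part v = b}.ncard + 1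

end GeneralizedTuran

namespace GeneralizedTuran

open scoped Classical
open Finset Filter Topology

/-! A blow-up of `C_k` has no odd cycle shorter than `k`, and with classes of sizes `n_i` it has `2k
∏ n_i` labelled `k`-cycles. The heart of the matter is that a maximiser `G` maps homomorphically to
`C_k`. Then it lies inside a blow-up, maximality forces equality and balance, and AM-GM gives
`(n/k)^k`.

Asymptotic bound. A labelled cycle `z` is revealed vertex by vertex in the order 0, 1, 3, 2, 4, ...,
each vertex from a set determined by the earlier ones (`choiceSet`). The product of the inverse
sizes of these sets is a subprobability on cycles. Summing over the `k` rotations of a cycle and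
using `log x ≤ x - 1`, a lower bound for the weights follows from an upper bound for a weighted sum
of the set sizes. That sum is counted vertex by vertex: a vertex contributes at most `k - 1`
(`incidence_count_le`) unless it is atypical for `z`. Atypical vertices are rare because, without
`C_{k-2}`, the neighbourhoods of the ends of a path with an odd number of vertices, at most `k - 4`,
span only `O(n)` edges (`card_adj_pairs_le`). The inequality gains a constant factor on cycles for
which some `z i`, `z (i + 2)` have too few common neighbours. Hence a graph with as many cycles as
the balanced blow-up has a cycle all of whose codegrees are nearly `n/k` (`exists_good_cycle`).

Stability. The common neighbourhoods along this cycle form `k` classes of size nearly `n/k` with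
`O(n)` edges between non-consecutive classes. Counting cycles shows that consecutive classes are
almost completely joined (`exists_isNear`).

Exactness. In such a graph walks on `C_k` lift to paths, so a misplaced edge closes a `C_{k-2}`. A
vertex that fits no class lies on fewer `k`-cycles than it would inside a class, contradicting
maximality (`exists_classes_of_isNear`). -/

/-! ### Cycles as lists and as maps on `ZMod k`; labelled and unlabelled copies. -/

theorem not_free_cycleGraph_of_list {V : Type*} {G : SimpleGraph V} {m : ℕ} (hm : 2 ≤ m)
    (l : List V) (hl : l.length = m) (hnd : l.Nodup) (hch : l.IsChain G.Adj)
    (hclose : ∀ a ∈ l.getLast?, ∀ b ∈ l.head?, G.Adj a b) :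
    ¬ (SimpleGraph.cycleGraph m).Free G := by
  rw [SimpleGraph.not_free]
  subst hl
  have hsucc : ∀ (i : ℕ) (hi : i + 1 < l.length), G.Adj l[i] l[i+1] := by
    intro i hi
    exact List.isChain_iff_getElem.1 hch i (by omega)
  have hlast : G.Adj (l[l.length - 1]) l[0] := by
    apply hclose
    · simp [List.getLast?_eq_getElem?]
    · simp [List.head?_eq_getElem?]
  have key : ∀ u v : Fin l.length, (v - u).val = 1 → G.Adj (l.get u) (l.get v) := by
    intro u v huv
    rw [Fin.sub_def] at huv
    simp only at huv
    have hu := u.2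
    have hv := v.2
    rcases Nat.lt_or_ge u.val v.val with h | h
    · have : l.length - u.val + v.val = l.length + (v.val - u.val) := by omega
      rw [this, Nat.add_mod_left, Nat.mod_eq_of_lt (by omega)] at huv
      have h2 := hsucc u.val (by omega)
      have h3 : v.val = u.val + 1 := by omega
      simp only [List.get_eq_getElem, h3]
      exact h2
    · rcases Nat.lt_or_ge v.val u.val with h' | h'
      · rw [Nat.mod_eq_of_lt (by omega)] at huv
        have h3 : v.val = 0 := by omega
        have h4 : u.val = l.length - 1 := by omega
        simp only [List.get_eq_getElem, h3, h4]
        exact hlast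
      · have h5 : l.length - u.val + v.val = l.length := by omega
        rw [h5, Nat.mod_self] at huv
        omega
  refine ⟨⟨⟨l.get, ?_⟩, ?_⟩⟩
  · intro u v huv
    rw [SimpleGraph.cycleGraph_adj'] at huv
    rcases huv with h | h
    · exact (key _ _ h).symm
    · exact key _ _ h
  · exact List.nodup_iff_injective_get.1 hnd

/-- Two embeddings with the same image subgraph differ by a unique automorphism of `T`, so all
fibres of `Copy.toSubgraph` over its image have the size of the automorphism group. -/
theorem labelledCopyCount_eq_copyCount_mul {V W : Type*} [Fintype V] [Fintype W]
    (G : SimpleGraph V) (T : SimpleGraph W) :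
    G.labelledCopyCount T = G.copyCount T * Nat.card (T ≃g T) := by
  have : Finite (T ≃g T) := DFunLike.finite _
  have := Fintype.ofFinite (T ≃g T)
  rw [Nat.card_eq_fintype_card]
  rw [SimpleGraph.copyCount_eq_card_image_copyToSubgraph, SimpleGraph.labelledCopyCount]
  rw [← Finset.card_univ (α := T.Copy G),
    Finset.card_eq_sum_card_image SimpleGraph.Copy.toSubgraph, Finset.sum_const_nat]
  intro S hS
  obtain ⟨f, -, rfl⟩ := Finset.mem_image.1 hS
  rw [← Finset.card_univ (α := T ≃g T)]
  symm
  refine Finset.card_bij (fun e _ => f.comp e.toCopy) ?_ ?_ ?_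
  · intro e _
    simp only [mem_filter, mem_univ, true_and]
    ext x y
    · simp only [SimpleGraph.Copy.toSubgraph]
      simp
      constructor
      · rintro ⟨a, rfl⟩; exact ⟨e a, rfl⟩
      · rintro ⟨a, rfl⟩; exact ⟨e.symm a, by simp⟩
    · simp only [SimpleGraph.Copy.toSubgraph]
      simp [Relation.Map]
      constructor
      · rintro ⟨a, b, h, rfl, rfl⟩; exact ⟨e a, e b, e.map_rel_iff.2 h, rfl, rfl⟩
      · rintro ⟨a, b, h, rfl, rfl⟩; exact ⟨e.symm a, e.symm b, e.symm.map_rel_iff.2 h, by simp, by simp⟩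
  · intro e _ e' _ h
    ext a
    have := DFunLike.congr_fun h a
    exact f.injective this
  · intro g hg
    simp only [mem_filter, mem_univ, true_and] at hg
    have hv : Set.range f = Set.range g := by
      have := congrArg SimpleGraph.Subgraph.verts hg
      simpa [SimpleGraph.Copy.toSubgraph] using this.symm
    have hadj : ∀ (h : T.Copy G) (a b : W), h.toSubgraph.Adj (h a) (h b) ↔ T.Adj a b := by
      intro h a b
      simp only [SimpleGraph.Copy.toSubgraph]
      simp [Relation.Map]
      constructor
      · rintro ⟨c, d, hcd, h1, h2⟩
        rw [← h.injective h1, ← h.injective h2]; exact hcd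
      · intro hab; exact ⟨a, b, hab, rfl, rfl⟩
    have hex : ∀ a, ∃ b, f b = g a := fun a => by
      have : g a ∈ Set.range f := hv ▸ ⟨a, rfl⟩
      exact this
    choose e he using hex
    have hinj : Function.Injective e := by
      intro a b hab
      apply g.injective
      simp only [SimpleGraph.Copy.coe_toHom]
      rw [← he a, ← he b, hab]
    have hsurj : Function.Surjective e := Finite.surjective_of_injective hinj
    refine ⟨⟨Equiv.ofBijective e ⟨hinj, hsurj⟩, ?_⟩, mem_univ _, ?_⟩
    · intro a b
      show T.Adj (e a) (e b) ↔ T.Adj a b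
      rw [← hadj f, he, he, ← hg, hadj]
    · ext a
      exact he a

/-- Labelled `k`-cycles of `G`. -/
noncomputable def cycles {V : Type*} [Fintype V] (G : SimpleGraph V) (k : ℕ) [NeZero k] :
    Finset (ZMod k → V) :=
  univ.filter fun z => Function.Injective z ∧ ∀ i, G.Adj (z i) (z (i + 1))

theorem mem_cycles {V : Type*} [Fintype V] {G : SimpleGraph V} {k : ℕ} [NeZero k]
    {z : ZMod k → V} : z ∈ cycles G k ↔ Function.Injective z ∧ ∀ i, G.Adj (z i) (z (i + 1)) := by
  simp [cycles]

theorem exists_equiv_cycleGraph (k : ℕ) (hk : 2 ≤ k) : ∃ e : Fin k ≃ ZMod k,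
    ∀ u v, (SimpleGraph.cycleGraph k).Adj u v ↔ (e v = e u + 1 ∨ e u = e v + 1) := by
  obtain ⟨m, rfl⟩ := Nat.exists_eq_add_of_le' hk
  refine ⟨Equiv.refl _, fun u v => ?_⟩
  rw [SimpleGraph.cycleGraph_adj, or_comm]
  exact or_congr (sub_eq_iff_eq_add' (G := ZMod (m + 2))) (sub_eq_iff_eq_add' (G := ZMod (m + 2)))

theorem card_cycles_eq_labelledCopyCount {V : Type*} [Fintype V] (G : SimpleGraph V) (k : ℕ)
    [NeZero k] (hk : 2 ≤ k) :
    (cycles G k).card = G.labelledCopyCount (SimpleGraph.cycleGraph k) := by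
  obtain ⟨e, he⟩ := exists_equiv_cycleGraph k hk
  suffices key : ∀ inst : Fintype ((SimpleGraph.cycleGraph k).Copy G),
      (cycles G k).card = @Fintype.card _ inst from key _
  intro inst
  rw [← Finset.card_univ (α := (SimpleGraph.cycleGraph k).Copy G)]
  symm
  refine Finset.card_bij (fun (f : (SimpleGraph.cycleGraph k).Copy G) _ (i : ZMod k) =>
    f (e.symm i)) ?_ ?_ ?_
  · intro f _
    rw [mem_cycles]
    refine ⟨fun i j h => e.symm.injective (f.injective h), fun i => ?_⟩
    apply f.toHom.map_adj
    rw [he]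
    simp
  · intro f _ g _ h
    ext a
    simpa using congrFun h (e a)
  · intro z hz
    rw [mem_cycles] at hz
    refine ⟨⟨⟨fun a => z (e a), ?_⟩, ?_⟩, mem_univ _, ?_⟩
    · intro a b hab
      rw [he] at hab
      rcases hab with h | h
      · rw [h]; exact hz.2 _
      · rw [h]; exact (hz.2 _).symm
    · intro a b h; exact e.injective (hz.1 h)
    · funext i
      show z (e (e.symm i)) = z i
      simp

/-! ### Closed walks and symmetries of the cycle `ZMod k`. -/

/-- Adjacency in the cycle with vertex set `ZMod k`. -/
def Consec {k : ℕ} (a b : ZMod k) : Prop := b = a + 1 ∨ a = b + 1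

theorem Consec.symm {k : ℕ} {a b : ZMod k} (h : Consec a b) : Consec b a := Or.symm h

theorem natCast_ne_zero_of_lt {k : ℕ} {a : ℕ} (h0 : 0 < a) (h : a < k) : (a : ZMod k) ≠ 0 := by
  rw [Ne, ZMod.natCast_eq_zero_iff]
  exact fun hd => absurd (Nat.le_of_dvd h0 hd) (by omega)

/-- The increments of a closed walk sum to zero, and each is `1`, or `-1 = 1 - 2` for a backward
step. -/
theorem exists_two_mul_eq_of_closed_walk {k l : ℕ} [NeZero l] (f : ZMod l → ZMod k)
    (hf : ∀ i, Consec (f i) (f (i + 1))) :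
    (l : ZMod k) = 2 * ((univ.filter fun i => f (i + 1) ≠ f i + 1).card : ZMod k) := by
  have h0 : ∑ i, (f (i + 1) - f i) = 0 := by
    rw [sum_sub_distrib, sub_eq_zero]
    exact Equiv.sum_comp (Equiv.addRight (1 : ZMod l)) f
  have h1 : ∀ i, f (i + 1) - f i = 1 - 2 * (if f (i + 1) ≠ f i + 1 then 1 else 0) := by
    intro i
    split_ifs with h
    · rcases hf i with h' | h'
      · exact absurd h' h
      · rw [h']; ring
    · push Not at h
      rw [h]; ring
  rw [sum_congr rfl (fun i _ => h1 i), sum_sub_distrib, ← mul_sum, sum_boole] at h0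
  simp only [sum_const, card_univ, ZMod.card, nsmul_eq_mul, mul_one] at h0
  exact sub_eq_zero.1 h0

/-- With `m` backward steps, `l - 2m` is a multiple of `k` of absolute value below `k`, hence zero,
against the parity of `l`. -/
theorem not_closed_walk_of_odd_lt {k l : ℕ} [NeZero l] (hl : Odd l) (hlk : l < k)
    (f : ZMod l → ZMod k) (hf : ∀ i, Consec (f i) (f (i + 1))) : False := by
  have h := exists_two_mul_eq_of_closed_walk f hf
  set m := (univ.filter fun i => f (i + 1) ≠ f i + 1).card with hm
  have hml : m ≤ l := by
    refine (card_le_univ _).trans ?_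
    simp
  have h2 : ((l - 2 * m : ℤ) : ZMod k) = 0 := by
    push_cast
    rw [h]; ring
  rw [ZMod.intCast_zmod_eq_zero_iff_dvd] at h2
  obtain ⟨t, ht⟩ := hl
  have : (l - 2 * m : ℤ) = 0 := by
    apply Int.eq_zero_of_abs_lt_dvd h2
    rw [abs_lt]; omega
  omega

/-- The rotations and reflections of the cycle on `ZMod k`. -/
noncomputable def dihedral (k : ℕ) [NeZero k] : Finset (ZMod k → ZMod k) :=
  univ.filter fun t => (∀ i, t i = t 0 + i) ∨ ∀ i, t i = t 0 - i

theorem mem_dihedral {k : ℕ} [NeZero k] {t : ZMod k → ZMod k} :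
    t ∈ dihedral k ↔ (∀ i, t i = t 0 + i) ∨ ∀ i, t i = t 0 - i := by
  simp [dihedral]

theorem apply_eq_add_of_succ {k : ℕ} [NeZero k] (t : ZMod k → ZMod k) (s : ZMod k)
    (h : ∀ i, t (i + 1) = t i + s) (i : ZMod k) : t i = t 0 + i * s := by
  have : ∀ m : ℕ, t m = t 0 + m * s := by
    intro m
    induction m with
    | zero => simp
    | succ m ih => push_cast; rw [h, ih]; ring
  have h2 := this i.val
  rwa [ZMod.natCast_zmod_val] at h2

/-- The number of backward steps is at most `k`, and `k` divides its double. As `k` is odd it is `0`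
or `k`, so all steps go the same way round. -/
theorem mem_dihedral_of_consec {k : ℕ} [NeZero k] (hodd : Odd k) (t : ZMod k → ZMod k)
    (h : ∀ i, Consec (t i) (t (i + 1))) : t ∈ dihedral k := by
  have h1 := exists_two_mul_eq_of_closed_walk t h
  set S := univ.filter fun i => t (i + 1) ≠ t i + 1 with hS
  have hSk : S.card ≤ k := by
    refine (card_le_univ _).trans ?_
    simp
  have h2 : k ∣ 2 * S.card := by
    rw [← ZMod.natCast_eq_zero_iff]
    push_cast
    rw [← h1]; simp
  have h3 : k ∣ S.card := (Nat.Coprime.dvd_mul_left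
    (Nat.coprime_two_right.2 hodd)).1 h2
  rw [mem_dihedral]
  rcases Nat.eq_zero_or_pos S.card with h0 | hpos
  · left
    have : ∀ i, t (i + 1) = t i + 1 := by
      intro i
      by_contra hi
      have : i ∈ S := by simp [hS, hi]
      rw [card_eq_zero.1 h0] at this
      simp at this
    intro i
    rw [apply_eq_add_of_succ t 1 this]; ring
  · right
    have hk : S.card = k := le_antisymm hSk (Nat.le_of_dvd hpos h3)
    have hu : S = univ := by
      apply eq_univ_of_card
      rw [hk, ZMod.card]
    have : ∀ i, t (i + 1) = t i + (-1) := by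
      intro i
      have : i ∈ S := by rw [hu]; simp
      have hi : t (i + 1) ≠ t i + 1 := by simpa [hS] using this
      rcases h i with h' | h'
      · exact absurd h' hi
      · rw [h']; ring
    intro i
    rw [apply_eq_add_of_succ t (-1) this]; ring

theorem bijective_of_mem_dihedral {k : ℕ} [NeZero k] {t : ZMod k → ZMod k}
    (h : t ∈ dihedral k) : Function.Bijective t := by
  rw [← Finite.injective_iff_bijective]
  intro a b hab
  rw [mem_dihedral] at h
  rcases h with h | h
  · rw [h a, h b] at hab; exact add_left_cancel hab
  · rw [h a, h b] at hab; exact sub_right_injective hab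

theorem consec_of_mem_dihedral {k : ℕ} [NeZero k] {t : ZMod k → ZMod k}
    (h : t ∈ dihedral k) (i : ZMod k) : Consec (t i) (t (i + 1)) := by
  rw [mem_dihedral] at h
  rcases h with h | h
  · left; rw [h (i + 1), h i]; ring
  · right; rw [h (i + 1), h i]; ring

theorem two_ne_zero_zmod {k : ℕ} (hk : 3 ≤ k) : (2 : ZMod k) ≠ 0 := by
  exact_mod_cast natCast_ne_zero_of_lt (k := k) (a := 2) (by omega) (by omega)

theorem card_dihedral {k : ℕ} [NeZero k] (hk : 3 ≤ k) : (dihedral k).card = 2 * k := by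
  have : (dihedral k) = (univ : Finset (Bool × ZMod k)).image
      (fun p => fun i => if p.1 then p.2 + i else p.2 - i) := by
    ext t
    rw [mem_dihedral, mem_image]
    constructor
    · rintro (h | h)
      · exact ⟨(true, t 0), mem_univ _, funext fun i => by simp [h i]⟩
      · exact ⟨(false, t 0), mem_univ _, funext fun i => by simp [h i]⟩
    · rintro ⟨⟨b, c⟩, -, rfl⟩
      cases b <;> simp
  rw [this, card_image_of_injective]
  · simp [ZMod.card]
  · rintro ⟨b, c⟩ ⟨b', c'⟩ h
    have h0 := congrFun h 0
    have h1 := congrFun h 1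
    have h2 := two_ne_zero_zmod hk
    cases b <;> cases b' <;> simp at h0 h1 ⊢
    · exact h0
    · subst h0; apply h2; linear_combination -h1
    · subst h0; apply h2; linear_combination h1
    · exact h0

/-- The number of `z` whose classes are given by `t`, with an extra constraint. -/
theorem card_filter_comp_eq {V : Type*} [Fintype V] {k : ℕ} [NeZero k] {t : ZMod k → ZMod k}
    (ht : t ∈ dihedral k) (X : ZMod k → Finset V) :
    (univ.filter fun z : ZMod k → V => ∀ i, z i ∈ X (t i)).card = ∏ i, (X i).card := by
  have h1 : (univ.filter fun z : ZMod k → V => ∀ i, z i ∈ X (t i))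
      = Fintype.piFinset fun i => X (t i) := by
    ext z; simp
  rw [h1, Fintype.card_piFinset]
  exact (Equiv.ofBijective t (bijective_of_mem_dihedral ht)).prod_comp fun i => (X i).card

/-! ### Blow-ups of the cycle and their `k`-cycles. -/

/-- The blow-up of the `k`-cycle with classes given by `c`. -/
def blowup {V : Type*} {k : ℕ} (hk : 2 ≤ k) (c : V → ZMod k) : SimpleGraph V where
  Adj u v := Consec (c u) (c v)
  symm := ⟨fun _ _ h => h.symm⟩
  loopless := ⟨fun u h => by
    have : (1 : ZMod k) ≠ 0 := by
      exact_mod_cast natCast_ne_zero_of_lt (k := k) (a := 1) (by omega) (by omega)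
    rcases h with h | h <;> exact this (by simpa using h)⟩

theorem blowup_adj {V : Type*} {k : ℕ} (hk : 2 ≤ k) (c : V → ZMod k) (u v : V) :
    (blowup hk c).Adj u v ↔ Consec (c u) (c v) := Iff.rfl

theorem blowup_free {V : Type*} {k l : ℕ} (hk : 2 ≤ k) (c : V → ZMod k) (hl : Odd l)
    (hl2 : 2 ≤ l) (hlk : l < k) : (SimpleGraph.cycleGraph l).Free (blowup hk c) := by
  rintro ⟨f⟩
  obtain ⟨e, he⟩ := exists_equiv_cycleGraph l hl2
  have : NeZero l := ⟨by omega⟩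
  apply not_closed_walk_of_odd_lt hl hlk fun i => c (f (e.symm i))
  intro i
  have h1 : (SimpleGraph.cycleGraph l).Adj (e.symm i) (e.symm (i + 1)) := by
    rw [he]; simp
  exact f.toHom.map_adj h1

/-- The colour pattern of a `k`-cycle is one of the `2k` dihedral maps. Conversely, any choice of
vertices following such a pattern is automatically injective. -/
theorem card_cycles_blowup {V : Type*} [Fintype V] {k : ℕ} [NeZero k] (hk : 3 ≤ k)
    (hodd : Odd k) (c : V → ZMod k) :
    (cycles (blowup (by omega : 2 ≤ k) c) k).card
      = 2 * k * ∏ i, (univ.filter fun v => c v = i).card := by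
  rw [card_eq_sum_card_fiberwise (f := fun z i => c (z i)) (t := dihedral k)]
  · rw [sum_congr rfl (g := fun _ => ∏ i, (univ.filter fun v => c v = i).card)]
    · simp [card_dihedral hk]
    · intro t ht
      rw [← card_filter_comp_eq ht]
      congr 1
      ext z
      simp only [mem_filter, mem_cycles, mem_univ, true_and]
      constructor
      · rintro ⟨-, rfl⟩ i
        rfl
      · intro h
        refine ⟨⟨?_, ?_⟩, funext h⟩
        · intro i j hij
          apply (bijective_of_mem_dihedral ht).1
          rw [← h i, ← h j, hij]
        · intro i
          rw [blowup_adj, h, h]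
          exact consec_of_mem_dihedral ht i
  · intro z hz
    have hz := mem_cycles.1 hz
    exact mem_dihedral_of_consec hodd _ fun i => hz.2 i

/-! ### Few edges between the neighbourhoods of the ends of a short path. -/

theorem card_filter_fst_degree_le {V : Type*} [Fintype V] (R : Finset (V × V)) (D : ℕ) :
    (R.filter fun p => (R.filter fun q => q.1 = p.1).card ≤ D).card ≤ D * Fintype.card V := by
  refine card_le_mul_card_image_of_maps_to (f := Prod.fst) (t := univ)
    (fun _ _ => mem_univ _) D ?_
  intro a _
  by_cases h : (R.filter fun q => q.1 = a).card ≤ D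
  · refine (card_le_card ?_).trans h
    intro p hp
    simp only [mem_filter] at hp ⊢
    exact ⟨hp.1.1, hp.2⟩
  · rw [card_eq_zero.2]
    · exact Nat.zero_le _
    · rw [eq_empty_iff_forall_notMem]
      intro p hp
      simp only [mem_filter] at hp
      rw [hp.2] at hp
      exact h hp.1.2

theorem card_filter_snd_degree_le {V : Type*} [Fintype V] (R : Finset (V × V)) (D : ℕ) :
    (R.filter fun p => (R.filter fun q => q.2 = p.2).card ≤ D).card ≤ D * Fintype.card V := by
  refine card_le_mul_card_image_of_maps_to (f := Prod.snd) (t := univ)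
    (fun _ _ => mem_univ _) D ?_
  intro a _
  by_cases h : (R.filter fun q => q.2 = a).card ≤ D
  · refine (card_le_card ?_).trans h
    intro p hp
    simp only [mem_filter] at hp ⊢
    exact ⟨hp.1.1, hp.2⟩
  · rw [card_eq_zero.2]
    · exact Nat.zero_le _
    · rw [eq_empty_iff_forall_notMem]
      intro p hp
      simp only [mem_filter] at hp
      rw [hp.2] at hp
      exact h hp.1.2

theorem exists_mem_fst_notMem {V : Type*} (R : Finset (V × V)) (b : V) (L : Finset V)
    (h : L.card < (R.filter fun q => q.2 = b).card) : ∃ a, (a, b) ∈ R ∧ a ∉ L := by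
  by_contra hcon
  push Not at hcon
  apply absurd h
  rw [not_lt]
  refine card_le_card_of_injOn Prod.fst ?_ ?_
  · intro p hp
    simp only [coe_filter, Set.mem_ofPred_eq] at hp
    exact hcon p.1 (by rw [← hp.2]; exact hp.1)
  · intro p hp q hq hpq
    simp only [coe_filter, Set.mem_ofPred_eq] at hp hq
    exact Prod.ext hpq (hp.2.trans hq.2.symm)

theorem exists_mem_snd_notMem {V : Type*} (R : Finset (V × V)) (a : V) (L : Finset V)
    (h : L.card < (R.filter fun q => q.1 = a).card) : ∃ b, (a, b) ∈ R ∧ b ∉ L := by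
  by_contra hcon
  push Not at hcon
  apply absurd h
  rw [not_lt]
  refine card_le_card_of_injOn Prod.snd ?_ ?_
  · intro p hp
    simp only [coe_filter, Set.mem_ofPred_eq] at hp
    exact hcon p.2 (by rw [← hp.2]; exact hp.1)
  · intro p hp q hq hpq
    simp only [coe_filter, Set.mem_ofPred_eq] at hp hq
    exact Prod.ext (hp.2.trans hq.2.symm) hpq

/-- A dense relation contained in a graph has a long alternating path avoiding a small set. -/
theorem exists_alternating_path {V : Type*} [Fintype V] (G : SimpleGraph V) (F : Finset V) (D : ℕ)
    (j : ℕ) (hD : F.card + 2 * j + 2 ≤ D) (R : Finset (V × V)) (hR : ∀ p ∈ R, G.Adj p.1 p.2)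
    (hcard : (2 * j + 2) * D * Fintype.card V < R.card) :
    ∃ (a b : V) (w : List V), (a, b) ∈ R ∧ w.length = 2 * j ∧ (a :: b :: w).Nodup ∧
      (∀ v ∈ a :: b :: w, v ∉ F) ∧ (a :: b :: w).IsChain G.Adj ∧
      ∀ y ∈ (a :: b :: w).getLast?, ∃ p ∈ R, p.2 = y := by
  induction j generalizing R with
  | zero =>
    have hex : ∃ p ∈ R, p.1 ∉ F ∧ p.2 ∉ F := by
      by_contra hcon
      push Not at hcon
      have : R ⊆ (F ×ˢ univ) ∪ (univ ×ˢ F) := by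
        intro p hp
        simp only [mem_union, mem_product, mem_univ, and_true, true_and]
        by_cases h : p.1 ∈ F
        · exact Or.inl h
        · exact Or.inr (hcon p hp h)
      have h2 := (card_le_card this).trans (card_union_le _ _)
      rw [card_product, card_product, card_univ] at h2
      have : F.card * Fintype.card V ≤ D * Fintype.card V := Nat.mul_le_mul_right _ (by omega)
      nlinarith
    obtain ⟨⟨a, b⟩, hp, ha, hb⟩ := hex
    have hab := hR _ hp
    refine ⟨a, b, [], hp, rfl, ?_, ?_, ?_, ?_⟩
    · simp [hab.ne]
    · simp; exact ⟨ha, hb⟩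
    · simp; exact hab
    · intro y hy
      simp at hy
      exact ⟨_, hp, hy⟩
  | succ j ih =>
    -- Two cleanings, of right ends of small degree in `R` and of left ends of small degree in `R1`,
    -- each cost at most `D * |V|` pairs; this explains the factor `2 * j + 2`. A path obtained in
    -- `R2` is prolonged at its front: `a` has many partners `b1` in `R1`, and each `b1` has many
    -- partners `a1` in `R`.
    set R1 := R.filter fun p => ¬ (R.filter fun q => q.2 = p.2).card ≤ D with hR1
    set R2 := R1.filter fun p => ¬ (R1.filter fun q => q.1 = p.1).card ≤ D with hR2
    have c1 := card_filter_add_card_filter_not (s := R)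
      (fun p => (R.filter fun q => q.2 = p.2).card ≤ D)
    have c2 := card_filter_add_card_filter_not (s := R1)
      (fun p => (R1.filter fun q => q.1 = p.1).card ≤ D)
    have d1 := card_filter_snd_degree_le R D
    have d2 := card_filter_fst_degree_le R1 D
    have hc : (2 * j + 2) * D * Fintype.card V < R2.card := by
      rw [← hR1] at c1
      rw [← hR2] at c2
      have : (2 * (j + 1) + 2) * D * Fintype.card V
        = (2 * j + 2) * D * Fintype.card V + 2 * (D * Fintype.card V) := by ring
      omega
    obtain ⟨a, b, w, hab, hw, hnd, hF, hch, hlast⟩ := ih (by omega) R2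
      (fun p hp => hR p (mem_filter.1 (mem_filter.1 hp).1).1) hc
    have hab2 := (mem_filter.1 hab).2
    set L := F ∪ (a :: b :: w).toFinset with hL
    have hLc : L.card ≤ F.card + (2 * j + 2) := by
      refine (card_union_le _ _).trans ?_
      have := List.toFinset_card_le (a :: b :: w)
      simp only [List.length_cons, hw] at this
      omega
    obtain ⟨b1, hb1, hb1L⟩ := exists_mem_snd_notMem R1 a L (by simp only at hab2; omega)
    have hb12 := (mem_filter.1 hb1).2
    obtain ⟨a1, ha1, ha1L⟩ := exists_mem_fst_notMem R b1 (insert b1 L) (by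
      simp only at hb12
      have := card_insert_le b1 L
      omega)
    have hadj1 := hR _ ha1
    have hadj2 := hR _ (mem_filter.1 hb1).1
    simp only [hL, mem_insert, mem_union, List.mem_toFinset, not_or] at hb1L ha1L
    refine ⟨a1, b1, a :: b :: w, ha1, by simp [hw]; ring, ?_, ?_, ?_, ?_⟩
    · rw [List.nodup_cons, List.nodup_cons]
      refine ⟨?_, hb1L.2, hnd⟩
      rw [List.mem_cons, not_or]
      exact ⟨ha1L.1, ha1L.2.2⟩
    · intro v hv
      rw [List.mem_cons, List.mem_cons] at hv
      rcases hv with rfl | rfl | hv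
      · exact ha1L.2.1
      · exact hb1L.1
      · exact hF v hv
    · rw [List.isChain_cons_cons, List.isChain_cons_cons]
      exact ⟨hadj1, hadj2.symm, hch⟩
    · intro y hy
      rw [List.getLast?_cons_cons, List.getLast?_cons_cons] at hy
      obtain ⟨p, hp, h⟩ := hlast y hy
      exact ⟨p, (mem_filter.1 (mem_filter.1 hp).1).1, h⟩

/-- In a graph without an odd cycle `C_l`, the neighbourhoods of the two ends of a path with an odd
number of vertices, at most `l - 2`, span only linearly many edges. -/
theorem card_adj_pairs_le {V : Type*} [Fintype V] (G : SimpleGraph V) (l : ℕ) (hl : Odd l)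
    (hfree : (SimpleGraph.cycleGraph l).Free G) (x : List V) (hx : Odd x.length)
    (hxl : x.length + 2 ≤ l) (hnd : x.Nodup) (hch : x.IsChain G.Adj) (p q : V)
    (hp : x.head? = some p) (hq : x.getLast? = some q) :
    (univ.filter fun e : V × V => G.Adj p e.1 ∧ G.Adj q e.2 ∧ G.Adj e.1 e.2).card
      ≤ 2 * l ^ 2 * Fintype.card V := by
  by_contra hcon
  push Not at hcon
  obtain ⟨s, hs⟩ := hx
  obtain ⟨t, ht⟩ := hl
  set R := univ.filter fun e : V × V => G.Adj q e.1 ∧ G.Adj p e.2 ∧ G.Adj e.1 e.2 with hR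
  have hRc : R.card = (univ.filter fun e : V × V =>
      G.Adj p e.1 ∧ G.Adj q e.2 ∧ G.Adj e.1 e.2).card := by
    refine card_bij (fun e _ => (e.2, e.1)) ?_ ?_ ?_
    · intro e he
      simp only [hR, mem_filter, mem_univ, true_and] at he ⊢
      exact ⟨he.2.1, he.1, he.2.2.symm⟩
    · intro e _ e' _ h
      simp only [Prod.mk.injEq] at h
      exact Prod.ext h.2 h.1
    · intro e he
      refine ⟨(e.2, e.1), ?_, rfl⟩
      simp only [hR, mem_filter, mem_univ, true_and] at he ⊢
      exact ⟨he.2.1, he.1, he.2.2.symm⟩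
  have hxF := List.toFinset_card_le x
  -- With `l = 2t + 1` and `x` on `2s + 1` vertices, an alternating path on `2(t - s - 1) + 2`
  -- further vertices completes `x` to length `l`. `R` is oriented from the neighbours of `q` to
  -- those of `p`, so the new path starts next to `q` and ends next to `p`.
  obtain ⟨a, b, w, hab, hw, hnd2, hF, hch2, hlast⟩ :=
    exists_alternating_path G x.toFinset (2 * l) (t - s - 1) (by omega) R
      (fun e he => (mem_filter.1 he).2.2.2) (by
        rw [hRc]
        refine lt_of_le_of_lt ?_ hcon
        apply Nat.mul_le_mul_right
        have : 2 * (t - s - 1) + 2 ≤ l := by omega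
        calc _ ≤ l * (2 * l) := Nat.mul_le_mul_right _ this
          _ = _ := by ring)
  refine not_free_cycleGraph_of_list (m := l) (by omega) ((a :: b :: w) ++ x) ?_ ?_ ?_ ?_ hfree
  · simp [hw]; omega
  · rw [List.nodup_append]
    refine ⟨hnd2, hnd, ?_⟩
    rintro v hv u hu rfl
    exact hF v hv (List.mem_toFinset.2 hu)
  · rw [List.isChain_append]
    refine ⟨hch2, hch, ?_⟩
    intro y hy v hv
    rw [hp] at hv
    simp only [Option.mem_def, Option.some.injEq] at hv
    subst hv
    obtain ⟨e, he, rfl⟩ := hlast y hy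
    exact (mem_filter.1 he).2.2.1.symm
  · intro u hu v hv
    rw [List.getLast?_append, hq] at hu
    simp at hu hv
    subst hu hv
    exact (mem_filter.1 hab).2.1

/-! ### Lifting walks on the cycle to paths of a graph with rich classes. -/

/-- There is a walk with `m` steps from `i` to `j` in the cycle on `ZMod k`. -/
def StepReach {k : ℕ} : ℕ → ZMod k → ZMod k → Prop
  | 0, i, j => i = j
  | m + 1, i, j => ∃ i', Consec i i' ∧ StepReach m i' j

theorem StepReach.add_two {k : ℕ} {m : ℕ} {i j : ZMod k} (h : StepReach m i j) :
    StepReach (m + 2) i j :=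
  ⟨i + 1, Or.inl rfl, i, Or.inr rfl, h⟩

theorem StepReach.add_two_mul {k : ℕ} {m : ℕ} {i j : ZMod k} (h : StepReach m i j) (e : ℕ) :
    StepReach (m + 2 * e) i j := by
  induction e with
  | zero => exact h
  | succ e ih => exact ih.add_two

theorem stepReach_add {k : ℕ} (m : ℕ) (i : ZMod k) : StepReach m i (i + m) := by
  induction m generalizing i with
  | zero => simp [StepReach]
  | succ m ih =>
    refine ⟨i + 1, Or.inl rfl, ?_⟩
    have := ih (i + 1)
    push_cast
    convert this using 1
    ring

theorem stepReach_sub {k : ℕ} (m : ℕ) (i : ZMod k) : StepReach m i (i - m) := by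
  induction m generalizing i with
  | zero => simp [StepReach]
  | succ m ih =>
    refine ⟨i - 1, Or.inr (by ring), ?_⟩
    have := ih (i - 1)
    push_cast
    convert this using 1
    ring

/-- One of the two arcs between `i` and `j` is even. Its length is not `k - 1`, since the other arc
is not a single edge, so it can be padded to `k - 3` by back-and-forth steps. -/
theorem stepReach_of_even {k : ℕ} [NeZero k] (hodd : Odd k) (h3 : 3 ≤ k) {i j : ZMod k}
    (h : ¬ Consec i j) : StepReach (k - 3) i j := by
  obtain ⟨t, ht⟩ := hodd
  set d := (j - i).val with hd
  have hdk : d < k := ZMod.val_lt _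
  have hj : j = i + d := by rw [hd, ZMod.natCast_zmod_val]; ring
  have hj' : j = i - ((k - d : ℕ) : ZMod k) := by
    rw [Nat.cast_sub hdk.le, hj]; simp
  have h1 : d ≠ 1 := by
    intro h1; apply h; left; rw [hj, h1]; simp
  have h2 : k - d ≠ 1 := by
    intro h1; apply h; right; rw [hj', h1]; simp
  rcases Nat.even_or_odd' d with ⟨e, he | he⟩
  · have := (stepReach_add d i).add_two_mul (t - 1 - e)
    rw [← hj] at this
    convert this using 1
    omega
  · have := (stepReach_sub (k - d) i).add_two_mul (e - 1)
    rw [← hj'] at this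
    convert this using 1
    omega

/-- The even arc has length neither `0` nor `2`, so the odd one has length at most `k - 4` and can
be padded to it. -/
theorem stepReach_of_odd {k : ℕ} [NeZero k] (hodd : Odd k) (h5 : 5 ≤ k) {i j : ZMod k}
    (h0 : j ≠ i) (h2 : j ≠ i + 2) (h2' : j ≠ i - 2) : StepReach (k - 4) i j := by
  obtain ⟨t, ht⟩ := hodd
  set d := (j - i).val with hd
  have hdk : d < k := ZMod.val_lt _
  have hj : j = i + d := by rw [hd, ZMod.natCast_zmod_val]; ring
  have hj' : j = i - ((k - d : ℕ) : ZMod k) := by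
    rw [Nat.cast_sub hdk.le, hj]; simp
  have c0 : d ≠ 0 := by
    intro h1; apply h0; rw [hj, h1]; simp
  have c2 : d ≠ 2 := by
    intro h1; apply h2; rw [hj, h1]; simp
  have c2' : k - d ≠ 2 := by
    intro h1; apply h2'; rw [hj', h1]; simp
  rcases Nat.even_or_odd' d with ⟨e, he | he⟩
  · have := (stepReach_sub (k - d) i).add_two_mul (e - 2)
    rw [← hj'] at this
    convert this using 1
    omega
  · have := (stepReach_add d i).add_two_mul (t - 2 - e)
    rw [← hj] at this
    convert this using 1
    omega

/-- The vertices of class `i`. -/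
noncomputable def cls {V : Type*} [Fintype V] {k : ℕ} (cl : V → Option (ZMod k)) (i : ZMod k) :
    Finset V :=
  univ.filter fun v => cl v = some i

theorem mem_cls {V : Type*} [Fintype V] {k : ℕ} {cl : V → Option (ZMod k)} {i : ZMod k} {v : V} :
    v ∈ cls cl i ↔ cl v = some i := by simp [cls]

/-- Vertices in the classes next to `i` have many common neighbours in class `i`. -/
def IsRich {V : Type*} [Fintype V] {k : ℕ} (G : SimpleGraph V) (cl : V → Option (ZMod k))
    (M : ℕ) : Prop :=
  ∀ i a b x y, Consec a i → Consec b i → cl x = some a → cl y = some b →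
    M ≤ ((cls cl i).filter fun v => G.Adj x v ∧ G.Adj y v).card

/-- The walk is lifted greedily, each new vertex avoiding `L` and the vertices already used. The
last inner vertex has to be adjacent both to its predecessor and to `y`, which is where codegrees
rather than degrees are needed. -/
theorem IsRich.exists_path {V : Type*} [Fintype V] {k : ℕ} {G : SimpleGraph V}
    {cl : V → Option (ZMod k)} {M : ℕ} (hrich : IsRich G cl M) (m : ℕ) {i j : ZMod k}
    (hr : StepReach (m + 2) i j) {x y : V} (hx : cl x = some i) (hy : cl y = some j)
    (L : Finset V) (hL : L.card + m < M) :
    ∃ w : List V, w.length = m + 1 ∧ w.Nodup ∧ (∀ v ∈ w, v ∉ L) ∧ (x :: w ++ [y]).IsChain G.Adj := by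
  induction m generalizing x i L with
  | zero =>
    obtain ⟨c, hc, c', hc', rfl⟩ := hr
    have h1 := hrich c i c' x y hc hc'.symm hx hy
    obtain ⟨v, hv, hvL⟩ := exists_mem_notMem_of_card_lt_card (lt_of_lt_of_le (by omega) h1)
    simp only [mem_filter] at hv
    refine ⟨[v], rfl, by simp, by simpa using hvL, ?_⟩
    simpa using ⟨hv.2.1, hv.2.2.symm⟩
  | succ m ih =>
    obtain ⟨c, hc, hr⟩ := hr
    -- With `x` taken twice, richness bounds the degree of `x` into class `c`.
    have h1 := hrich c i i x x hc hc hx hx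
    obtain ⟨v, hv, hvL⟩ :=
      exists_mem_notMem_of_card_lt_card (lt_of_lt_of_le (by omega : L.card < M) h1)
    simp only [mem_filter, mem_cls] at hv
    obtain ⟨w, hw, hnd, hwL, hch⟩ := ih hr hv.1 (insert v L) (by
      have := card_insert_le v L
      omega)
    refine ⟨v :: w, by simp [hw], ?_, ?_, ?_⟩
    · rw [List.nodup_cons]
      exact ⟨fun h => hwL v h (mem_insert_self _ _), hnd⟩
    · intro u hu
      rcases List.mem_cons.1 hu with rfl | hu
      · exact hvL
      · exact fun h => hwL u hu (mem_insert_of_mem h)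
    · simp only [List.cons_append] at hch ⊢
      rw [List.isChain_cons_cons]
      exact ⟨hv.2.1, hch⟩

/-- Otherwise a walk of `k - 3` steps lifts to a path from `x` to `y`, which the edge `xy` closes to
a `C_{k-2}`. -/
theorem IsRich.consec_of_adj {V : Type*} [Fintype V] {k : ℕ} [NeZero k] (hk : 7 ≤ k)
    (hodd : Odd k) {G : SimpleGraph V}
    (hfree : (SimpleGraph.cycleGraph (k - 2)).Free G)
    {cl : V → Option (ZMod k)} {M : ℕ} (hM : k ≤ M) (hrich : IsRich G cl M)
    {x y : V} {i j : ZMod k} (hx : cl x = some i) (hy : cl y = some j) (hxy : G.Adj x y) :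
    Consec i j := by
  by_contra hcon
  have hr := stepReach_of_even hodd (by omega) hcon
  obtain ⟨w, hw, hnd, hwL, hch⟩ := hrich.exists_path (k - 5)
    (by convert hr using 1; omega) hx hy {x, y} (by
      have := card_le_two (a := x) (b := y)
      omega)
  simp only [mem_insert, mem_singleton, not_or] at hwL
  refine not_free_cycleGraph_of_list (m := k - 2) (by omega) (x :: w ++ [y]) ?_ ?_ hch ?_ hfree
  · simp [hw]; omega
  · rw [List.cons_append, List.nodup_cons, List.nodup_append]
    refine ⟨?_, hnd, by simp, ?_⟩
    · simp only [List.mem_append, List.mem_singleton, not_or]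
      exact ⟨fun h => (hwL x h).1 rfl, hxy.ne⟩
    · intro a ha b hb
      rw [List.mem_singleton] at hb
      rw [hb]
      exact (hwL a ha).2
  · intro a ha b hb
    rw [List.getLast?_concat] at ha
    simp at ha hb
    subst ha hb
    exact hxy.symm

/-- Otherwise a walk of `k - 4` steps lifts to a path from `x` to `y` avoiding `v`, and `v` closes
it to a `C_{k-2}`. -/
theorem IsRich.class_of_common_neighbor {V : Type*} [Fintype V] {k : ℕ} [NeZero k] (hk : 7 ≤ k)
    (hodd : Odd k) {G : SimpleGraph V}
    (hfree : (SimpleGraph.cycleGraph (k - 2)).Free G)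
    {cl : V → Option (ZMod k)} {M : ℕ} (hM : k ≤ M) (hrich : IsRich G cl M)
    {v x y : V} {i j : ZMod k} (hx : cl x = some i) (hy : cl y = some j) (hvx : G.Adj v x)
    (hvy : G.Adj v y) : j = i ∨ j = i + 2 ∨ j = i - 2 := by
  by_contra hcon
  push Not at hcon
  have hr := stepReach_of_odd hodd (by omega) hcon.1 hcon.2.1 hcon.2.2
  have hxy : x ≠ y := by
    rintro rfl
    rw [hx] at hy
    exact hcon.1 (Option.some.inj hy).symm
  obtain ⟨w, hw, hnd, hwL, hch⟩ := hrich.exists_path (k - 6)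
    (by convert hr using 1; omega) hx hy {v, x, y} (by
      have := card_le_three (a := v) (b := x) (c := y)
      omega)
  simp only [mem_insert, mem_singleton, not_or] at hwL
  refine not_free_cycleGraph_of_list (m := k - 2) (by omega) (v :: (x :: w ++ [y]))
    ?_ ?_ ?_ ?_ hfree
  · simp [hw]; omega
  · rw [List.cons_append, List.nodup_cons, List.nodup_cons, List.nodup_append]
    refine ⟨?_, ?_, hnd, by simp, ?_⟩
    · simp only [List.mem_cons, List.mem_append, List.not_mem_nil, or_false, not_or]
      exact ⟨hvx.ne, fun h => (hwL v h).1 rfl, hvy.ne⟩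
    · simp only [List.mem_append, List.mem_singleton, not_or]
      exact ⟨fun h => (hwL x h).2.1 rfl, hxy⟩
    · intro a ha b hb
      rw [List.mem_singleton] at hb
      rw [hb]
      exact (hwL a ha).2.2
  · rw [List.cons_append, List.isChain_cons_cons]
    exact ⟨hvx, hch⟩
  · intro a ha b hb
    have : (v :: (x :: w ++ [y])).getLast? = some y := by
      rw [← List.cons_append, List.getLast?_concat]
    rw [this] at ha
    simp at ha hb
    subst ha hb
    exact hvy.symm

theorem natCast_sub_ne {k : ℕ} (hk : 7 ≤ k) :
    (2 : ZMod k) ≠ 0 ∧ (4 : ZMod k) ≠ 0 ∧ (6 : ZMod k) ≠ 0 := by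
  refine ⟨?_, ?_, ?_⟩
  · exact_mod_cast natCast_ne_zero_of_lt (k := k) (a := 2) (by omega) (by omega)
  · exact_mod_cast natCast_ne_zero_of_lt (k := k) (a := 4) (by omega) (by omega)
  · exact_mod_cast natCast_ne_zero_of_lt (k := k) (a := 6) (by omega) (by omega)

/-- A set of residues with pairwise differences `0, ±2` consists of at most two residues around a
common centre. -/
theorem exists_center {k : ℕ} (hk : 7 ≤ k) (J : Set (ZMod k))
    (hJ : ∀ i ∈ J, ∀ j ∈ J, j = i ∨ j = i + 2 ∨ j = i - 2) :
    ∃ c, ∀ j ∈ J, j = c + 1 ∨ j = c - 1 := by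
  obtain ⟨h2, h4, h6⟩ := natCast_sub_ne hk
  by_cases hex : ∃ i ∈ J, i + 2 ∈ J
  · obtain ⟨i, hi, hi2⟩ := hex
    refine ⟨i + 1, fun j hj => ?_⟩
    rcases hJ i hi j hj with h | h | h
    · right; rw [h]; ring
    · left; rw [h]; ring
    · exfalso
      rcases hJ _ hi2 j hj with h' | h' | h'
      · apply h4; linear_combination h - h'
      · apply h6; linear_combination h - h'
      · apply h2; linear_combination h - h'
  · push Not at hex
    rcases J.eq_empty_or_nonempty with rfl | ⟨i, hi⟩
    · exact ⟨0, fun j hj => absurd hj (by simp)⟩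
    · refine ⟨i - 1, fun j hj => ?_⟩
      rcases hJ i hi j hj with h | h | h
      · left; rw [h]; ring
      · exact absurd (h ▸ hj) (hex i hi)
      · exfalso
        apply hex j hj
        have : j + 2 = i := by rw [h]; ring
        rwa [this]

theorem IsRich.exists_class {V : Type*} [Fintype V] {k : ℕ} [NeZero k] (hk : 7 ≤ k)
    (hodd : Odd k) {G : SimpleGraph V}
    (hfree : (SimpleGraph.cycleGraph (k - 2)).Free G)
    {cl : V → Option (ZMod k)} {M : ℕ} (hM : k ≤ M) (hrich : IsRich G cl M) (v : V) :
    ∃ c : ZMod k, ∀ x j, G.Adj v x → cl x = some j → Consec c j := by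
  obtain ⟨c, hc⟩ := exists_center hk {j | ∃ x, G.Adj v x ∧ cl x = some j} (by
    rintro i ⟨x, hvx, hx⟩ j ⟨y, hvy, hy⟩
    exact hrich.class_of_common_neighbor hk hodd hfree hM hx hy hvx hvy)
  refine ⟨c, fun x j hvx hx => ?_⟩
  rcases hc j ⟨x, hvx, hx⟩ with h | h
  · exact Or.inl h
  · right; rw [h]; ring

/-! ### From a near blow-up to an exact homomorphism into the cycle. -/

theorem card_le_of_dihedral {V : Type*} [Fintype V] {k : ℕ} [NeZero k] (hk : 3 ≤ k)
    (Z : Finset (ZMod k → V)) (X : ZMod k → Finset V)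
    (hZ : ∀ z ∈ Z, ∃ t ∈ dihedral k, ∀ i, z i ∈ X (t i)) :
    Z.card ≤ 2 * k * ∏ i, (X i).card := by
  have h1 : Z ⊆ (dihedral k).biUnion fun t =>
      univ.filter fun z : ZMod k → V => ∀ i, z i ∈ X (t i) := by
    intro z hz
    obtain ⟨t, ht, h⟩ := hZ z hz
    rw [mem_biUnion]
    exact ⟨t, ht, by simpa using h⟩
  refine (card_le_card h1).trans (card_biUnion_le.trans ?_)
  rw [sum_congr rfl fun t ht => card_filter_comp_eq ht X, sum_const, card_dihedral hk, smul_eq_mul]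

theorem card_filter_apply_pair_le {V ι : Type*} [Fintype V] [Fintype ι] [DecidableEq ι] {i j : ι}
    (hij : i ≠ j) (E : Finset (V × V)) :
    (univ.filter fun z : ι → V => (z i, z j) ∈ E).card
      ≤ E.card * Fintype.card V ^ (Fintype.card ι - 2) := by
  rw [mul_comm]
  refine card_le_mul_card_image_of_maps_to (f := fun z : ι → V => (z i, z j)) (t := E)
    (fun z hz => (mem_filter.1 hz).2) _ ?_
  rintro ⟨a, b⟩ -
  have : (filter (fun z : ι → V => (z i, z j) = (a, b))
      (univ.filter fun z : ι → V => (z i, z j) ∈ E))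
      ⊆ Fintype.piFinset fun l => if l = i then {a} else if l = j then {b} else univ := by
    intro z hz
    simp only [mem_filter, mem_univ, true_and, Prod.mk.injEq] at hz
    rw [Fintype.mem_piFinset]
    intro l
    split_ifs with h1 h2
    · subst h1; simp [hz.2.1]
    · subst h2; simp [hz.2.2]
    · simp
  refine (card_le_card this).trans ?_
  rw [Fintype.card_piFinset, ← mul_prod_erase univ _ (mem_univ i),
    ← mul_prod_erase (univ.erase i) _ (mem_erase.2 ⟨hij.symm, mem_univ j⟩)]
  simp only [if_pos, hij.symm, if_false, card_singleton, one_mul]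
  rw [prod_congr rfl (g := fun _ => Fintype.card V)]
  · rw [prod_const, card_erase_of_mem (mem_erase.2 ⟨hij.symm, mem_univ j⟩),
      card_erase_of_mem (mem_univ i), card_univ, Nat.sub_sub]
  · intro l hl
    simp only [mem_erase, mem_univ, and_true] at hl
    rw [if_neg hl.2, if_neg hl.1, card_univ]

theorem card_filter_apply_mem_le {V ι : Type*} [Fintype V] [Fintype ι] [DecidableEq ι] (i : ι) (B : Finset V) :
    (univ.filter fun z : ι → V => z i ∈ B).card
      ≤ B.card * Fintype.card V ^ (Fintype.card ι - 1) := by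
  have : (univ.filter fun z : ι → V => z i ∈ B)
      = Fintype.piFinset fun l => if l = i then B else univ := by
    ext z
    simp only [mem_filter, mem_univ, true_and, Fintype.mem_piFinset]
    constructor
    · intro h l
      split_ifs with h1
      · rw [h1]; exact h
      · simp
    · intro h; simpa using h i
  rw [this, Fintype.card_piFinset, ← mul_prod_erase univ _ (mem_univ i)]
  simp only [if_pos]
  rw [prod_congr rfl (g := fun _ => Fintype.card V)]
  · rw [prod_const, card_erase_of_mem (mem_univ i), card_univ]
  · intro l hl
    rw [if_neg (mem_erase.1 hl).1, card_univ]

/-- `G` is close to a balanced blow-up of the cycle, with classes given by `cl`. -/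
structure IsNear {V : Type*} [Fintype V] {k : ℕ} (G : SimpleGraph V)
    (cl : V → Option (ZMod k)) (γ : ℝ) : Prop where
  size : ∀ i, (1 / k - γ) * Fintype.card V ≤ ((cls cl i).card : ℝ)
  miss : ∀ v i j, cl v = some i → Consec i j →
    (((cls cl j).filter fun u => ¬ G.Adj v u).card : ℝ) ≤ γ * Fintype.card V

/-- Two vertices miss at most `2γn` of a class of size at least `(1/k - γ)n`. What remains is at
least `(1/k - 3γ)n ≥ n/(2k) ≥ k`. -/
theorem IsNear.isRich {V : Type*} [Fintype V] {k : ℕ} {G : SimpleGraph V}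
    {cl : V → Option (ZMod k)} {γ : ℝ} (h : IsNear G cl γ) (hk : 0 < k) (hγ : γ ≤ 1 / (6 * k))
    (hn : 2 * k ^ 2 ≤ Fintype.card V) : IsRich G cl k := by
  intro i a b x y ha hb hx hy
  have h1 := h.size i
  have h2 := h.miss x a i hx ha
  have h3 := h.miss y b i hy hb
  have h4 : (cls cl i).card ≤ ((cls cl i).filter fun v => G.Adj x v ∧ G.Adj y v).card
      + (((cls cl i).filter fun u => ¬ G.Adj x u).card
        + ((cls cl i).filter fun u => ¬ G.Adj y u).card) := by
    refine le_trans (card_le_card ?_) ((card_union_le _ _).trans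
      (Nat.add_le_add_left (card_union_le _ _) _))
    intro v hv
    simp only [mem_union, mem_filter, hv, true_and]
    tauto
  have h4' : ((cls cl i).card : ℝ) ≤ ((cls cl i).filter fun v => G.Adj x v ∧ G.Adj y v).card
      + (((cls cl i).filter fun u => ¬ G.Adj x u).card
        + ((cls cl i).filter fun u => ¬ G.Adj y u).card) := by exact_mod_cast h4
  have hk' : (0 : ℝ) < k := by exact_mod_cast hk
  have hn' : (2 * k ^ 2 : ℝ) ≤ Fintype.card V := by exact_mod_cast hn
  have h5 : (1 / (2 * k) : ℝ) ≤ 1 / k - 3 * γ := by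
    have : (1 / (2 * k) : ℝ) = 1 / k - 3 * (1 / (6 * k)) := by field_simp; norm_num
    rw [this]; linarith
  have h6 : (k : ℝ) ≤ 1 / (2 * k) * Fintype.card V := by
    rw [div_mul_eq_mul_div, one_mul, le_div_iff₀ (by positivity)]
    nlinarith
  have h7 : (1 / (2 * k) : ℝ) * Fintype.card V ≤ (1 / k - 3 * γ) * Fintype.card V :=
    mul_le_mul_of_nonneg_right h5 (by positivity)
  have : (k : ℝ) ≤ ((cls cl i).filter fun v => G.Adj x v ∧ G.Adj y v).card := by nlinarith
  exact_mod_cast this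

theorem sum_card_cls {V : Type*} [Fintype V] {k : ℕ} [NeZero k] (cl : V → Option (ZMod k)) :
    ∑ i, (cls cl i).card + (univ.filter fun v => cl v = none).card = Fintype.card V := by
  rw [← card_univ (α := V), card_eq_sum_card_fiberwise (s := univ) (f := cl) (t := univ)
    (fun _ _ => mem_univ _), Fintype.sum_option, add_comm]
  rfl

theorem card_none_le_of_le_card_cls {V : Type*} [Fintype V] {k : ℕ} [NeZero k]
    {cl : V → Option (ZMod k)} {γ : ℝ}
    (h : ∀ i, (1 / k - γ) * Fintype.card V ≤ ((cls cl i).card : ℝ)) :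
    ((univ.filter fun v => cl v = none).card : ℝ) ≤ k * γ * Fintype.card V := by
  have h1 := sum_card_cls cl
  have h1' : ∑ i, ((cls cl i).card : ℝ) + ((univ.filter fun v => cl v = none).card : ℝ)
    = Fintype.card V := by exact_mod_cast h1
  have h2 : ∑ i : ZMod k, (1 / k - γ) * Fintype.card V ≤ ∑ i, ((cls cl i).card : ℝ) :=
    sum_le_sum fun i _ => h i
  rw [sum_const, card_univ, ZMod.card, nsmul_eq_mul] at h2
  have hk : (k : ℝ) ≠ 0 := by exact_mod_cast NeZero.ne k
  have h3 : (k : ℝ) * ((1 / k - γ) * Fintype.card V)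
    = Fintype.card V - k * γ * Fintype.card V := by field_simp
  linarith

theorem card_cls_le_of_le_card_cls {V : Type*} [Fintype V] {k : ℕ} [NeZero k]
    {cl : V → Option (ZMod k)} {γ : ℝ}
    (h : ∀ i, (1 / k - γ) * Fintype.card V ≤ ((cls cl i).card : ℝ)) (hγ : 0 ≤ γ) (i : ZMod k) :
    ((cls cl i).card : ℝ) ≤ (1 / k + k * γ) * Fintype.card V := by
  have h1 := sum_card_cls cl
  have h1' : ∑ i, ((cls cl i).card : ℝ) + ((univ.filter fun v => cl v = none).card : ℝ)
    = Fintype.card V := by exact_mod_cast h1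
  rw [← add_sum_erase univ _ (mem_univ i)] at h1'
  have h2 : ∑ i ∈ univ.erase i, (1 / k - γ) * Fintype.card V
      ≤ ∑ i ∈ univ.erase i, ((cls cl i).card : ℝ) :=
    sum_le_sum fun i _ => h i
  have hk0 : 1 ≤ k := NeZero.one_le
  rw [sum_const, card_erase_of_mem (mem_univ i), card_univ, ZMod.card, nsmul_eq_mul,
    Nat.cast_sub hk0] at h2
  push_cast at h2
  have hk : (k : ℝ) ≠ 0 := by exact_mod_cast NeZero.ne k
  have h3 : ((k : ℝ) - 1) * ((1 / k - γ) * Fintype.card V)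
    = Fintype.card V - (1 / k + k * γ) * Fintype.card V + γ * Fintype.card V := by
    field_simp; ring
  have h4 : 0 ≤ γ * Fintype.card V := by positivity
  have h5 : (0 : ℝ) ≤ (univ.filter fun v => cl v = none).card := by positivity
  linarith

/-- Put every unclassified vertex missing few neighbours next to some class into that class. -/
noncomputable def extendClass {V : Type*} [Fintype V] {k : ℕ} (G : SimpleGraph V)
    (cl : V → Option (ZMod k)) (δ : ℝ) (v : V) : Option (ZMod k) :=
  if cl v ≠ none then cl v else
    if h : ∃ i, ∀ j, Consec i j →
        (((cls cl j).filter fun u => ¬ G.Adj v u).card : ℝ) ≤ δ * Fintype.card V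
    then some h.choose else none

theorem extendClass_of_some {V : Type*} [Fintype V] {k : ℕ} {G : SimpleGraph V}
    {cl : V → Option (ZMod k)} {δ : ℝ} {v : V} {i : ZMod k} (h : cl v = some i) :
    extendClass G cl δ v = some i := by
  unfold extendClass
  rw [if_pos (by simp [h]), h]

theorem extendClass_eq_none {V : Type*} [Fintype V] {k : ℕ} {G : SimpleGraph V}
    {cl : V → Option (ZMod k)} {δ : ℝ} {v : V} (h : extendClass G cl δ v = none) :
    cl v = none ∧ ∀ i, ∃ j, Consec i j ∧
      δ * Fintype.card V < (((cls cl j).filter fun u => ¬ G.Adj v u).card : ℝ) := by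
  unfold extendClass at h
  split_ifs at h with h1 h2
  · exact absurd h h1
  · refine ⟨by simpa using h1, ?_⟩
    push Not at h2
    exact h2

theorem extendClass_miss {V : Type*} [Fintype V] {k : ℕ} {G : SimpleGraph V}
    {cl : V → Option (ZMod k)} {γ δ : ℝ} (hγδ : γ ≤ δ) (hn : IsNear G cl γ) {v : V} {i : ZMod k}
    (h : extendClass G cl δ v = some i) (j : ZMod k) (hj : Consec i j) :
    (((cls cl j).filter fun u => ¬ G.Adj v u).card : ℝ) ≤ δ * Fintype.card V := by
  unfold extendClass at h
  split_ifs at h with h1 h2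
  · exact (hn.miss v i j h hj).trans (mul_le_mul_of_nonneg_right hγδ (by positivity))
  · have := h2.choose_spec
    rw [Option.some.inj h] at this
    exact this j hj

/-- A vertex misses at most `δn` in an old class; the enlarged class adds only previously
unclassified vertices, of which there are at most `kγn`. -/
theorem IsNear.extend {V : Type*} [Fintype V] {k : ℕ} [NeZero k] {G : SimpleGraph V}
    {cl : V → Option (ZMod k)} {γ δ : ℝ} (hγδ : γ ≤ δ) (hγ : 0 ≤ γ) (hn : IsNear G cl γ) :
    IsNear G (extendClass G cl δ) (δ + k * γ) where
  size i := by
    have h1 : (cls cl i).card ≤ (cls (extendClass G cl δ) i).card := by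
      apply card_le_card
      intro v hv
      rw [mem_cls] at hv ⊢
      exact extendClass_of_some hv
    have h1' : ((cls cl i).card : ℝ) ≤ (cls (extendClass G cl δ) i).card := by exact_mod_cast h1
    refine (le_trans ?_ (hn.size i)).trans h1'
    apply mul_le_mul_of_nonneg_right _ (by positivity)
    have : 0 ≤ (k : ℝ) * γ := by positivity
    linarith
  miss v i j hv hij := by
    have h1 := extendClass_miss hγδ hn hv j hij
    have h2 := card_none_le_of_le_card_cls hn.size
    have h3 : (((cls (extendClass G cl δ) j).filter fun u => ¬ G.Adj v u).card)
        ≤ ((cls cl j).filter fun u => ¬ G.Adj v u).card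
          + (univ.filter fun v => cl v = none).card := by
      refine le_trans (card_le_card ?_) (card_union_le _ _)
      intro u hu
      simp only [mem_union, mem_filter, mem_univ, true_and, mem_cls] at hu ⊢
      cases hc : cl u with
      | none => right; rfl
      | some a =>
        left
        rw [extendClass_of_some hc] at hu
        exact ⟨hu.1, hu.2⟩
    have h3' : (((cls (extendClass G cl δ) j).filter fun u => ¬ G.Adj v u).card : ℝ)
        ≤ ((cls cl j).filter fun u => ¬ G.Adj v u).card
          + (univ.filter fun v => cl v = none).card := by exact_mod_cast h3
    linarith

theorem consec_succ_of_consec_dihedral {k : ℕ} [NeZero k] {t : ZMod k → ZMod k}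
    (ht : t ∈ dihedral k) {i j : ZMod k} (h : Consec (t i) (t j)) : Consec i j := by
  rw [mem_dihedral] at ht
  unfold Consec at *
  rcases ht with ht | ht
  · rw [ht i, ht j] at h
    rcases h with h | h
    · left; linear_combination h
    · right; linear_combination h
  · rw [ht i, ht j] at h
    rcases h with h | h
    · right; linear_combination h
    · left; linear_combination h

/-- Labelled cycles all of whose vertices are classified. -/
theorem card_cycles_classified_le {V : Type*} [Fintype V] {k : ℕ} [NeZero k] (hk : 3 ≤ k)
    (hodd : Odd k) {G : SimpleGraph V} {cl : V → Option (ZMod k)}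
    (hcons : ∀ x y i j, cl x = some i → cl y = some j → G.Adj x y → Consec i j)
    (Z : Finset (ZMod k → V)) (hZ : Z ⊆ cycles G k) (hcl : ∀ z ∈ Z, ∀ i, cl (z i) ≠ none) :
    Z.card ≤ 2 * k * ∏ i, (cls cl i).card := by
  apply card_le_of_dihedral hk
  intro z hz
  have hcy := mem_cycles.1 (hZ hz)
  have hex : ∀ i, ∃ a, cl (z i) = some a := fun i => Option.ne_none_iff_exists'.1 (hcl z hz i)
  choose t ht using hex
  refine ⟨t, mem_dihedral_of_consec hodd t fun i => ?_, fun i => mem_cls.2 (ht i)⟩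
  exact hcons _ _ _ _ (ht i) (ht (i + 1)) (hcy.2 i)

/-- Give `v` the colour `c`. The colour pattern is then dihedral, so only `v` has colour `c`, and if
`b` is next to `c` the vertex of colour `b` is next to `v` on the cycle, hence a neighbour of `v`.
The clause `Consec c b` makes the bound valid for every `b`. -/
theorem card_cycles_through_le {V : Type*} [Fintype V] {k : ℕ} [NeZero k] (hk : 3 ≤ k)
    (hodd : Odd k) {G : SimpleGraph V} {cl : V → Option (ZMod k)}
    (hcons : ∀ x y i j, cl x = some i → cl y = some j → G.Adj x y → Consec i j)
    (v : V) (c : ZMod k) (hc : ∀ x j, G.Adj v x → cl x = some j → Consec c j)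
    (Z : Finset (ZMod k → V)) (hZ : Z ⊆ cycles G k)
    (hcl : ∀ z ∈ Z, ∃ j, z j = v ∧ ∀ l ≠ j, cl (z l) ≠ none) (b : ZMod k) :
    Z.card ≤ 2 * k * ∏ i, (if i = c then {v} else if i = b ∧ Consec c b then
      (cls cl b).filter fun u => G.Adj v u else cls cl i).card := by
  apply card_le_of_dihedral hk
  intro z hz
  have hcy := mem_cycles.1 (hZ hz)
  obtain ⟨j, rfl, hl⟩ := hcl z hz
  have hex : ∀ i, ∃ a, (i = j ∧ a = c) ∨ (i ≠ j ∧ cl (z i) = some a) := by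
    intro i
    by_cases h : i = j
    · exact ⟨c, Or.inl ⟨h, rfl⟩⟩
    · obtain ⟨a, ha⟩ := Option.ne_none_iff_exists'.1 (hl i h)
      exact ⟨a, Or.inr ⟨h, ha⟩⟩
  choose t ht using hex
  have htj : t j = c := by
    rcases ht j with h | h
    · exact h.2
    · exact absurd rfl h.1
  have ht' : ∀ i, i ≠ j → cl (z i) = some (t i) := by
    intro i hi
    rcases ht i with h | h
    · exact absurd h.1 hi
    · exact h.2
  have h1 : (1 : ZMod k) ≠ 0 := by
    exact_mod_cast natCast_ne_zero_of_lt (k := k) (a := 1) (by omega) (by omega)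
  have hdi : t ∈ dihedral k := by
    apply mem_dihedral_of_consec hodd t
    intro i
    by_cases hi : i = j
    · subst hi
      have hi' : i + 1 ≠ i := by simpa using h1
      rw [htj]
      exact hc _ _ (hcy.2 i) (ht' _ hi')
    · by_cases hi2 : i + 1 = j
      · subst hi2
        rw [htj]
        exact (hc _ _ (hcy.2 i).symm (ht' _ hi)).symm
      · exact hcons _ _ _ _ (ht' _ hi) (ht' _ hi2) (hcy.2 i)
  refine ⟨t, hdi, fun i => ?_⟩
  by_cases hi : i = j
  · subst hi; simp [htj]
  · have htc : t i ≠ c := by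
      rw [← htj]
      exact fun h => hi ((bijective_of_mem_dihedral hdi).1 h)
    rw [if_neg htc]
    split_ifs with hb
    · rw [mem_filter, mem_cls, ← hb.1]
      refine ⟨ht' i hi, ?_⟩
      have : Consec (t j) (t i) := by rw [htj, hb.1]; exact hb.2
      rcases consec_succ_of_consec_dihedral hdi this with h | h
      · rw [h]; exact hcy.2 j
      · rw [h]; exact (hcy.2 i).symm
    · exact mem_cls.2 (ht' i hi)

theorem card_cycles_two_le {V : Type*} [Fintype V] {k : ℕ} [NeZero k] (v : V) (B : Finset V)
    (Z : Finset (ZMod k → V)) (hZ : ∀ z ∈ Z, ∃ j l, j ≠ l ∧ z j = v ∧ z l ∈ B) :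
    Z.card ≤ k ^ 2 * (B.card * Fintype.card V ^ (k - 2)) := by
  have : Z ⊆ (univ : Finset (ZMod k × ZMod k)).biUnion fun p =>
      if p.1 = p.2 then ∅ else univ.filter fun z : ZMod k → V => (z p.1, z p.2) ∈ {v} ×ˢ B := by
    intro z hz
    obtain ⟨j, l, hjl, h1, h2⟩ := hZ z hz
    rw [mem_biUnion]
    refine ⟨(j, l), mem_univ _, ?_⟩
    rw [if_neg hjl]
    simp [h1, h2]
  refine (card_le_card this).trans (card_biUnion_le.trans ?_)
  refine (sum_le_card_nsmul _ _ (B.card * Fintype.card V ^ (k - 2)) ?_).trans ?_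
  · rintro ⟨j, l⟩ -
    split_ifs with h
    · simp
    · have := card_filter_apply_pair_le (V := V) h ({v} ×ˢ B)
      rw [card_product, card_singleton, one_mul, ZMod.card] at this
      exact this
  · rw [card_univ, Fintype.card_prod, ZMod.card, smul_eq_mul, sq]

theorem prod_erase_two {k : ℕ} [NeZero k] (f : ZMod k → ℝ) (a b : ZMod k)
    (hab : a ≠ b) (A B C : ℝ) (hf : ∀ i, 0 ≤ f i) (ha : f a ≤ A) (hb : f b ≤ B)
    (hC : ∀ i, i ≠ a → i ≠ b → f i ≤ C) : ∏ i, f i ≤ A * B * C ^ (k - 2) := by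
  rw [← mul_prod_erase univ _ (mem_univ a),
    ← mul_prod_erase (univ.erase a) _ (mem_erase.2 ⟨hab.symm, mem_univ b⟩), ← mul_assoc]
  have h1 : ∏ i ∈ (univ.erase a).erase b, f i ≤ C ^ (k - 2) := by
    refine (prod_le_prod (fun i _ => hf i) (g := fun _ => C) (fun i hi => ?_)).trans
      (le_of_eq ?_)
    · simp only [mem_erase, mem_univ, and_true] at hi
      exact hC i hi.2 hi.1
    · rw [prod_const, card_erase_of_mem (mem_erase.2 ⟨hab.symm, mem_univ b⟩),
        card_erase_of_mem (mem_univ a), card_univ, ZMod.card, Nat.sub_sub]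
  have hA := (hf a).trans ha
  have hB := (hf b).trans hb
  exact mul_le_mul (mul_le_mul ha hb (hf b) hA) h1 (prod_nonneg fun i _ => hf i)
    (mul_nonneg hA hB)

/-- There are two scales: `γ` for the given partition and the larger `δ` for admitting further
vertices. A vertex still left over lacks more than `δn` neighbours next to every class, so it lies
on distinctly fewer cycles than a vertex of a class; `hstrict` compares the two counts, divided by
`n^(k-1)`. Moving all leftover vertices into one class of a blow-up would therefore increase the
number of cycles. -/
theorem exists_classes_of_isNear {V : Type*} [Fintype V] {k : ℕ} [NeZero k] (hk : 7 ≤ k)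
    (hodd : Odd k) {G : SimpleGraph V} (hfree : (SimpleGraph.cycleGraph (k - 2)).Free G)
    (hmax : ∀ c : V → ZMod k, (cycles (blowup (by omega : 2 ≤ k) c) k).card ≤ (cycles G k).card)
    {cl : V → Option (ZMod k)} {γ δ : ℝ} (hγ : 0 < γ) (hγδ : γ ≤ δ)
    (hδ : δ + k * γ ≤ 1 / (6 * k))
    (hstrict : 2 * k * ((1 / k + k * γ - δ) * (1 / k + k * γ) ^ (k - 2)) + k ^ 3 * γ
      < 2 * k * (1 / k - γ) ^ (k - 1))
    (hnear : IsNear G cl γ) (hn : 2 * k ^ 2 ≤ Fintype.card V) :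
    ∃ c : V → ZMod k, ∀ u v, G.Adj u v → Consec (c u) (c v) := by
  set n := Fintype.card V with hn_def
  set q := extendClass G cl δ with hq
  have hk0 : 0 < k := by omega
  have hkR : (0 : ℝ) < k := by exact_mod_cast hk0
  have hn0 : 0 < n := by
    have : 0 < k ^ 2 := by positivity
    omega
  have hnR : (0 : ℝ) < n := by exact_mod_cast hn0
  have hqnear : IsNear G q (δ + k * γ) := hnear.extend hγδ hγ.le
  have hrich : IsRich G q k := hqnear.isRich hk0 hδ hn
  have hcons : ∀ x y i j, q x = some i → q y = some j → G.Adj x y → Consec i j :=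
    fun x y i j hx hy hxy => hrich.consec_of_adj hk hodd hfree le_rfl hx hy hxy
  have hsub : ∀ i, cls cl i ⊆ cls q i := fun i v hv => by
    rw [mem_cls] at hv ⊢
    exact extendClass_of_some hv
  have hsize : ∀ i, (1 / k - γ) * n ≤ ((cls q i).card : ℝ) := fun i =>
    (hnear.size i).trans (by exact_mod_cast card_le_card (hsub i))
  have hupper := card_cls_le_of_le_card_cls hsize hγ.le
  have hnone := card_none_le_of_le_card_cls hsize
  set B := univ.filter fun v => q v = none with hB
  rcases B.eq_empty_or_nonempty with hBe | hBne
  · have hex : ∀ v, ∃ a, q v = some a := by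
      intro v
      apply Option.ne_none_iff_exists'.1
      intro h
      have : v ∈ B := by simp [hB, h]
      rw [hBe] at this
      simp at this
    choose c hc using hex
    exact ⟨c, fun u v huv => hcons u v _ _ (hc u) (hc v) huv⟩
  exfalso
  -- cycles avoiding `B`, meeting `B` once, and meeting `B` at least twice
  set Z0 := (cycles G k).filter fun z => ∀ i, q (z i) ≠ none with hZ0
  let Z1 : V → Finset (ZMod k → V) := fun v =>
    (cycles G k).filter fun z => ∃ j, z j = v ∧ ∀ l ≠ j, q (z l) ≠ none
  let Z2 : V → Finset (ZMod k → V) := fun v =>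
    (cycles G k).filter fun z => ∃ j l, j ≠ l ∧ z j = v ∧ z l ∈ B
  have hcover : cycles G k ⊆ Z0 ∪ B.biUnion fun v => Z1 v ∪ Z2 v := by
    intro z hz
    rw [mem_union]
    by_cases h : ∀ i, q (z i) ≠ none
    · left; rw [hZ0, mem_filter]; exact ⟨hz, h⟩
    · right
      push Not at h
      obtain ⟨j, hj⟩ := h
      rw [mem_biUnion]
      refine ⟨z j, by simp [hB, hj], ?_⟩
      rw [mem_union]
      by_cases h2 : ∀ l ≠ j, q (z l) ≠ none
      · left; exact mem_filter.2 ⟨hz, j, rfl, h2⟩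
      · right
        push Not at h2
        obtain ⟨l, hlj, hl⟩ := h2
        exact mem_filter.2 ⟨hz, j, l, hlj.symm, rfl, by simp [hB, hl]⟩
  -- The first term bounds the cycles through a vertex of `B` that are otherwise classified, the
  -- second those that meet `B` again.
  set W : ℝ := 2 * k * ((1 / k + k * γ - δ) * (1 / k + k * γ) ^ (k - 2) * n ^ (k - 1))
    + k ^ 3 * γ * n ^ (k - 1) with hW
  have hpow : (n : ℝ) ^ (k - 1) = n * n ^ (k - 2) := by
    rw [← pow_succ']; congr 1; omega
  have h0 : Z0.card ≤ 2 * k * ∏ i, (cls q i).card :=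
    card_cycles_classified_le (by omega) hodd hcons Z0 (filter_subset _ _)
      (fun z hz => (mem_filter.1 hz).2)
  have h12 : ∀ v ∈ B, (((Z1 v ∪ Z2 v).card : ℕ) : ℝ) ≤ W := by
    intro v hv
    have hv' : q v = none := by simpa [hB] using hv
    obtain ⟨c, hc⟩ := hrich.exists_class hk hodd hfree le_rfl v
    obtain ⟨b, hcb, hb⟩ := (extendClass_eq_none hv').2 c
    have hcb' : c ≠ b := by
      have h1 : (1 : ZMod k) ≠ 0 := by
        exact_mod_cast natCast_ne_zero_of_lt (k := k) (a := 1) (by omega) (by omega)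
      rintro rfl
      rcases hcb with h | h <;> exact h1 (by simpa using h)
    have h1 := card_cycles_through_le (by omega : 3 ≤ k) hodd hcons v c hc (Z1 v)
      (filter_subset _ _) (fun z hz => (mem_filter.1 hz).2) b
    have h2 := card_cycles_two_le v B (Z2 v) (fun z hz => (mem_filter.1 hz).2)
    have hnb : (((cls q b).filter fun u => G.Adj v u).card : ℝ) ≤ (1 / k + k * γ - δ) * n := by
      have e1 := card_filter_add_card_filter_not (s := cls q b) (fun u => G.Adj v u)
      have e2 : ((cls cl b).filter fun u => ¬ G.Adj v u).card
        ≤ ((cls q b).filter fun u => ¬ G.Adj v u).card :=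
        card_le_card (filter_subset_filter _ (hsub b))
      have e1' : (((cls q b).filter fun u => G.Adj v u).card : ℝ)
        + ((cls q b).filter fun u => ¬ G.Adj v u).card = (cls q b).card := by exact_mod_cast e1
      have e2' : (((cls cl b).filter fun u => ¬ G.Adj v u).card : ℝ)
        ≤ ((cls q b).filter fun u => ¬ G.Adj v u).card := by exact_mod_cast e2
      have := hupper b
      linarith
    have h1' : ((Z1 v).card : ℝ) ≤ 2 * k * (1 * ((1 / k + k * γ - δ) * n)
        * ((1 / k + k * γ) * n) ^ (k - 2)) := by
      have h1R : ((Z1 v).card : ℝ) ≤ 2 * k * ∏ i, ((if i = c then {v} else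
          if i = b ∧ Consec c b then (cls q b).filter fun u => G.Adj v u
          else cls q i : Finset V).card : ℝ) := by exact_mod_cast h1
      refine h1R.trans (mul_le_mul_of_nonneg_left ?_ (by positivity))
      apply prod_erase_two _ c b hcb'
      · intro i; positivity
      · simp
      · rw [if_neg hcb'.symm, if_pos ⟨rfl, hcb⟩]; exact hnb
      · intro i hic hib
        rw [if_neg hic, if_neg (fun h => hib h.1)]
        exact hupper i
    have h2' : ((Z2 v).card : ℝ) ≤ k ^ 3 * γ * n ^ (k - 1) := by
      have h2R : ((Z2 v).card : ℝ) ≤ k ^ 2 * (B.card * n ^ (k - 2)) := by exact_mod_cast h2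
      refine h2R.trans ?_
      have : (B.card : ℝ) * n ^ (k - 2) ≤ (k * γ * n) * n ^ (k - 2) :=
        mul_le_mul_of_nonneg_right hnone (by positivity)
      calc (k : ℝ) ^ 2 * (B.card * n ^ (k - 2)) ≤ k ^ 2 * ((k * γ * n) * n ^ (k - 2)) :=
            mul_le_mul_of_nonneg_left this (by positivity)
        _ = _ := by rw [hpow]; ring
    have h3 : (((Z1 v ∪ Z2 v).card : ℕ) : ℝ) ≤ (Z1 v).card + (Z2 v).card := by
      exact_mod_cast card_union_le _ _
    refine h3.trans ((add_le_add h1' h2').trans (le_of_eq ?_))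
    rw [hW, hpow, mul_pow]; ring
  have hL : ((cycles G k).card : ℝ) ≤ 2 * k * ∏ i, ((cls q i).card : ℝ) + B.card * W := by
    have e1 := (card_le_card hcover).trans (card_union_le _ _)
    have e1' : ((cycles G k).card : ℝ) ≤ Z0.card
      + ((B.biUnion fun v => Z1 v ∪ Z2 v).card : ℕ) := by exact_mod_cast e1
    have e2 : ((B.biUnion fun v => Z1 v ∪ Z2 v).card : ℝ)
        ≤ ∑ v ∈ B, (((Z1 v ∪ Z2 v).card : ℕ) : ℝ) := by exact_mod_cast card_biUnion_le
    have e3 := sum_le_card_nsmul B _ W h12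
    rw [nsmul_eq_mul] at e3
    have e4 : (Z0.card : ℝ) ≤ 2 * k * ∏ i, ((cls q i).card : ℝ) := by exact_mod_cast h0
    linarith
  -- The default `0` puts all of `B` into class `0`. In this blow-up each vertex of `B` lies on `2k`
  -- times the product of the other class sizes many labelled cycles.
  have hlow := hmax fun v => (q v).getD 0
  rw [card_cycles_blowup (by omega) hodd] at hlow
  have hprod : ∏ i, (univ.filter fun v => (q v).getD 0 = i).card
      = ∏ i, (cls q i).card + B.card * ∏ i ∈ univ.erase 0, (cls q i).card := by
    rw [← mul_prod_erase univ _ (mem_univ 0),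
      ← mul_prod_erase univ (fun i => (cls q i).card) (mem_univ 0), ← add_mul]
    congr 1
    · rw [← card_union_of_disjoint]
      · congr 1
        ext v
        simp only [mem_filter, mem_univ, true_and, mem_union, mem_cls, hB]
        cases q v <;> simp
      · rw [disjoint_left]
        intro v h1 h2
        rw [mem_cls] at h1
        simp [hB, h1] at h2
    · refine prod_congr rfl fun i hi => ?_
      congr 1
      ext v
      have hi := (mem_erase.1 hi).1
      simp only [mem_filter, mem_univ, true_and, mem_cls]
      cases q v <;> simp [hi.symm]
  rw [hprod] at hlow
  have hlow' : 2 * k * (∏ i, ((cls q i).card : ℝ)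
      + B.card * ∏ i ∈ univ.erase 0, ((cls q i).card : ℝ)) ≤ ((cycles G k).card : ℝ) := by
    exact_mod_cast hlow
  have hBpos : (0 : ℝ) < B.card := by exact_mod_cast hBne.card_pos
  have hγk : γ ≤ 1 / k := by
    have : (1 / (6 * k) : ℝ) ≤ 1 / k := by
      apply one_div_le_one_div_of_le hkR; linarith
    have : 0 ≤ k * γ := by positivity
    linarith
  have hqlow : ((1 / k - γ) * n) ^ (k - 1) ≤ ∏ i ∈ univ.erase (0 : ZMod k), ((cls q i).card : ℝ) := by
    have := prod_le_prod (s := univ.erase (0 : ZMod k)) (f := fun _ => (1 / k - γ) * (n : ℝ))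
      (g := fun i => ((cls q i).card : ℝ)) (fun i _ => mul_nonneg (by linarith) hnR.le)
      (fun i _ => hsize i)
    rwa [prod_const, card_erase_of_mem (mem_univ _), card_univ, ZMod.card] at this
  have hfin : 2 * k * ((1 / k - γ) * n) ^ (k - 1) ≤ W := by
    have e1 : B.card * (2 * k * ∏ i ∈ univ.erase (0 : ZMod k), ((cls q i).card : ℝ))
      ≤ B.card * W := by linarith
    have e2 := le_of_mul_le_mul_left e1 hBpos
    refine le_trans (mul_le_mul_of_nonneg_left hqlow (by positivity)) e2
  rw [mul_pow] at hfin
  have hnp : (0 : ℝ) < n ^ (k - 1) := by positivity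
  have : 2 * k * (1 / k - γ) ^ (k - 1) ≤
      2 * k * ((1 / k + k * γ - δ) * (1 / k + k * γ) ^ (k - 2)) + k ^ 3 * γ := by
    apply le_of_mul_le_mul_right _ hnp
    linarith
  linarith

/-! ### Weights from sequential choice, and the logarithmic inequality. -/

/-- Sequentially choosing each coordinate uniformly from a set depending on the previous ones
defines a (sub)probability distribution. -/
theorem sum_prod_ite_inv_card_le_one {V : Type*} [Fintype V] (n : ℕ)
    (A : Fin n → (Fin n → V) → Finset V)
    (hA : ∀ i y y', (∀ j < i, y j = y' j) → A i y = A i y') :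
    ∑ y : Fin n → V, ∏ i, (if y i ∈ A i y then ((A i y).card : ℝ)⁻¹ else 0) ≤ 1 := by
  induction n with
  | zero => simp
  | succ n ih =>
    rw [← Equiv.sum_comp (Fin.consEquiv fun _ => V), Fintype.sum_prod_type]
    simp only [Fin.consEquiv_apply, Fin.prod_univ_succ, Fin.cons_zero, Fin.cons_succ]
    rcases isEmpty_or_nonempty (Fin (n + 1) → V) with hV | ⟨⟨y0⟩⟩
    · have : IsEmpty V := by
        by_contra h
        rw [not_isEmpty_iff] at h
        exact hV.false fun _ => h.some
      simp
    have h0 : ∀ y, A 0 y = A 0 y0 := fun y => hA 0 _ _ fun j hj => absurd hj (Fin.not_lt_zero j)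
    have h1 : ∀ v : V, ∑ y : Fin n → V, (if v ∈ A 0 (Fin.cons v y) then
          ((A 0 (Fin.cons v y)).card : ℝ)⁻¹ else 0) *
        ∏ i : Fin n, (if y i ∈ A i.succ (Fin.cons v y) then
          ((A i.succ (Fin.cons v y)).card : ℝ)⁻¹ else 0)
        ≤ if v ∈ A 0 y0 then ((A 0 y0).card : ℝ)⁻¹ else 0 := by
      intro v
      simp only [h0]
      rw [← mul_sum]
      refine mul_le_of_le_one_right (by split_ifs <;> positivity) ?_
      apply ih (fun i y => A i.succ (Fin.cons v y))
      intro i y y' hyy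
      apply hA
      intro j hj
      refine Fin.cases ?_ (fun j' hj' => ?_) j hj
      · intro _; simp
      · simp only [Fin.cons_succ]
        exact hyy j' (Fin.succ_lt_succ_iff.1 hj')
    refine (sum_le_sum fun v _ => h1 v).trans ?_
    rw [sum_ite_mem, univ_inter, sum_const, nsmul_eq_mul]
    -- Not an equality: the first set may be empty, and then the inverse of its size is `0`.
    exact mul_inv_le_one

theorem sum_prod_inv_card_le_one {V ι : Type*} [Fintype V] [Fintype ι] [DecidableEq ι] {n : ℕ}
    (rank : ι ≃ Fin n) (A : ι → (ι → V) → Finset V)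
    (hA : ∀ i z z', (∀ j, rank j < rank i → z j = z' j) → A i z = A i z')
    (S : Finset (ι → V)) (hS : ∀ z ∈ S, ∀ i, z i ∈ A i z) :
    ∑ z ∈ S, ∏ i, ((A i z).card : ℝ)⁻¹ ≤ 1 := by
  have h := sum_prod_ite_inv_card_le_one n
    (fun i y => A (rank.symm i) (fun j => y (rank j))) (by
      intro i y y' hyy
      apply hA
      intro j hj
      apply hyy
      simpa using hj)
  refine le_trans ?_ h
  rw [← Equiv.sum_comp (rank.arrowCongr (Equiv.refl V))]
  refine le_trans (le_of_eq ?_) (sum_le_sum_of_subset_of_nonneg (subset_univ S) ?_)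
  · refine sum_congr rfl fun z hz => ?_
    rw [← Equiv.prod_comp rank]
    refine prod_congr rfl fun i _ => ?_
    have := hS z hz i
    simp [Equiv.arrowCongr, this]
  · intro z _ _
    refine prod_nonneg fun i _ => ?_
    split_ifs <;> positivity

/-- The product equals `exp (∑ -log x i)`, at least `1 - ∑ log x i`. The bound `log x ≤ x - 1`
serves at every index except `i₀`, where the improvement by `p` enters. -/
theorem one_add_sum_le_prod_inv {ι : Type*} [Fintype ι] (x : ι → ℝ) (hx : ∀ i, 0 < x i) (i₀ : ι)
    (p : ℝ) (hp : Real.log (x i₀) ≤ x i₀ - 1 - p) :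
    1 + ∑ i, (1 - x i) + p ≤ ∏ i, (x i)⁻¹ := by
  have h1 : ∏ i, (x i)⁻¹ = Real.exp (∑ i, -Real.log (x i)) := by
    rw [Real.exp_sum]
    refine prod_congr rfl fun i _ => ?_
    rw [Real.exp_neg, Real.exp_log (hx i)]
  rw [h1]
  refine le_trans ?_ (Real.add_one_le_exp _)
  rw [← add_sum_erase univ _ (mem_univ i₀), ← add_sum_erase univ (fun i => -Real.log (x i))
    (mem_univ i₀)]
  have : ∑ i ∈ univ.erase i₀, (1 - x i) ≤ ∑ i ∈ univ.erase i₀, -Real.log (x i) := by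
    gcongr with i
    have := Real.log_le_sub_one_of_pos (hx i)
    linarith
  linarith

/-- With `s = √x`, `log x = 2 log s ≤ 2(s - 1) = x - 1 - (1 - s)²`, and `1 - s ≥ ε/2`. -/
theorem log_le_sub_one_sub_sq {x ε : ℝ} (hx : 0 < x) (hε : 0 ≤ ε) (hxε : x ≤ 1 - ε) :
    Real.log x ≤ x - 1 - ε ^ 2 / 4 := by
  have h1 := Real.log_le_sub_one_of_pos (Real.sqrt_pos.2 hx)
  rw [Real.log_sqrt hx.le] at h1
  have h2 := Real.sq_sqrt hx.le
  have h3 := Real.sqrt_nonneg x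
  set s := √x
  have h4 : s ≤ 1 := by nlinarith
  have h5 : ε / 2 ≤ 1 - s := by nlinarith
  nlinarith

/-- The sets from which the vertices of a cycle are chosen one by one, in the order
`0, 1, 3, 2, 4, 5, …`. Here `θ` is the threshold above which codegrees count as large. -/
noncomputable def choiceSet {V : Type*} [Fintype V] {k : ℕ} (G : SimpleGraph V) (θ : ℝ)
    (j : ZMod k) (z : ZMod k → V) : Finset V :=
  if j = 0 then univ
  else if j = 1 then univ.filter fun u => G.Adj u (z 0)
  else if j = 2 then univ.filter fun u => G.Adj u (z 1) ∧ G.Adj u (z 3)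
  else if j = 3 then univ.filter fun u =>
    θ ≤ ((univ.filter fun w => G.Adj u w ∧ G.Adj (z 1) w).card : ℝ) ∧ ¬ G.Adj u (z 0)
  else if j = -1 then univ.filter fun u => G.Adj u (z (-2)) ∧ G.Adj u (z 0)
  else univ.filter fun u => G.Adj u (z (j - 1)) ∧ ¬ G.Adj u (z (j - 3))

/-- The order in which the vertices of a cycle are chosen. -/
def choiceRank (k : ℕ) [NeZero k] : ZMod k ≃ Fin k :=
  (Equiv.swap 2 3).trans
    ⟨fun a => ⟨a.val, ZMod.val_lt a⟩, fun i => (i.val : ZMod k),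
      fun a => by simp, fun i => by ext; simp [ZMod.val_cast_of_lt i.2]⟩

theorem choiceRank_natCast {k : ℕ} [NeZero k] (hk : 7 ≤ k) (a : ℕ) (ha : a < k) :
    (choiceRank k (a : ZMod k)).val = if a = 2 then 3 else if a = 3 then 2 else a := by
  have hval : ∀ b : ℕ, b < k → (b : ZMod k).val = b := fun b hb => ZMod.val_cast_of_lt hb
  have hne : ∀ b c : ℕ, b < k → c < k → b ≠ c → (b : ZMod k) ≠ c := by
    intro b c hb hc hbc h
    apply hbc
    rw [← hval b hb, ← hval c hc, h]
  simp only [choiceRank, Equiv.trans_apply, Equiv.coe_fn_mk]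
  split_ifs with h2 h3
  · subst h2
    have : ((2 : ℕ) : ZMod k) = 2 := by simp
    rw [this, Equiv.swap_apply_left]
    exact hval 3 (by omega)
  · subst h3
    have : ((3 : ℕ) : ZMod k) = 3 := by simp
    rw [this, Equiv.swap_apply_right]
    exact hval 2 (by omega)
  · rw [Equiv.swap_apply_of_ne_of_ne]
    · exact hval a ha
    · exact_mod_cast hne a 2 ha (by omega) h2
    · exact_mod_cast hne a 3 ha (by omega) h3

theorem choiceSet_congr {V : Type*} [Fintype V] {k : ℕ} [NeZero k] (hk : 7 ≤ k)
    (G : SimpleGraph V) (θ : ℝ) (i : ZMod k) (z z' : ZMod k → V)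
    (h : ∀ j, choiceRank k j < choiceRank k i → z j = z' j) :
    choiceSet G θ i z = choiceSet G θ i z' := by
  obtain ⟨a, ha, rfl⟩ : ∃ a : ℕ, a < k ∧ i = a := ⟨i.val, ZMod.val_lt i, by simp⟩
  have h' : ∀ b : ℕ, b < k → (if b = 2 then 3 else if b = 3 then 2 else b)
      < (if a = 2 then 3 else if a = 3 then 2 else a) → z (b : ZMod k) = z' (b : ZMod k) := by
    intro b hb hlt
    apply h
    rw [Fin.lt_def, choiceRank_natCast hk b hb, choiceRank_natCast hk a ha]
    exact hlt
  unfold choiceSet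
  split_ifs with h0 h1 h2 h3 h4
  · rfl
  · have : a = 1 := by
      rw [← ZMod.val_cast_of_lt ha, h1]
      exact_mod_cast ZMod.val_cast_of_lt (n := k) (a := 1) (by omega)
    subst this
    have e0 := h' 0 (by omega) (by decide)
    simp only [Nat.cast_zero] at e0
    rw [e0]
  · have : a = 2 := by
      rw [← ZMod.val_cast_of_lt ha, h2]
      exact_mod_cast ZMod.val_cast_of_lt (n := k) (a := 2) (by omega)
    subst this
    have e1 := h' 1 (by omega) (by decide)
    have e3 := h' 3 (by omega) (by decide)
    simp only [Nat.cast_one, Nat.cast_ofNat] at e1 e3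
    rw [e1, e3]
  · have : a = 3 := by
      rw [← ZMod.val_cast_of_lt ha, h3]
      exact_mod_cast ZMod.val_cast_of_lt (n := k) (a := 3) (by omega)
    subst this
    have e1 := h' 1 (by omega) (by decide)
    have e0 := h' 0 (by omega) (by decide)
    simp only [Nat.cast_one, Nat.cast_zero] at e1 e0
    rw [e1, e0]
  · have hk1 : ((k - 1 : ℕ) : ZMod k) = -1 := by
      rw [Nat.cast_sub (by omega)]; simp
    have hk2 : ((k - 2 : ℕ) : ZMod k) = -2 := by
      rw [Nat.cast_sub (by omega)]; simp
    have : a = k - 1 := by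
      rw [← ZMod.val_cast_of_lt ha, h4, ← hk1]
      exact ZMod.val_cast_of_lt (by omega)
    subst this
    have e0 := h' 0 (by omega) (by split_ifs <;> omega)
    have e2 := h' (k - 2) (by omega) (by split_ifs <;> omega)
    rw [hk2] at e2
    simp only [Nat.cast_zero] at e0
    rw [e0, e2]
  · have a0 : a ≠ 0 := by rintro rfl; exact h0 (by simp)
    have a1 : a ≠ 1 := by rintro rfl; exact h1 (by simp)
    have a2 : a ≠ 2 := by rintro rfl; exact h2 (by simp)
    have a3 : a ≠ 3 := by rintro rfl; exact h3 (by simp)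
    have e1 := h' (a - 1) (by omega) (by split_ifs <;> omega)
    have e3 := h' (a - 3) (by omega) (by split_ifs <;> omega)
    rw [Nat.cast_sub (by omega), Nat.cast_one] at e1
    rw [Nat.cast_sub (by omega), Nat.cast_ofNat] at e3
    rw [e1, e3]

/-! ### The contribution of one vertex to the choice sets of all rotations of a cycle. -/

/-- These differences must not vanish in the case analyses on residues. Only `8` needs `k` odd, to
exclude `k = 8`. -/
theorem natCast_even_ne {k : ℕ} (hk : 7 ≤ k) (hodd : Odd k) :
    (1 : ZMod k) ≠ 0 ∧ (2 : ZMod k) ≠ 0 ∧ (3 : ZMod k) ≠ 0 ∧ (4 : ZMod k) ≠ 0 ∧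
      (6 : ZMod k) ≠ 0 ∧ (8 : ZMod k) ≠ 0 := by
  refine ⟨?_, ?_, ?_, ?_, ?_, ?_⟩
  · exact_mod_cast natCast_ne_zero_of_lt (k := k) (a := 1) (by omega) (by omega)
  · exact_mod_cast natCast_ne_zero_of_lt (k := k) (a := 2) (by omega) (by omega)
  · exact_mod_cast natCast_ne_zero_of_lt (k := k) (a := 3) (by omega) (by omega)
  · exact_mod_cast natCast_ne_zero_of_lt (k := k) (a := 4) (by omega) (by omega)
  · exact_mod_cast natCast_ne_zero_of_lt (k := k) (a := 6) (by omega) (by omega)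
  · have h : ((8 : ℕ) : ZMod k) ≠ 0 := by
      rw [Ne, ZMod.natCast_eq_zero_iff]
      intro hd
      have h1 := Nat.le_of_dvd (by omega) hd
      obtain ⟨t, ht⟩ := hodd
      have : k = 7 ∨ k = 8 := by omega
      rcases this with rfl | rfl
      · omega
      · omega
    exact_mod_cast h

/-- `N` stands for the neighbours of a vertex on the cycle and `R` for the positions of large
codegree. By `exists_center`, `N` lies in some `{c - 1, c + 1}`. If it is the whole pair, as for a
vertex of class `c` in a blow-up, the four terms are at most `1 + 2 + 1 + (k - 5)`. A singleton
gives at most `1/2 + 0 + 3 + (k - 5)`. If `N` is empty only the `R` term survives, and `R` is not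
everything. -/
theorem incidence_count_le {k : ℕ} [NeZero k] (hk : 7 ≤ k) (hodd : Odd k) (N R : Finset (ZMod k))
    (h1 : ∀ i ∈ N, ∀ j ∈ N, j = i ∨ j = i + 2 ∨ j = i - 2)
    (h2 : ∀ i ∈ N, ∀ j ∈ R, j = i + 1 ∨ j = i - 1 ∨ j = i + 3 ∨ j = i - 3)
    (h3 : ∀ i ∈ R, i + 1 ∉ R) :
    (N.card : ℝ) / 2 + 2 * ((univ.filter fun r => r ∈ N ∧ r + 2 ∈ N).card : ℝ)
      + ((univ.filter fun r => r + 1 ∈ R ∧ r ∉ N).card : ℝ)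
      + (k - 5) * ((univ.filter fun r => r ∈ N ∧ r - 2 ∉ N).card : ℝ) ≤ k - 1 := by
  obtain ⟨n1, n2, n3, n4, n6, n8⟩ := natCast_even_ne hk hodd
  have hk' : (7 : ℝ) ≤ k := by exact_mod_cast hk
  have bound : ∀ a t ρ h : ℕ, N.card ≤ a → (univ.filter fun r => r ∈ N ∧ r + 2 ∈ N).card ≤ t →
      (univ.filter fun r => r + 1 ∈ R ∧ r ∉ N).card ≤ ρ →
      (univ.filter fun r => r ∈ N ∧ r - 2 ∉ N).card ≤ h →
      (a : ℝ) / 2 + 2 * t + ρ + (k - 5) * h ≤ k - 1 →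
      (N.card : ℝ) / 2 + 2 * ((univ.filter fun r => r ∈ N ∧ r + 2 ∈ N).card : ℝ)
      + ((univ.filter fun r => r + 1 ∈ R ∧ r ∉ N).card : ℝ)
      + (k - 5) * ((univ.filter fun r => r ∈ N ∧ r - 2 ∉ N).card : ℝ) ≤ k - 1 := by
    intro a t ρ h ha ht hρ hh hle
    have ha' : (N.card : ℝ) ≤ a := by exact_mod_cast ha
    have ht' : ((univ.filter fun r => r ∈ N ∧ r + 2 ∈ N).card : ℝ) ≤ t := by exact_mod_cast ht
    have hρ' : ((univ.filter fun r => r + 1 ∈ R ∧ r ∉ N).card : ℝ) ≤ ρ := by exact_mod_cast hρ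
    have hh' : ((univ.filter fun r => r ∈ N ∧ r - 2 ∉ N).card : ℝ) ≤ h := by exact_mod_cast hh
    have := mul_le_mul_of_nonneg_left hh' (by linarith : (0 : ℝ) ≤ k - 5)
    linarith
  have single : ∀ a, N = {a} → (N.card : ℝ) / 2
      + 2 * ((univ.filter fun r => r ∈ N ∧ r + 2 ∈ N).card : ℝ)
      + ((univ.filter fun r => r + 1 ∈ R ∧ r ∉ N).card : ℝ)
      + (k - 5) * ((univ.filter fun r => r ∈ N ∧ r - 2 ∉ N).card : ℝ) ≤ k - 1 := by
    intro a ha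
    apply bound 1 0 3 1
    · simp [ha]
    · rw [Nat.le_zero, card_eq_zero, filter_eq_empty_iff]
      rintro r - ⟨hr, hr2⟩
      rw [ha, mem_singleton] at hr hr2
      apply n2; linear_combination hr2 - hr
    · refine (card_le_card ?_).trans (card_le_three (a := a - 2) (b := a + 2) (c := a - 4))
      intro r hr
      simp only [mem_filter, mem_univ, true_and] at hr
      simp only [mem_insert, mem_singleton]
      rcases h2 a (by simp [ha]) _ hr.1 with h | h | h | h
      · exfalso; apply hr.2
        rw [ha, mem_singleton]; linear_combination h
      · left; linear_combination h
      · right; left; linear_combination h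
      · right; right; linear_combination h
    · refine (card_le_card ?_).trans (card_singleton a).le
      intro r hr
      simp only [mem_filter, mem_univ, true_and] at hr
      rw [← ha]; exact hr.1
    · push_cast; linarith
  obtain ⟨c, hc⟩ := exists_center hk (N : Set (ZMod k)) h1
  have hc' : ∀ j ∈ N, j = c + 1 ∨ j = c - 1 := fun j hj => hc j hj
  by_cases hp : c + 1 ∈ N <;> by_cases hm : c - 1 ∈ N
  · apply bound 2 1 1 1
    · refine (card_le_card ?_).trans (card_le_two (a := c + 1) (b := c - 1))
      intro r hr
      simpa using hc' r hr
    · refine (card_le_card ?_).trans (card_singleton (c - 1)).le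
      intro r hr
      simp only [mem_filter, mem_univ, true_and] at hr
      rw [mem_singleton]
      rcases hc' r hr.1 with h | h
      · exfalso
        rcases hc' _ hr.2 with h' | h'
        · apply n2; linear_combination h' - h
        · apply n4; linear_combination h' - h
      · exact h
    · refine (card_le_card ?_).trans (card_singleton (c - 3)).le
      intro r hr
      simp only [mem_filter, mem_univ, true_and] at hr
      rw [mem_singleton]
      rcases h2 _ hm _ hr.1 with h | h | h | h
      · exfalso; apply hr.2
        have : r = c - 1 := by linear_combination h
        rwa [this]
      · linear_combination h
      · exfalso; apply hr.2
        have : r = c + 1 := by linear_combination h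
        rwa [this]
      · exfalso
        rcases h2 _ hp _ hr.1 with h' | h' | h' | h'
        · apply n6; linear_combination h - h'
        · apply n4; linear_combination h - h'
        · apply n8; linear_combination h - h'
        · apply n2; linear_combination h - h'
    · refine (card_le_card ?_).trans (card_singleton (c - 1)).le
      intro r hr
      simp only [mem_filter, mem_univ, true_and] at hr
      rw [mem_singleton]
      rcases hc' r hr.1 with h | h
      · exfalso; apply hr.2
        have : r - 2 = c - 1 := by linear_combination h
        rwa [this]
      · exact h
    · push_cast; linarith
  · apply single (c + 1)
    ext j
    rw [mem_singleton]
    constructor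
    · intro hj
      rcases hc' j hj with h | h
      · exact h
      · exact absurd (h ▸ hj) hm
    · rintro rfl; exact hp
  · apply single (c - 1)
    ext j
    rw [mem_singleton]
    constructor
    · intro hj
      rcases hc' j hj with h | h
      · exact absurd (h ▸ hj) hp
      · exact h
    · rintro rfl; exact hm
  · have hN : ∀ j, j ∉ N := by
      intro j hj
      rcases hc' j hj with h | h
      · exact hp (h ▸ hj)
      · exact hm (h ▸ hj)
    apply bound 0 0 (k - 1) 0
    · rw [Nat.le_zero, card_eq_zero]
      exact eq_empty_of_forall_notMem hN
    · simp [hN]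
    · obtain ⟨i, hi⟩ : ∃ i, i ∉ R := by
        by_contra hcon
        push Not at hcon
        exact h3 0 (hcon 0) (hcon _)
      have : (univ.filter fun r => r + 1 ∈ R ∧ r ∉ N) ⊆ univ.erase (i - 1) := by
        intro r hr
        simp only [mem_filter, mem_univ, true_and] at hr
        rw [mem_erase]
        refine ⟨?_, mem_univ _⟩
        rintro rfl
        apply hi
        have := hr.1
        rwa [sub_add_cancel] at this
      refine (card_le_card this).trans ?_
      rw [card_erase_of_mem (mem_univ _), card_univ, ZMod.card]
    · simp [hN]
    · rw [Nat.cast_sub (by omega)]; push_cast; linarith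

/-- Weight of a position in the choice order, relative to the size of a class. -/
noncomputable def choiceWeight {k : ℕ} (j : ZMod k) : ℝ :=
  if j = 0 then 0 else if j = 1 then 1 / 2 else 1

/-- Indices of the neighbours of `u` on `z`. -/
noncomputable def nbrIdx {V : Type*} {k : ℕ} [NeZero k] (G : SimpleGraph V) (z : ZMod k → V)
    (u : V) : Finset (ZMod k) :=
  univ.filter fun i => G.Adj u (z i)

/-- Indices of the vertices of `z` having many common neighbours with `u`. -/
noncomputable def codegIdx {V : Type*} [Fintype V] {k : ℕ} [NeZero k] (G : SimpleGraph V) (θ : ℝ)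
    (z : ZMod k → V) (u : V) : Finset (ZMod k) :=
  univ.filter fun i => θ ≤ ((univ.filter fun w => G.Adj u w ∧ G.Adj (z i) w).card : ℝ)

theorem card_filter_add {k : ℕ} [NeZero k] (P : ZMod k → Prop) [DecidablePred P]
    (c : ZMod k) :
    (univ.filter fun r => P (r + c)).card = (univ.filter P).card := by
  refine card_equiv (Equiv.addRight c) fun i => ?_
  simp

/-- Over all rotations, position `1` counts neighbours of `u` with weight one half, positions `2`
and `-1` each count neighbour pairs at gap two, position `3` gives the codegree term, and the
remaining `k - 5` positions give the last term. Position `0` has weight zero, its choice set being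
everything. -/
theorem sum_choiceWeight_eq {V : Type*} [Fintype V] {k : ℕ} [NeZero k] (hk : 7 ≤ k)
    (hodd : Odd k) (G : SimpleGraph V) (θ : ℝ) (z : ZMod k → V) (u : V) :
    ∑ j : ZMod k, choiceWeight j *
      ((univ.filter fun r => u ∈ choiceSet G θ j fun i => z (i + r)).card : ℝ)
    = ((nbrIdx G z u).card : ℝ) / 2
      + 2 * ((univ.filter fun r => r ∈ nbrIdx G z u ∧ r + 2 ∈ nbrIdx G z u).card : ℝ)
      + ((univ.filter fun r => r + 1 ∈ codegIdx G θ z u ∧ r ∉ nbrIdx G z u).card : ℝ)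
      + (k - 5) * ((univ.filter fun r => r ∈ nbrIdx G z u ∧ r - 2 ∉ nbrIdx G z u).card : ℝ) := by
  obtain ⟨n1, n2, n3, n4, n6, n8⟩ := natCast_even_ne hk hodd
  set N := nbrIdx G z u with hN
  set R := codegIdx G θ z u with hR
  have mN : ∀ i, G.Adj u (z i) ↔ i ∈ N := fun i => by simp [hN, nbrIdx]
  have mR : ∀ i, θ ≤ ((univ.filter fun w => G.Adj u w ∧ G.Adj (z i) w).card : ℝ) ↔ i ∈ R :=
    fun i => by simp [hR, codegIdx]
  set t : ℝ := ((univ.filter fun r => r ∈ N ∧ r + 2 ∈ N).card : ℝ) with ht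
  set ρ : ℝ := ((univ.filter fun r => r + 1 ∈ R ∧ r ∉ N).card : ℝ) with hρ
  set h : ℝ := ((univ.filter fun r => r ∈ N ∧ r - 2 ∉ N).card : ℝ) with hh
  have d1 : (1 : ZMod k) ≠ 0 := n1
  have d2 : (2 : ZMod k) ≠ 0 := n2
  have d3 : (3 : ZMod k) ≠ 0 := n3
  have d4 : (-1 : ZMod k) ≠ 0 := neg_ne_zero.2 n1
  have d21 : (2 : ZMod k) ≠ 1 := fun e => n1 (by linear_combination e)
  have d31 : (3 : ZMod k) ≠ 1 := fun e => n2 (by linear_combination e)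
  have d41 : (-1 : ZMod k) ≠ 1 := fun e => n2 (by linear_combination -e)
  have d32 : (3 : ZMod k) ≠ 2 := fun e => n1 (by linear_combination e)
  have d42 : (-1 : ZMod k) ≠ 2 := fun e => n3 (by linear_combination -e)
  have d43 : (-1 : ZMod k) ≠ 3 := fun e => n4 (by linear_combination -e)
  have key : ∀ j : ZMod k, choiceWeight j *
      ((univ.filter fun r => u ∈ choiceSet G θ j fun i => z (i + r)).card : ℝ)
      = h + (if j = 0 then -h else 0) + (if j = 1 then (N.card : ℝ) / 2 - h else 0)
        + (if j = 2 then t - h else 0) + (if j = 3 then ρ - h else 0)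
        + (if j = -1 then t - h else 0) := by
    intro j
    by_cases j0 : j = 0
    · subst j0
      simp [choiceWeight, d1.symm, d2.symm, d3.symm, d4.symm]
    by_cases j1 : j = 1
    · subst j1
      have : (univ.filter fun r => u ∈ choiceSet G θ (1 : ZMod k) fun i => z (i + r)) = N := by
        ext r
        simp [choiceSet, d1, mN]
      rw [this]
      simp only [choiceWeight, d1, d21.symm, d31.symm, d41.symm, if_false, if_true]
      ring
    by_cases j2 : j = 2
    · subst j2
      have : ((univ.filter fun r => u ∈ choiceSet G θ (2 : ZMod k) fun i => z (i + r)).card : ℝ)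
          = t := by
        rw [ht, ← card_filter_add (fun r => r ∈ N ∧ r + 2 ∈ N) 1]
        congr 2
        ext r
        simp only [choiceSet, d2, d21, if_false, if_true, mem_filter, mem_univ, true_and, mN]
        rw [add_comm 1 r, show (3 : ZMod k) + r = r + 1 + 2 by ring]
      rw [this]
      simp only [choiceWeight, d2, d21, d32.symm, d42.symm, if_false, if_true]
      ring
    by_cases j3 : j = 3
    · subst j3
      have : ((univ.filter fun r => u ∈ choiceSet G θ (3 : ZMod k) fun i => z (i + r)).card : ℝ)
          = ρ := by
        rw [hρ]
        congr 2
        ext r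
        simp only [choiceSet, d3, d31, d32, if_false, if_true, mem_filter, mem_univ, true_and, mN,
          mR, zero_add]
        rw [add_comm 1 r]
      rw [this]
      simp only [choiceWeight, d3, d31, d32, d43.symm, if_false, if_true]
      ring
    by_cases j4 : j = -1
    · subst j4
      have : ((univ.filter fun r => u ∈ choiceSet G θ (-1 : ZMod k) fun i => z (i + r)).card : ℝ)
          = t := by
        rw [ht, ← card_filter_add (fun r => r ∈ N ∧ r + 2 ∈ N) (-2)]
        congr 2
        ext r
        simp only [choiceSet, d4, d41, d42, d43, if_false, if_true, mem_filter, mem_univ, true_and,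
          mN, zero_add]
        rw [add_comm (-2) r, show r + -2 + 2 = r by ring]
      rw [this]
      simp only [choiceWeight, d4, d41, d42, d43, if_false, if_true]
      ring
    have : ((univ.filter fun r => u ∈ choiceSet G θ j fun i => z (i + r)).card : ℝ) = h := by
      rw [hh, ← card_filter_add (fun r => r ∈ N ∧ r - 2 ∉ N) (j - 1)]
      congr 2
      ext r
      simp only [choiceSet, j0, j1, j2, j3, j4, if_false, mem_filter, mem_univ, true_and, mN]
      rw [show j - 1 + r = r + (j - 1) by ring, show j - 3 + r = r + (j - 1) - 2 by ring]
    rw [this]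
    simp only [choiceWeight, j0, j1, j2, j3, j4, if_false]
    ring
  rw [sum_congr rfl fun j _ => key j]
  simp only [sum_add_distrib, sum_ite_eq', mem_univ, if_true, sum_const, card_univ, ZMod.card,
    nsmul_eq_mul]
  ring

/-! ### Atypical vertices are rare. -/

theorem card_adj_nbrs_add_le {V : Type*} [Fintype V] {k : ℕ} [NeZero k] (hk : 7 ≤ k)
    (hodd : Odd k) {G : SimpleGraph V} (hfree : (SimpleGraph.cycleGraph (k - 2)).Free G)
    {z : ZMod k → V} (hz : z ∈ cycles G k) (i : ZMod k) (p : ℕ) (hp : Even p) (hpk : p + 5 ≤ k) :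
    (univ.filter fun e : V × V => G.Adj (z i) e.1 ∧ G.Adj (z (i + p)) e.2 ∧ G.Adj e.1 e.2).card
      ≤ 2 * (k - 2) ^ 2 * Fintype.card V := by
  obtain ⟨hinj, hadj⟩ := mem_cycles.1 hz
  have hlodd : Odd (k - 2) := by
    obtain ⟨t, rfl⟩ := hodd
    exact ⟨t - 1, by omega⟩
  refine card_adj_pairs_le G (k - 2) hlodd hfree
    ((List.range (p + 1)).map fun t : ℕ => z (i + t)) ?_ ?_ ?_ ?_ _ _ ?_ ?_
  · simpa using hp.add_one
  · simp; omega
  · refine List.Nodup.map_on ?_ List.nodup_range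
    intro a ha b hb hab
    rw [List.mem_range] at ha hb
    have h1 := add_left_cancel (hinj hab)
    rw [← ZMod.val_cast_of_lt (by omega : a < k), ← ZMod.val_cast_of_lt (by omega : b < k), h1]
  · rw [List.isChain_map, List.isChain_iff_getElem]
    intro t ht
    simp only [List.getElem_range]
    have := hadj (i + t)
    push_cast
    rwa [add_assoc] at this
  · simp [List.head?_map, List.head?_range]
  · simp [List.getLast?_map, List.getLast?_range]

/-- Two vertices of a `k`-cycle joined by a short even path of the cycle have neighbourhoods
spanning few edges. -/
theorem card_adj_nbrs_le {V : Type*} [Fintype V] {k : ℕ} [NeZero k] (hk : 7 ≤ k)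
    (hodd : Odd k) {G : SimpleGraph V} (hfree : (SimpleGraph.cycleGraph (k - 2)).Free G)
    {z : ZMod k → V} (hz : z ∈ cycles G k) (i j : ZMod k)
    (hij : ¬ (j = i + 1 ∨ j = i - 1 ∨ j = i + 3 ∨ j = i - 3)) :
    (univ.filter fun e : V × V => G.Adj (z i) e.1 ∧ G.Adj (z j) e.2 ∧ G.Adj e.1 e.2).card
      ≤ 2 * (k - 2) ^ 2 * Fintype.card V := by
  push Not at hij
  obtain ⟨t, ht⟩ := hodd
  set d := (j - i).val with hd
  have hdk : d < k := ZMod.val_lt _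
  have hj : j = i + d := by rw [hd, ZMod.natCast_zmod_val]; ring
  have hj' : j = i - ((k - d : ℕ) : ZMod k) := by
    rw [Nat.cast_sub hdk.le, hj]; simp
  have c1 : d ≠ 1 := by
    intro h1; apply hij.1; rw [hj, h1]; simp
  have c2 : k - d ≠ 1 := by
    intro h1; apply hij.2.1; rw [hj', h1]; simp
  have c3 : d ≠ 3 := by
    intro h1; apply hij.2.2.1; rw [hj, h1]; simp
  have c4 : k - d ≠ 3 := by
    intro h1; apply hij.2.2.2; rw [hj', h1]; simp
  -- As `k` is odd, exactly one arc between `i` and `j` is even. The excluded differences are those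
  -- for which it has length `k - 1` or `k - 3`, so here it has at most `k - 5` edges.
  rcases Nat.even_or_odd d with hev | hod
  · have h5 : d + 5 ≤ k := by obtain ⟨e, he⟩ := hev; omega
    have := card_adj_nbrs_add_le hk ⟨t, ht⟩ hfree hz i d hev h5
    rwa [← hj] at this
  · have hev : Even (k - d) := by
      obtain ⟨e, he⟩ := hod
      exact ⟨t - e, by omega⟩
    have h5 : k - d + 5 ≤ k := by obtain ⟨e, he⟩ := hod; omega
    have := card_adj_nbrs_add_le hk ⟨t, ht⟩ hfree hz j (k - d) hev h5
    have hi : j + ((k - d : ℕ) : ZMod k) = i := by rw [hj']; ring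
    rw [hi] at this
    refine le_trans (le_of_eq ?_) this
    refine card_equiv (Equiv.prodComm V V) ?_
    rintro ⟨a, b⟩
    simp only [mem_filter, mem_univ, true_and, Equiv.prodComm_apply, Prod.swap_prod_mk]
    rw [G.adj_comm a b]
    tauto

/-- Bounding a set of pairs by bounding its fibres in one coordinate. -/
theorem card_le_of_fiber {V U ι : Type*} [Fintype V] [Fintype U] [Fintype ι] [DecidableEq ι]
    (i : ι) (P : Finset ((ι → V) × U)) (M : ℕ)
    (h : ∀ p ∈ P, (univ.filter fun e : V × U => (Function.update p.1 i e.1, e.2) ∈ P).card ≤ M) :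
    P.card ≤ M * Fintype.card V ^ (Fintype.card ι - 1) := by
  have h1 := card_le_mul_card_image_of_maps_to
    (f := fun (p : (ι → V) × U) (l : {l // l ≠ i}) => p.1 l) (s := P) (t := univ)
    (fun _ _ => mem_univ _) M ?_
  · refine h1.trans (le_of_eq ?_)
    rw [card_univ, Fintype.card_fun, Fintype.card_subtype_compl, Fintype.card_subtype_eq]
  · intro g _
    rcases (P.filter fun p => (fun l : {l // l ≠ i} => p.1 l) = g).eq_empty_or_nonempty with he | ⟨p, hp⟩
    · rw [he]; simp
    · rw [mem_filter] at hp
      refine le_trans (card_le_card_of_injOn (fun q => (q.1 i, q.2)) ?_ ?_) (h p hp.1)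
      · intro q hq
        simp only [coe_filter, Set.mem_ofPred_eq] at hq
        simp only [coe_filter, Set.mem_ofPred_eq, mem_univ, true_and]
        have : Function.update p.1 i (q.1 i) = q.1 := by
          funext l
          by_cases hl : l = i
          · subst hl; simp
          · rw [Function.update_of_ne hl]
            have e1 := congrFun hp.2 ⟨l, hl⟩
            have e2 := congrFun hq.2 ⟨l, hl⟩
            exact e1.trans e2.symm
        rw [this]; exact hq.1
      · intro q hq q' hq' hqq
        simp only [coe_filter, Set.mem_ofPred_eq] at hq hq'
        simp only [Prod.mk.injEq] at hqq
        refine Prod.ext ?_ hqq.2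
        funext l
        by_cases hl : l = i
        · subst hl; exact hqq.1
        · have e1 := congrFun hq.2 ⟨l, hl⟩
          have e2 := congrFun hq'.2 ⟨l, hl⟩
          exact e1.trans e2.symm

/-- Vertices adjacent to two vertices of `z` not at distance `0` or `2` on the cycle. -/
noncomputable def oddAttached {V : Type*} [Fintype V] {k : ℕ} [NeZero k] (G : SimpleGraph V)
    (z : ZMod k → V) : Finset V :=
  univ.filter fun u => ∃ i ∈ nbrIdx G z u, ∃ j ∈ nbrIdx G z u,
    ¬ (j = i ∨ j = i + 2 ∨ j = i - 2)

/-- Fix every vertex of the cycle except `z i`. The pair of `z i` and the attached vertex is an edge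
between the neighbourhoods of `z (i + 1)` and `z (i + d)`, which are joined by an even arc avoiding
`z i`. This leaves `O(n)` pairs instead of `n²`. -/
theorem card_two_nbrs_le {V : Type*} [Fintype V] {k : ℕ} [NeZero k] (hk : 7 ≤ k)
    (hodd : Odd k) {G : SimpleGraph V} (hfree : (SimpleGraph.cycleGraph (k - 2)).Free G)
    (i : ZMod k) (d : ℕ) (hd : Odd d) (hdk : d + 4 ≤ k) :
    (univ.filter fun p : (ZMod k → V) × V => p.1 ∈ cycles G k ∧ G.Adj p.2 (p.1 i)
      ∧ G.Adj p.2 (p.1 (i + d))).card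
      ≤ 2 * (k - 2) ^ 2 * Fintype.card V * Fintype.card V ^ (k - 1) := by
  have h := card_le_of_fiber i (univ.filter fun p : (ZMod k → V) × V =>
    p.1 ∈ cycles G k ∧ G.Adj p.2 (p.1 i) ∧ G.Adj p.2 (p.1 (i + d)))
    (2 * (k - 2) ^ 2 * Fintype.card V) ?_
  · rwa [ZMod.card] at h
  · intro p hp
    rw [mem_filter] at hp
    obtain ⟨e, he⟩ := hd
    have hev : Even (d - 1) := ⟨e, by omega⟩
    have := card_adj_nbrs_add_le hk hodd hfree hp.2.1 (i + 1) (d - 1) hev (by omega)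
    have hid : i + 1 + ((d - 1 : ℕ) : ZMod k) = i + d := by
      rw [Nat.cast_sub (by omega)]; push_cast; ring
    rw [hid] at this
    refine le_trans (card_le_card ?_) this
    intro q hq
    have hne : i + (d : ZMod k) ≠ i := by
      simpa using natCast_ne_zero_of_lt (k := k) (a := d) (by omega) (by omega)
    have hne1 : i + 1 ≠ i := by
      simpa using natCast_ne_zero_of_lt (k := k) (a := 1) (by omega) (by omega)
    simp only [mem_filter, mem_univ, true_and, mem_cycles, Function.update_self,
      Function.update_of_ne hne] at hq ⊢
    have h2 := hq.1.2 i
    rw [Function.update_self, Function.update_of_ne hne1] at h2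
    exact ⟨h2.symm, hq.2.2.symm, hq.2.1.symm⟩

/-- When two positions are not at distance `0` or `2`, the odd arc between them has length at most
`k - 4`; there are at most `k²` such arcs. Unlike the two other kinds of atypical vertices, these
are bounded on average over the cycles only. -/
theorem sum_card_oddAttached_le {V : Type*} [Fintype V] {k : ℕ} [NeZero k] (hk : 7 ≤ k)
    (hodd : Odd k) {G : SimpleGraph V} (hfree : (SimpleGraph.cycleGraph (k - 2)).Free G) :
    ∑ z ∈ cycles G k, (oddAttached G z).card ≤ 2 * k ^ 4 * Fintype.card V ^ k := by
  have h1 : ∑ z ∈ cycles G k, (oddAttached G z).card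
      = ((cycles G k).sigma fun z => oddAttached G z).card := (card_sigma _ _).symm
  rw [h1]
  have h2 : ((cycles G k).sigma fun z => oddAttached G z).card
      ≤ ((univ : Finset (ZMod k × Fin k)).biUnion fun q =>
        if Odd q.2.val ∧ q.2.val + 4 ≤ k then
        univ.filter fun p : (ZMod k → V) × V => p.1 ∈ cycles G k ∧ G.Adj p.2 (p.1 q.1)
      ∧ G.Adj p.2 (p.1 (q.1 + (q.2.val : ZMod k))) else ∅).card := by
    refine card_le_card_of_injOn (fun p => (p.1, p.2)) ?_ ?_
    · rintro ⟨z, u⟩ hp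
      simp only [coe_sigma, Set.mem_sigma_iff, mem_coe, oddAttached, mem_filter, mem_univ,
        true_and, nbrIdx] at hp
      obtain ⟨hz, i, hi, j, hj, hij⟩ := hp
      push Not at hij
      rw [mem_coe, mem_biUnion]
      obtain ⟨t, ht⟩ := hodd
      set d := (j - i).val with hd
      have hdk : d < k := ZMod.val_lt _
      have hjd : j = i + d := by rw [hd, ZMod.natCast_zmod_val]; ring
      have hj' : j = i - ((k - d : ℕ) : ZMod k) := by
        rw [Nat.cast_sub hdk.le, hjd]; simp
      have c1 : d ≠ 0 := by
        intro h1; apply hij.1; rw [hjd, h1]; simp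
      have c2 : d ≠ 2 := by
        intro h1; apply hij.2.1; rw [hjd, h1]; simp
      have c3 : k - d ≠ 2 := by
        intro h1; apply hij.2.2; rw [hj', h1]; simp
      rcases Nat.even_or_odd' d with ⟨e, he | he⟩
      · refine ⟨(j, ⟨k - d, by omega⟩), mem_univ _, ?_⟩
        rw [if_pos ⟨⟨t - e, by simp only; omega⟩, by simp only; omega⟩]
        have hi' : j + ((k - d : ℕ) : ZMod k) = i := by rw [hj']; ring
        simp only [mem_filter, mem_univ, true_and, hi']
        exact ⟨hz, hj, hi⟩
      · refine ⟨(i, ⟨d, hdk⟩), mem_univ _, ?_⟩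
        rw [if_pos ⟨⟨e, he⟩, by simp only; omega⟩]
        simp only [mem_filter, mem_univ, true_and, ← hjd]
        exact ⟨hz, hi, hj⟩
    · rintro ⟨z, u⟩ _ ⟨z', u'⟩ _ h
      simp only [Prod.mk.injEq] at h
      obtain ⟨rfl, rfl⟩ := h
      rfl
  refine h2.trans (card_biUnion_le.trans ?_)
  refine (sum_le_card_nsmul _ _ (2 * k ^ 2 * Fintype.card V ^ k) ?_).trans (le_of_eq ?_)
  · rintro ⟨i, d⟩ -
    split_ifs with h
    · refine (card_two_nbrs_le hk hodd hfree i d.val h.1 h.2).trans ?_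
      have : Fintype.card V ^ k = Fintype.card V * Fintype.card V ^ (k - 1) := by
        rw [← pow_succ']; congr 1; omega
      rw [this, ← mul_assoc]
      gcongr
      omega
    · simp
  · rw [card_univ, Fintype.card_prod, ZMod.card, Fintype.card_fin, smul_eq_mul]; ring

/-- Once all other vertices are fixed, `z (i + 1)` must be one of fewer than `θ` common neighbours.
-/
theorem card_low_codegree_le {V : Type*} [Fintype V] {k : ℕ} [NeZero k] (hk : 7 ≤ k)
    {G : SimpleGraph V} {θ : ℝ} (hθ : 0 ≤ θ) :
    (((cycles G k).filter fun z => ∃ i,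
      ((univ.filter fun w => G.Adj (z i) w ∧ G.Adj (z (i + 2)) w).card : ℝ) < θ).card : ℝ)
      ≤ k * (θ * Fintype.card V ^ (k - 1)) := by
  have h1 : ((cycles G k).filter fun z => ∃ i,
      ((univ.filter fun w => G.Adj (z i) w ∧ G.Adj (z (i + 2)) w).card : ℝ) < θ).card
      ≤ k * (⌊θ⌋₊ * Fintype.card V ^ (k - 1)) := by
    have hsub : ((cycles G k).filter fun z => ∃ i,
      ((univ.filter fun w => G.Adj (z i) w ∧ G.Adj (z (i + 2)) w).card : ℝ) < θ)
      ⊆ univ.biUnion fun i => (cycles G k).filter fun z =>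
        ((univ.filter fun w => G.Adj (z i) w ∧ G.Adj (z (i + 2)) w).card : ℝ) < θ := by
      intro z hz
      rw [mem_filter] at hz
      obtain ⟨hz, i, hi⟩ := hz
      rw [mem_biUnion]
      exact ⟨i, mem_univ _, mem_filter.2 ⟨hz, hi⟩⟩
    refine (card_le_card hsub).trans (card_biUnion_le.trans ?_)
    refine (sum_le_card_nsmul _ _ (⌊θ⌋₊ * Fintype.card V ^ (k - 1)) ?_).trans (le_of_eq ?_)
    · intro i _
      set P := (cycles G k).filter fun z =>
        ((univ.filter fun w => G.Adj (z i) w ∧ G.Adj (z (i + 2)) w).card : ℝ) < θ with hP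
      have h2 := card_le_of_fiber (U := Unit) (i + 1) (P ×ˢ univ) ⌊θ⌋₊ ?_
      · rwa [card_product, card_univ, Fintype.card_unit, mul_one, ZMod.card] at h2
      · rintro ⟨z, u⟩ hz
        simp only [mem_product, mem_univ, and_true, hP, mem_filter] at hz
        refine le_trans (card_le_card_of_injOn Prod.fst ?_ ?_) (Nat.le_floor hz.2.le)
        · intro q hq
          simp only [coe_filter, Set.mem_ofPred_eq, mem_product, mem_univ, and_true, true_and,
            hP, mem_filter, mem_cycles] at hq ⊢
          have n1 : (i : ZMod k) ≠ i + 1 := by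
            have := natCast_ne_zero_of_lt (k := k) (a := 1) (by omega) (by omega)
            simpa using this
          have n2 : i + 2 ≠ i + 1 := by
            have := natCast_ne_zero_of_lt (k := k) (a := 1) (by omega) (by omega)
            intro h
            apply this
            push_cast
            linear_combination h
          have a1 := hq.1.2 i
          have a2 := hq.1.2 (i + 1)
          rw [Function.update_self, Function.update_of_ne n1] at a1
          rw [show i + 1 + 1 = i + 2 by ring, Function.update_self,
            Function.update_of_ne n2] at a2
          exact ⟨a1, a2.symm⟩
        · rintro ⟨a, u⟩ _ ⟨b, u'⟩ _ hab
          exact Prod.ext hab rfl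
    · rw [card_univ, ZMod.card, smul_eq_mul]
  have h2 : (((cycles G k).filter fun z => ∃ i,
      ((univ.filter fun w => G.Adj (z i) w ∧ G.Adj (z (i + 2)) w).card : ℝ) < θ).card : ℝ)
      ≤ k * (⌊θ⌋₊ * Fintype.card V ^ (k - 1)) := by exact_mod_cast h1
  refine h2.trans ?_
  have := Nat.floor_le hθ
  gcongr

/-- The number of common neighbours. -/
noncomputable def codeg {V : Type*} [Fintype V] (G : SimpleGraph V) (a b : V) : ℕ :=
  (univ.filter fun w => G.Adj a w ∧ G.Adj b w).card

theorem codeg_comm {V : Type*} [Fintype V] (G : SimpleGraph V) (a b : V) :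
    codeg G a b = codeg G b a := by
  unfold codeg
  congr 1
  ext w
  simp only [mem_filter, mem_univ, true_and]
  exact and_comm

theorem mem_codegIdx {V : Type*} [Fintype V] {k : ℕ} [NeZero k] {G : SimpleGraph V} {θ : ℝ}
    {z : ZMod k → V} {u : V} {i : ZMod k} :
    i ∈ codegIdx G θ z u ↔ θ ≤ codeg G u (z i) := by
  simp [codegIdx, codeg]

/-- Vertices adjacent to `z i` with large codegree to `z j`, where `i` and `j` are not at odd
distance `1` or `3`. -/
noncomputable def mixedAttached {V : Type*} [Fintype V] {k : ℕ} [NeZero k] (G : SimpleGraph V)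
    (θ : ℝ) (z : ZMod k → V) : Finset V :=
  univ.filter fun u => ∃ i ∈ nbrIdx G z u, ∃ j ∈ codegIdx G θ z u,
    ¬ (j = i + 1 ∨ j = i - 1 ∨ j = i + 3 ∨ j = i - 3)

/-- Vertices with large codegree to two consecutive vertices of `z`. -/
noncomputable def codegAttached {V : Type*} [Fintype V] {k : ℕ} [NeZero k] (G : SimpleGraph V)
    (θ : ℝ) (z : ZMod k → V) : Finset V :=
  univ.filter fun u => ∃ i ∈ codegIdx G θ z u, i + 1 ∈ codegIdx G θ z u

/-- Each such `u` yields at least `θ` edges from `u` to its common neighbours with `z j`. All of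
them run between the neighbourhoods of `z i` and `z j`, which span `O(n)` edges by
`card_adj_nbrs_le`. -/
theorem card_mixedAttached_le {V : Type*} [Fintype V] {k : ℕ} [NeZero k] (hk : 7 ≤ k)
    (hodd : Odd k) {G : SimpleGraph V} (hfree : (SimpleGraph.cycleGraph (k - 2)).Free G)
    {z : ZMod k → V} (hz : z ∈ cycles G k) {θ : ℝ} (hθ : 0 < θ) :
    (mixedAttached G θ z).card * θ ≤ 2 * k ^ 4 * Fintype.card V := by
  set D : ℕ := 2 * (k - 2) ^ 2 * Fintype.card V with hD
  have hDk : D ≤ 2 * k ^ 2 * Fintype.card V := by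
    rw [hD]; gcongr; omega
  let X : ZMod k × ZMod k → Finset V := fun q =>
    if ¬ (q.2 = q.1 + 1 ∨ q.2 = q.1 - 1 ∨ q.2 = q.1 + 3 ∨ q.2 = q.1 - 3) then
      univ.filter fun u => G.Adj u (z q.1) ∧ θ ≤ codeg G u (z q.2) else ∅
  have hsub : mixedAttached G θ z ⊆ univ.biUnion X := by
    intro u hu
    simp only [mixedAttached, mem_filter, mem_univ, true_and] at hu
    obtain ⟨i, hi, j, hj, hij⟩ := hu
    rw [mem_biUnion]
    refine ⟨(i, j), mem_univ _, ?_⟩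
    simp only [X]
    rw [if_pos hij, mem_filter]
    exact ⟨mem_univ _, by simpa [nbrIdx] using hi, mem_codegIdx.1 hj⟩
  have hX : ∀ q, ((X q).card : ℝ) * θ ≤ D := by
    rintro ⟨i, j⟩
    simp only [X]
    split_ifs with h
    · simp
    · set U := univ.filter fun u => G.Adj u (z i) ∧ θ ≤ codeg G u (z j) with hU
      have h1 := card_adj_nbrs_le hk hodd hfree hz i j h
      have h2 : ∑ u ∈ U, codeg G u (z j) ≤ D := by
        refine le_trans (le_of_eq ?_) (le_trans (card_le_card_of_injOn
          (s := U.sigma fun u => univ.filter fun w => G.Adj u w ∧ G.Adj (z j) w)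
          (fun p => (p.1, p.2)) ?_ ?_) h1)
        · rw [card_sigma]; rfl
        · rintro ⟨u, w⟩ hp
          simp only [coe_sigma, Set.mem_sigma_iff, mem_coe, mem_filter, mem_univ, true_and,
            hU] at hp ⊢
          exact ⟨hp.1.1.symm, hp.2.2, hp.2.1⟩
        · rintro ⟨u, w⟩ _ ⟨u', w'⟩ _ h
          simp only [Prod.mk.injEq] at h
          obtain ⟨rfl, rfl⟩ := h
          rfl
      have h3 := card_nsmul_le_sum U (fun u => (codeg G u (z j) : ℝ)) θ
        (fun u hu => (mem_filter.1 hu).2.2)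
      rw [nsmul_eq_mul] at h3
      refine h3.trans ?_
      exact_mod_cast h2
  have h1 : ((mixedAttached G θ z).card : ℝ) ≤ ∑ q, ((X q).card : ℝ) := by
    exact_mod_cast (card_le_card hsub).trans card_biUnion_le
  calc (mixedAttached G θ z).card * θ ≤ (∑ q, ((X q).card : ℝ)) * θ :=
        mul_le_mul_of_nonneg_right h1 hθ.le
    _ = ∑ q, ((X q).card : ℝ) * θ := sum_mul _ _ _
    _ ≤ ∑ q : ZMod k × ZMod k, (D : ℝ) := sum_le_sum fun q _ => hX q
    _ = k ^ 2 * D := by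
        rw [sum_const, card_univ, Fintype.card_prod, ZMod.card, nsmul_eq_mul]; push_cast; ring
    _ ≤ k ^ 2 * (2 * k ^ 2 * Fintype.card V) := by
        gcongr
        exact_mod_cast hDk
    _ = _ := by ring

/-- Count triples `(u, w, w')` with `w` a common neighbour of `u` and `z i`, and `w'` one of `u` and
`z (i + 1)`. For fixed `w'`, `wu` is an edge between the neighbourhoods of the ends of the path `z
i, z (i + 1), w'`, so there are `O(n²)` triples. The path requires `w' ≠ z i`, whence `θ - 1`. -/
theorem card_codegAttached_le {V : Type*} [Fintype V] {k : ℕ} [NeZero k] (hk : 7 ≤ k)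
    (hodd : Odd k) {G : SimpleGraph V} (hfree : (SimpleGraph.cycleGraph (k - 2)).Free G)
    {z : ZMod k → V} (hz : z ∈ cycles G k) {θ : ℝ} (hθ : 1 < θ) :
    (codegAttached G θ z).card * (θ * (θ - 1)) ≤ 2 * k ^ 3 * (Fintype.card V : ℝ) ^ 2 := by
  obtain ⟨hinj, hadj⟩ := mem_cycles.1 hz
  set D : ℕ := 2 * (k - 2) ^ 2 * Fintype.card V with hD
  have hDk : D ≤ 2 * k ^ 2 * Fintype.card V := by
    rw [hD]; gcongr; omega
  let X : ZMod k → Finset V := fun i =>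
    univ.filter fun u => θ ≤ codeg G u (z i) ∧ θ ≤ codeg G u (z (i + 1))
  have hsub : codegAttached G θ z ⊆ univ.biUnion X := by
    intro u hu
    simp only [codegAttached, mem_filter, mem_univ, true_and] at hu
    obtain ⟨i, hi, hi1⟩ := hu
    rw [mem_biUnion]
    exact ⟨i, mem_univ _, mem_filter.2 ⟨mem_univ _, mem_codegIdx.1 hi, mem_codegIdx.1 hi1⟩⟩
  have hX : ∀ i, ((X i).card : ℝ) * (θ * (θ - 1)) ≤ Fintype.card V * D := by
    intro i
    let A : V → Finset V := fun u => univ.filter fun w => G.Adj u w ∧ G.Adj (z i) w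
    let A' : V → Finset V := fun u =>
      (univ.filter fun w => G.Adj u w ∧ G.Adj (z (i + 1)) w).erase (z i)
    have h1 : ∀ w', w' ≠ z i → G.Adj (z (i + 1)) w' → (univ.filter fun e : V × V =>
        G.Adj (z i) e.1 ∧ G.Adj w' e.2 ∧ G.Adj e.1 e.2).card ≤ D := by
      intro w' hne hw'
      have hlodd : Odd (k - 2) := by
        obtain ⟨t, rfl⟩ := hodd
        exact ⟨t - 1, by omega⟩
      refine card_adj_pairs_le G (k - 2) hlodd hfree [z i, z (i + 1), w'] ⟨1, rfl⟩
        (by simp; omega) ?_ ?_ _ _ rfl rfl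
      · have := (hadj i).ne
        have := hw'.ne
        simp only [List.nodup_cons, List.mem_cons, List.not_mem_nil, or_false, not_or,
          not_false_eq_true, List.nodup_nil, and_true]
        exact ⟨⟨(hadj i).ne, hne.symm⟩, hw'.ne⟩
      · simp [hadj i, hw']
    have h2 : ∑ u ∈ X i, (A u).card * (A' u).card ≤ Fintype.card V * D := by
      have e1 : ∑ u ∈ X i, (A u).card * (A' u).card
          = ((X i).sigma fun u => A u ×ˢ A' u).card := by
        rw [card_sigma]
        exact sum_congr rfl fun u _ => (card_product _ _).symm
      rw [e1]
      let Y : V → Finset (V × V) := fun w' =>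
        if w' ≠ z i ∧ G.Adj (z (i + 1)) w' then
          univ.filter fun e : V × V => G.Adj (z i) e.1 ∧ G.Adj w' e.2 ∧ G.Adj e.1 e.2 else ∅
      have e2 : ((X i).sigma fun u => A u ×ˢ A' u).card
          ≤ ((univ : Finset V).sigma Y).card := by
        refine card_le_card_of_injOn (fun p => ⟨p.2.2, (p.2.1, p.1)⟩) ?_ ?_
        · rintro ⟨u, w, w'⟩ hp
          simp only [coe_sigma, Set.mem_sigma_iff, mem_coe, mem_product, A, A', mem_filter,
            mem_univ, true_and, mem_erase, Y] at hp ⊢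
          obtain ⟨_, ⟨huw, hiw⟩, hne, huw', hiw'⟩ := hp
          rw [if_pos ⟨hne, hiw'⟩, mem_filter]
          exact ⟨mem_univ _, hiw, huw'.symm, huw.symm⟩
        · rintro ⟨u, w, w'⟩ _ ⟨u1, w1, w1'⟩ _ h
          simp only [Sigma.mk.injEq, heq_eq_eq, Prod.mk.injEq] at h
          obtain ⟨rfl, rfl, rfl⟩ := h
          rfl
      refine e2.trans ?_
      rw [card_sigma]
      refine (sum_le_card_nsmul _ _ D ?_).trans (le_of_eq ?_)
      · intro w' _
        simp only [Y]
        split_ifs with h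
        · exact h1 w' h.1 h.2
        · simp
      · rw [card_univ, smul_eq_mul]
    have h3 := card_nsmul_le_sum (X i) (fun u => ((A u).card : ℝ) * ((A' u).card : ℝ))
      (θ * (θ - 1)) (fun u hu => by
        have hu := (mem_filter.1 hu).2
        have a1 : θ ≤ ((A u).card : ℝ) := hu.1
        have a2 : θ - 1 ≤ ((A' u).card : ℝ) := by
          have b1 := pred_card_le_card_erase
            (s := univ.filter fun w => G.Adj u w ∧ G.Adj (z (i + 1)) w) (a := z i)
          have b2 : codeg G u (z (i + 1)) ≤ (A' u).card + 1 := by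
            simp only [A', codeg]; omega
          have b3 : (codeg G u (z (i + 1)) : ℝ) ≤ (A' u).card + 1 := by exact_mod_cast b2
          linarith [hu.2]
        exact mul_le_mul a1 a2 (by linarith) (by positivity))
    rw [nsmul_eq_mul] at h3
    refine h3.trans ?_
    exact_mod_cast h2
  have hpos : 0 ≤ θ * (θ - 1) := mul_nonneg (by linarith) (by linarith)
  have h1 : ((codegAttached G θ z).card : ℝ) ≤ ∑ q, ((X q).card : ℝ) := by
    exact_mod_cast (card_le_card hsub).trans card_biUnion_le
  calc (codegAttached G θ z).card * (θ * (θ - 1)) ≤ (∑ q, ((X q).card : ℝ)) * (θ * (θ - 1)) :=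
        mul_le_mul_of_nonneg_right h1 hpos
    _ = ∑ q, ((X q).card : ℝ) * (θ * (θ - 1)) := sum_mul _ _ _
    _ ≤ ∑ q : ZMod k, (Fintype.card V * D : ℝ) := sum_le_sum fun q _ => hX q
    _ = k * (Fintype.card V * D) := by
        rw [sum_const, card_univ, ZMod.card, nsmul_eq_mul]
    _ ≤ k * (Fintype.card V * (2 * k ^ 2 * Fintype.card V)) := by
        gcongr
        exact_mod_cast hDk
    _ = _ := by ring

/-- Vertices of atypical position with respect to the cycle `z`. -/
noncomputable def atypical {V : Type*} [Fintype V] {k : ℕ} [NeZero k] (G : SimpleGraph V)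
    (θ : ℝ) (z : ZMod k → V) : Finset V :=
  oddAttached G z ∪ mixedAttached G θ z ∪ codegAttached G θ z

/-! ### The weighted cycle count and the existence of a good cycle. -/

theorem sum_choiceWeight_le {V : Type*} [Fintype V] {k : ℕ} [NeZero k] (hk : 7 ≤ k)
    (hodd : Odd k) (G : SimpleGraph V) (θ : ℝ) (z : ZMod k → V) (u : V) :
    ∑ j : ZMod k, choiceWeight j *
      ((univ.filter fun r => u ∈ choiceSet G θ j fun i => z (i + r)).card : ℝ)
      ≤ (k - 1) + if u ∈ atypical G θ z then (k : ℝ) ^ 2 else 0 := by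
  rw [sum_choiceWeight_eq hk hodd]
  have hkR : (7 : ℝ) ≤ k := by exact_mod_cast hk
  split_ifs with hu
  · have b : ∀ s : Finset (ZMod k), (s.card : ℝ) ≤ k := by
      intro s
      have := card_le_univ s
      rw [ZMod.card] at this
      exact_mod_cast this
    have b1 := b (nbrIdx G z u)
    have b2 := b (univ.filter fun r => r ∈ nbrIdx G z u ∧ r + 2 ∈ nbrIdx G z u)
    have b3 := b (univ.filter fun r => r + 1 ∈ codegIdx G θ z u ∧ r ∉ nbrIdx G z u)
    have b4 := mul_le_mul_of_nonneg_left
      (b (univ.filter fun r => r ∈ nbrIdx G z u ∧ r - 2 ∉ nbrIdx G z u))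
      (by linarith : (0 : ℝ) ≤ k - 5)
    nlinarith
  · rw [add_zero]
    simp only [atypical, mem_union, not_or] at hu
    apply incidence_count_le hk hodd
    · intro i hi j hj
      by_contra h
      exact hu.1.1 (mem_filter.2 ⟨mem_univ _, i, hi, j, hj, h⟩)
    · intro i hi j hj
      by_contra h
      exact hu.1.2 (mem_filter.2 ⟨mem_univ _, i, hi, j, hj, h⟩)
    · intro i hi hi1
      exact hu.2 (mem_filter.2 ⟨mem_univ _, i, hi, hi1⟩)

theorem sum_sum_choiceSet_le {V : Type*} [Fintype V] {k : ℕ} [NeZero k] (hk : 7 ≤ k)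
    (hodd : Odd k) (G : SimpleGraph V) (θ : ℝ) (z : ZMod k → V) :
    ∑ r : ZMod k, ∑ j : ZMod k, choiceWeight j *
      ((choiceSet G θ j fun i => z (i + r)).card : ℝ)
      ≤ (k - 1) * Fintype.card V + k ^ 2 * (atypical G θ z).card := by
  have h1 : ∑ r : ZMod k, ∑ j : ZMod k, choiceWeight j *
      ((choiceSet G θ j fun i => z (i + r)).card : ℝ)
      = ∑ u : V, ∑ j : ZMod k, choiceWeight j *
      ((univ.filter fun r => u ∈ choiceSet G θ j fun i => z (i + r)).card : ℝ) := by
    rw [sum_comm, sum_comm (s := (univ : Finset V))]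
    refine sum_congr rfl fun j _ => ?_
    rw [← mul_sum, ← mul_sum]
    congr 1
    simp only [card_eq_sum_ones, Nat.cast_sum, Nat.cast_one, sum_filter]
    rw [sum_comm]
    refine sum_congr rfl fun r _ => ?_
    simp
  rw [h1]
  refine (sum_le_sum fun u _ => sum_choiceWeight_le hk hodd G θ z u).trans (le_of_eq ?_)
  rw [sum_add_distrib, sum_const, sum_ite_mem, univ_inter, sum_const, card_univ, nsmul_eq_mul,
    nsmul_eq_mul]
  ring

theorem not_adj_add_three {V : Type*} [Fintype V] {k : ℕ} [NeZero k] (hk : 7 ≤ k)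
    {G : SimpleGraph V} (hfree : (SimpleGraph.cycleGraph (k - 2)).Free G)
    {z : ZMod k → V} (hz : z ∈ cycles G k) (i : ZMod k) : ¬ G.Adj (z (i + 3)) (z i) := by
  intro hcon
  obtain ⟨hinj, hadj⟩ := mem_cycles.1 hz
  refine not_free_cycleGraph_of_list (m := k - 2) (by omega)
    ((List.range (k - 3 + 1)).map fun t : ℕ => z (i + 3 + t)) ?_ ?_ ?_ ?_ hfree
  · simp; omega
  · refine List.Nodup.map_on ?_ List.nodup_range
    intro a ha b hb hab
    rw [List.mem_range] at ha hb
    have h1 := add_left_cancel (hinj hab)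
    rw [← ZMod.val_cast_of_lt (by omega : a < k), ← ZMod.val_cast_of_lt (by omega : b < k), h1]
  · rw [List.isChain_map, List.isChain_iff_getElem]
    intro t ht
    simp only [List.getElem_range]
    have := hadj (i + 3 + t)
    push_cast
    rwa [add_assoc (i + 3)] at this
  · intro a ha b hb
    rw [List.getLast?_map, List.getLast?_range] at ha
    rw [List.head?_map, List.head?_range] at hb
    simp at ha hb
    subst ha hb
    rw [Nat.cast_sub (by omega)]
    have : i + 3 + ((k : ZMod k) - (3 : ℕ)) = i := by simp
    rw [this]
    exact hcon.symm

/-- The non-adjacencies demanded by the choice sets hold because a chord joining positions at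
distance three would cut off a `C_{k-2}`. The codegree hypothesis matters at position `3` only. -/
theorem mem_choiceSet_self {V : Type*} [Fintype V] {k : ℕ} [NeZero k] (hk : 7 ≤ k)
    {G : SimpleGraph V} (hfree : (SimpleGraph.cycleGraph (k - 2)).Free G)
    {z : ZMod k → V} (hz : z ∈ cycles G k) {θ : ℝ}
    (hcodeg : ∀ i, θ ≤ codeg G (z i) (z (i + 2))) (j : ZMod k) :
    z j ∈ choiceSet G θ j z := by
  obtain ⟨hinj, hadj⟩ := mem_cycles.1 hz
  unfold choiceSet
  split_ifs with h0 h1 h2 h3 h4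
  · exact mem_univ _
  · subst h1
    have := hadj 0
    rw [zero_add] at this
    simpa using this.symm
  · subst h2
    have a1 := hadj 1
    have a2 := hadj 2
    rw [show (1 : ZMod k) + 1 = 2 by ring] at a1
    rw [show (2 : ZMod k) + 1 = 3 by ring] at a2
    simpa using ⟨a1.symm, a2⟩
  · subst h3
    have a1 := hcodeg 1
    rw [show (1 : ZMod k) + 2 = 3 by ring, codeg_comm] at a1
    have a2 := not_adj_add_three hk hfree hz 0
    rw [zero_add] at a2
    rw [mem_filter]
    exact ⟨mem_univ _, a1, a2⟩
  · subst h4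
    have a1 := hadj (-2)
    have a2 := hadj (-1)
    rw [show (-2 : ZMod k) + 1 = -1 by ring] at a1
    rw [show (-1 : ZMod k) + 1 = 0 by ring] at a2
    simpa using ⟨a1.symm, a2⟩
  · have a1 := hadj (j - 1)
    rw [sub_add_cancel] at a1
    have a2 := not_adj_add_three hk hfree hz (j - 3)
    rw [sub_add_cancel] at a2
    simpa using ⟨a1.symm, a2⟩

/-- The size of the `j`-th choice set in a balanced blow-up on `n` vertices. -/
noncomputable def choiceSize {k : ℕ} (n : ℝ) (j : ZMod k) : ℝ :=
  if j = 0 then n else if j = 1 then 2 * (n / k) else n / k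

theorem prod_choiceSize {k : ℕ} [NeZero k] (hk : 7 ≤ k) (n : ℝ) :
    ∏ j : ZMod k, choiceSize n j = 2 * k * (n / k) ^ k := by
  have h1 : (1 : ZMod k) ≠ 0 := by
    exact_mod_cast natCast_ne_zero_of_lt (k := k) (a := 1) (by omega) (by omega)
  rw [← mul_prod_erase univ _ (mem_univ (0 : ZMod k)),
    ← mul_prod_erase (univ.erase 0) _ (mem_erase.2 ⟨h1, mem_univ (1 : ZMod k)⟩)]
  rw [prod_congr rfl (g := fun _ => n / k)]
  · rw [prod_const, card_erase_of_mem (mem_erase.2 ⟨h1, mem_univ _⟩),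
      card_erase_of_mem (mem_univ _), card_univ, ZMod.card]
    simp only [choiceSize, if_true, h1, if_false]
    have hk0 : (k : ℝ) ≠ 0 := by exact_mod_cast NeZero.ne k
    obtain ⟨m, rfl⟩ : ∃ m, k = m + 2 := ⟨k - 2, by omega⟩
    have : m + 2 - 1 - 1 = m := by omega
    rw [this, pow_add]
    field_simp
  · intro j hj
    simp only [mem_erase, mem_univ, and_true] at hj
    simp [choiceSize, hj.1, hj.2]

theorem choiceSize_pos {k : ℕ} [NeZero k] {n : ℝ} (hn : 0 < n) (j : ZMod k) :
    0 < choiceSize n j := by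
  have hk0 : (0 : ℝ) < k := by exact_mod_cast NeZero.pos k
  unfold choiceSize
  split_ifs <;> positivity

set_option maxHeartbeats 1000000 in
-- The weights `w` sum to at most one over `S`, and `S` is invariant under rotation, so it suffices
-- to bound the total weight of the rotations of a single cycle from below. Dividing each choice set
-- by its size in the balanced blow-up turns this into `one_add_sum_le_prod_inv` together with the
-- incidence count. The small codegree provides the gain `ε²/4` in one rotation.
theorem card_mul_le_of_small_codegree {V : Type*} [Fintype V] {k : ℕ} [NeZero k] (hk : 7 ≤ k)
    (hodd : Odd k) {G : SimpleGraph V} (hfree : (SimpleGraph.cycleGraph (k - 2)).Free G)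
    (S : Finset (ZMod k → V)) (hS : S ⊆ cycles G k)
    (hshift : ∀ z ∈ S, ∀ r, (fun i => z (i + r)) ∈ S) {θ η ε : ℝ}
    (hcodeg : ∀ z ∈ S, ∀ i, θ ≤ codeg G (z i) (z (i + 2)))
    (hatyp : ∀ z ∈ S, ((atypical G θ z).card : ℝ) ≤ η * Fintype.card V)
    (hn : 0 < Fintype.card V) (hε : 0 ≤ ε)
    (hsmall : ∀ z ∈ S, ∃ i, (codeg G (z i) (z (i + 2)) : ℝ) ≤ (1 - ε) * (Fintype.card V / k)) :
    S.card * (1 - k ^ 2 * η + ε ^ 2 / (4 * k)) ≤ 2 * k * ((Fintype.card V : ℝ) / k) ^ k := by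
  set n : ℝ := (Fintype.card V : ℝ) with hn_def
  have hnR : 0 < n := by rw [hn_def]; exact_mod_cast hn
  have hk0 : (0 : ℝ) < k := by exact_mod_cast NeZero.pos k
  obtain ⟨n1, n2, n3, n4, n6, n8⟩ := natCast_even_ne hk hodd
  set T : ℝ := 2 * k * (n / k) ^ k with hT
  have hTpos : 0 < T := by positivity
  let w : (ZMod k → V) → ℝ := fun z => ∏ j, ((choiceSet G θ j z).card : ℝ)⁻¹
  have hw1 : ∑ z ∈ S, w z ≤ 1 :=
    sum_prod_inv_card_le_one (choiceRank k) (choiceSet G θ) (choiceSet_congr hk G θ) S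
      (fun z hz j => mem_choiceSet_self hk hfree (hS hz) (hcodeg z hz) j)
  have hwshift : ∀ r, ∑ z ∈ S, w (fun i => z (i + r)) = ∑ z ∈ S, w z := by
    intro r
    refine sum_bij (fun z _ => fun i => z (i + r)) (fun z hz => hshift z hz r) ?_ ?_ ?_
    · intro z _ z' _ h
      funext i
      have := congrFun h (i - r)
      simpa using this
    · intro z hz
      refine ⟨fun i => z (i + -r), hshift z hz (-r), ?_⟩
      funext i
      simp
    · intro z _; rfl
  let x : (ZMod k → V) → ZMod k → ℝ := fun z j => ((choiceSet G θ j z).card : ℝ) / choiceSize n j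
  have hxw : ∀ z, w z = (∏ j, (x z j)⁻¹) / T := by
    intro z
    simp only [w, x, inv_div, prod_div_distrib, prod_inv_distrib]
    rw [prod_choiceSize hk, ← hT, div_right_comm, div_self hTpos.ne', one_div]
  have hxpos : ∀ z ∈ S, ∀ j, 0 < x z j := by
    intro z hz j
    refine div_pos ?_ (choiceSize_pos hnR j)
    exact_mod_cast card_pos.2 ⟨_, mem_choiceSet_self hk hfree (hS hz) (hcodeg z hz) j⟩
  have hxsum : ∀ z : ZMod k → V, ∑ j, x z j
      = 1 + k / n * ∑ j, choiceWeight j * ((choiceSet G θ j z).card : ℝ) := by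
    intro z
    rw [mul_sum, ← add_sum_erase univ _ (mem_univ (0 : ZMod k)),
      ← add_sum_erase univ (fun j => k / n * (choiceWeight j * ((choiceSet G θ j z).card : ℝ)))
        (mem_univ (0 : ZMod k)), ← add_assoc]
    congr 1
    · simp only [x, choiceSet, choiceSize, choiceWeight, if_true, card_univ]
      rw [← hn_def]
      field_simp
      simp
    · refine sum_congr rfl fun j hj => ?_
      have hj := (mem_erase.1 hj).1
      simp only [x, choiceSize, choiceWeight, hj, if_false]
      split_ifs
      · field_simp
      · field_simp
  have hmain : ∀ z ∈ S, (k - k ^ 3 * η + ε ^ 2 / 4) / T ≤ ∑ r : ZMod k, w (fun i => z (i + r)) := by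
    intro z hz
    obtain ⟨i, hi⟩ := hsmall z hz
    -- After rotation by `i - 1`, the choice set at position `2` is the common neighbourhood of `z
    -- i` and `z (i + 2)`, so this rotation has the gain.
    have h1 : ∀ r : ZMod k, 1 + ∑ j, (1 - x (fun i => z (i + r)) j)
        + (if r = i - 1 then ε ^ 2 / 4 else 0) ≤ w (fun i => z (i + r)) * T := by
      intro r
      rw [hxw, div_mul_cancel₀ _ hTpos.ne']
      refine one_add_sum_le_prod_inv _ (hxpos _ (hshift z hz r)) 2 _ ?_
      split_ifs with hr
      · apply log_le_sub_one_sub_sq (hxpos _ (hshift z hz r) 2) hε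
        have d21 : (2 : ZMod k) ≠ 1 := fun e => n1 (by linear_combination e)
        have : (choiceSet G θ 2 fun i => z (i + r)).card = codeg G (z i) (z (i + 2)) := by
          simp only [choiceSet, n2, d21, if_false, if_true, codeg]
          congr 1
          ext u
          rw [hr, show (1 : ZMod k) + (i - 1) = i by ring,
            show (3 : ZMod k) + (i - 1) = i + 2 by ring]
          simp [G.adj_comm]
        simp only [x, this, choiceSize, n2, d21, if_false]
        rw [div_le_iff₀ (by positivity)]
        exact hi
      · rw [sub_zero]
        exact Real.log_le_sub_one_of_pos (hxpos _ (hshift z hz r) 2)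
    have h2 := sum_le_sum fun r (_ : r ∈ (univ : Finset (ZMod k))) => h1 r
    rw [← sum_mul] at h2
    rw [div_le_iff₀ hTpos]
    refine le_trans ?_ h2
    have h3 := sum_sum_choiceSet_le hk hodd G θ z
    have h4 := hatyp z hz
    have h5 : ∑ r : ZMod k, (1 + ∑ j, (1 - x (fun i => z (i + r)) j)
        + (if r = i - 1 then ε ^ 2 / 4 else 0))
        = k ^ 2 + ε ^ 2 / 4 - k / n * ∑ r : ZMod k, ∑ j : ZMod k, choiceWeight j *
          ((choiceSet G θ j fun i => z (i + r)).card : ℝ) := by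
      simp only [sum_add_distrib, sum_sub_distrib, hxsum, sum_const, card_univ, ZMod.card,
        nsmul_eq_mul, mul_one, sum_ite_eq', mem_univ, if_true, ← mul_sum]
      ring
    rw [h5]
    have h6 : k / n * ∑ r : ZMod k, ∑ j : ZMod k, choiceWeight j *
          ((choiceSet G θ j fun i => z (i + r)).card : ℝ)
        ≤ k / n * ((k - 1) * n + k ^ 2 * (η * n)) := by
      apply mul_le_mul_of_nonneg_left _ (by positivity)
      refine h3.trans ?_
      gcongr
    have h7 : k / n * ((k - 1) * n + k ^ 2 * (η * n)) = k ^ 2 - k + k ^ 3 * η := by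
      field_simp
    linarith
  have hfin := sum_le_sum hmain
  rw [sum_comm, sum_const, nsmul_eq_mul, sum_congr rfl fun r _ => hwshift r, sum_const, card_univ,
    ZMod.card, nsmul_eq_mul] at hfin
  have h8 : S.card * ((k - k ^ 3 * η + ε ^ 2 / 4) / T) ≤ k := by nlinarith
  rw [mul_div_assoc', div_le_iff₀ hTpos] at h8
  have h9 : (k : ℝ) * (S.card * (1 - k ^ 2 * η + ε ^ 2 / (4 * k)))
      = S.card * (k - k ^ 3 * η + ε ^ 2 / 4) := by
    field_simp
  apply le_of_mul_le_mul_left _ hk0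
  linarith

/-- The natural quotient `n / k` is at least the real number `n/k - 1 = (1/k - 1/n) n`. -/
theorem pow_card_mul_le_of_le_cycles {k n c : ℕ} [NeZero k] (hn : k ≤ n)
    (hL : 2 * k * (n / k) ^ k ≤ c) :
    2 * k * (1 / k - 1 / (n : ℝ)) ^ k * (n : ℝ) ^ k ≤ (c : ℝ) := by
  have hk0 : (0 : ℝ) < k := by exact_mod_cast NeZero.pos k
  have hkn : (k : ℝ) ≤ n := by exact_mod_cast hn
  have hnpos : (0 : ℝ) < n := hk0.trans_le hkn
  have w1 : (2 * k * ((n / k : ℕ) : ℝ) ^ k) ≤ (c : ℝ) := by exact_mod_cast hL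
  refine le_trans ?_ w1
  rw [mul_assoc, ← mul_pow]
  have w2 : (1 / k - 1 / (n : ℝ)) * n ≤ ((n / k : ℕ) : ℝ) := by
    have := Nat.lt_div_mul_add (a := n) (NeZero.pos k)
    have w3 : (n : ℝ) ≤ ((n / k : ℕ) : ℝ) * k + k := by exact_mod_cast this.le
    have w4 : (1 / k - 1 / (n : ℝ)) * n = n / k - 1 := by field_simp
    rw [w4, sub_le_iff_le_add, div_le_iff₀ hk0]
    linarith
  have w5 : 0 ≤ (1 / k - 1 / (n : ℝ)) * n := by
    apply mul_nonneg _ hnpos.le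
    rw [sub_nonneg]
    exact one_div_le_one_div_of_le hk0 hkn
  gcongr

/-- Discard the cycles with a codegree below `τn` or with many odd-attached vertices; only a small
proportion is lost. If every remaining cycle had a small codegree, `card_mul_le_of_small_codegree`
would bound their number by `c n^k / (1 + e)`, below what the hypothesis on the cycle count leaves.
-/
theorem exists_good_cycle (k : ℕ) [NeZero k] (hk : 7 ≤ k) (hodd : Odd k) (ε η : ℝ) (hε : 0 < ε)
    (hη : 0 < η) : ∃ n₀ : ℕ, ∀ {V : Type*} [Fintype V] (G : SimpleGraph V),
      n₀ ≤ Fintype.card V → (SimpleGraph.cycleGraph (k - 2)).Free G →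
      2 * k * (Fintype.card V / k) ^ k ≤ (cycles G k).card →
      ∃ z ∈ cycles G k, ((oddAttached G z).card : ℝ) ≤ η * Fintype.card V ∧
        ∀ i, (1 - ε) * (Fintype.card V / k) < (codeg G (z i) (z (i + 2)) : ℝ) := by
  have hk0 : (0 : ℝ) < k := by exact_mod_cast NeZero.pos k
  -- Half of the gain `ε²/(4k)`; the other half pays for the atypical vertices through the choice of
  -- `ξ`.
  set e : ℝ := ε ^ 2 / (8 * k) with he
  have hepos : 0 < e := by positivity
  -- a smaller bound for the number of atypical vertices
  set ξ : ℝ := min η (e / (2 * k ^ 2)) with hξ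
  have hξpos : 0 < ξ := by positivity
  have hξη : ξ ≤ η := min_le_left _ _
  have hξe : k ^ 2 * (2 * ξ) ≤ e := by
    have : ξ ≤ e / (2 * k ^ 2) := min_le_right _ _
    rw [le_div_iff₀ (by positivity)] at this
    linarith
  set c : ℝ := 2 * k * (1 / k) ^ k with hc
  have hcpos : 0 < c := by positivity
  -- Chosen so that `kτ(1 + e) = ce/2`: losing `kτ n^k` cycles to low codegrees uses only half of
  -- the advantage `ce`.
  set τ : ℝ := c * e / (2 * (1 + e) * k) with hτ
  have hτpos : 0 < τ := by positivity
  have hlim : c < (c - k * τ) * (1 + e) := by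
    have : k * τ * (1 + e) = c * e / 2 := by rw [hτ]; field_simp
    nlinarith [mul_pos hcpos hepos]
  have hinv : Tendsto (fun n : ℕ => (1 : ℝ) / n) atTop (𝓝 0) := tendsto_one_div_atTop_nhds_zero_nat
  have ht : Tendsto (fun n : ℕ => (2 * k * (1 / k - 1 / (n : ℝ)) ^ k - k * τ
      - 2 * k ^ 4 / ξ * (1 / n)) * (1 + e)) atTop
      (𝓝 ((2 * k * (1 / k - 0) ^ k - k * τ - 2 * k ^ 4 / ξ * 0) * (1 + e))) := by
    refine Tendsto.mul_const _ (Tendsto.sub (Tendsto.sub_const ?_ _) (hinv.const_mul _))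
    exact ((hinv.const_sub _).pow k).const_mul _
  have hev1 := ht.eventually_const_lt (u := c) (by simpa [hc] using hlim)
  have hn_top : Tendsto (fun n : ℕ => (n : ℝ)) atTop atTop := tendsto_natCast_atTop_atTop
  have hev2 := (hn_top.const_mul_atTop hτpos).eventually_ge_atTop 2
  -- The right side is the constant bound for the mixed and codegree-attached vertices (`b1` and
  -- `b2` below), which are thus at most `ξn` in total.
  have hev3 := (hn_top.const_mul_atTop hξpos).eventually_ge_atTop
    (2 * k ^ 4 / τ + 4 * k ^ 3 / τ ^ 2)
  have hev4 := eventually_ge_atTop k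
  obtain ⟨n₀, hn₀⟩ := eventually_atTop.1 (hev1.and (hev2.and (hev3.and hev4)))
  refine ⟨n₀, fun {V} _ G hn hfree hL => ?_⟩
  obtain ⟨h1, h2, h3, h4⟩ := hn₀ _ hn
  set n : ℝ := (Fintype.card V : ℝ) with hn_def
  have hkn : (k : ℝ) ≤ n := by rw [hn_def]; exact_mod_cast h4
  have hnpos : 0 < n := hk0.trans_le hkn
  by_contra hcon
  push Not at hcon
  set θ : ℝ := τ * n with hθ
  set S := (cycles G k).filter fun z => (∀ i, θ ≤ codeg G (z i) (z (i + 2))) ∧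
    ((oddAttached G z).card : ℝ) ≤ ξ * n with hS
  have hatyp : ∀ z ∈ S, ((atypical G θ z).card : ℝ) ≤ 2 * ξ * n := by
    intro z hz
    rw [hS, mem_filter] at hz
    have hθ1 : 1 < θ := by linarith
    have hθ0 : 0 < θ := by linarith
    have a1 := card_mixedAttached_le hk hodd hfree hz.1 hθ0
    have a2 := card_codegAttached_le hk hodd hfree hz.1 hθ1
    have b1 : ((mixedAttached G θ z).card : ℝ) ≤ 2 * k ^ 4 / τ := by
      rw [le_div_iff₀ hτpos]
      apply le_of_mul_le_mul_right _ hnpos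
      calc _ = (mixedAttached G θ z).card * θ := by rw [hθ]; ring
        _ ≤ _ := a1
    have b2 : ((codegAttached G θ z).card : ℝ) ≤ 4 * k ^ 3 / τ ^ 2 := by
      rw [le_div_iff₀ (by positivity)]
      apply le_of_mul_le_mul_right _ (by positivity : 0 < n ^ 2)
      have : θ * θ / 2 ≤ θ * (θ - 1) := by nlinarith
      calc ((codegAttached G θ z).card : ℝ) * τ ^ 2 * n ^ 2
          = 2 * ((codegAttached G θ z).card * (θ * θ / 2)) := by rw [hθ]; ring
        _ ≤ 2 * ((codegAttached G θ z).card * (θ * (θ - 1))) := by gcongr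
        _ ≤ 2 * (2 * k ^ 3 * n ^ 2) := by gcongr
        _ = _ := by ring
    have b3 : ((atypical G θ z).card : ℝ) ≤ (oddAttached G z).card + (mixedAttached G θ z).card
        + (codegAttached G θ z).card := by
      have := (card_union_le (oddAttached G z ∪ mixedAttached G θ z) (codegAttached G θ z)).trans
        (Nat.add_le_add_right (card_union_le _ _) _)
      exact_mod_cast this
    linarith [hz.2.2]
  have hSle := card_mul_le_of_small_codegree hk hodd hfree S (filter_subset _ _) ?_
    (fun z hz => (mem_filter.1 hz).2.1) hatyp (by omega) hε.le ?_
  · -- lower bound for the size of `S`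
    have hpow : n ^ k = n * n ^ (k - 1) := by rw [← pow_succ']; congr 1; omega
    have hcover : cycles G k ⊆ S ∪ ((cycles G k).filter (fun z => ∃ i,
        ((univ.filter fun w => G.Adj (z i) w ∧ G.Adj (z (i + 2)) w).card : ℝ) < θ) ∪
        (cycles G k).filter fun z => ξ * n < (oddAttached G z).card) := by
      intro z hz
      rw [mem_union, mem_union]
      by_cases c1 : ∀ i, θ ≤ codeg G (z i) (z (i + 2))
      · by_cases c2 : ((oddAttached G z).card : ℝ) ≤ ξ * n
        · left; exact mem_filter.2 ⟨hz, c1, c2⟩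
        · right; right; exact mem_filter.2 ⟨hz, not_le.1 c2⟩
      · right; left
        push Not at c1
        exact mem_filter.2 ⟨hz, c1⟩
    have u1 := (card_le_card hcover).trans ((card_union_le _ _).trans
      (Nat.add_le_add_left (card_union_le _ _) _))
    have u2 := card_low_codegree_le hk (G := G) (by positivity : 0 ≤ θ)
    set S2 := (cycles G k).filter (fun z => ∃ i,
        ((univ.filter fun w => G.Adj (z i) w ∧ G.Adj (z (i + 2)) w).card : ℝ) < θ) with hS2
    set S3 := (cycles G k).filter fun z => ξ * n < (oddAttached G z).card with hS3
    have u1' : ((cycles G k).card : ℝ) ≤ S.card + (S2.card + S3.card) := by exact_mod_cast u1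
    have u3 : (S3.card : ℝ) * (ξ * n) ≤ 2 * k ^ 4 * n ^ k := by
      have v1 := card_nsmul_le_sum S3 (fun z => ((oddAttached G z).card : ℝ)) (ξ * n)
        (fun z hz => (mem_filter.1 hz).2.le)
      rw [nsmul_eq_mul] at v1
      have v2 : ∑ z ∈ S3, ((oddAttached G z).card : ℝ)
          ≤ ∑ z ∈ cycles G k, ((oddAttached G z).card : ℝ) :=
        sum_le_sum_of_subset_of_nonneg (filter_subset _ _) fun _ _ _ => by positivity
      have v3 : ∑ z ∈ cycles G k, ((oddAttached G z).card : ℝ) ≤ 2 * k ^ 4 * n ^ k := by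
        rw [hn_def]
        exact_mod_cast sum_card_oddAttached_le hk hodd hfree
      linarith
    have u3' : (S3.card : ℝ) ≤ 2 * k ^ 4 / ξ * (1 / n) * n ^ k := by
      apply le_of_mul_le_mul_right _ (by positivity : 0 < ξ * n)
      calc _ ≤ _ := u3
        _ = _ := by field_simp
    have u2' : (S2.card : ℝ) ≤ k * τ * n ^ k := by
      refine u2.trans (le_of_eq ?_)
      rw [hpow, hθ]; ring
    have u4 := pow_card_mul_le_of_le_cycles h4 hL
    rw [← hn_def] at u4
    have hnk : 0 < n ^ k := by positivity
    have u5 : (2 * k * (1 / k - 1 / n) ^ k - k * τ - 2 * k ^ 4 / ξ * (1 / n)) * n ^ k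
        ≤ S.card := by
      rw [sub_mul, sub_mul]; linarith
    have u6 : 1 + e ≤ 1 - k ^ 2 * (2 * ξ) + ε ^ 2 / (4 * k) := by
      have : ε ^ 2 / (4 * k) = 2 * e := by rw [he]; field_simp; norm_num
      linarith
    have u7 : c * n ^ k < (S.card : ℝ) * (1 + e) := by
      calc c * n ^ k < ((2 * k * (1 / k - 1 / n) ^ k - k * τ - 2 * k ^ 4 / ξ * (1 / n))
            * (1 + e)) * n ^ k := mul_lt_mul_of_pos_right h1 hnk
        _ = ((2 * k * (1 / k - 1 / n) ^ k - k * τ - 2 * k ^ 4 / ξ * (1 / n)) * n ^ k)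
            * (1 + e) := by ring
        _ ≤ _ := mul_le_mul_of_nonneg_right u5 (by positivity)
    have u8 : (S.card : ℝ) * (1 + e) ≤ S.card * (1 - k ^ 2 * (2 * ξ) + ε ^ 2 / (4 * k)) :=
      mul_le_mul_of_nonneg_left u6 (by positivity)
    have u9 : 2 * k * (n / k) ^ k = c * n ^ k := by
      rw [hc, div_pow, div_pow, one_pow]; ring
    rw [← hn_def] at hSle
    linarith
  · intro z hz r
    rw [hS, mem_filter] at hz ⊢
    obtain ⟨hz1, hz2, hz3⟩ := hz
    obtain ⟨hinj, hadj⟩ := mem_cycles.1 hz1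
    refine ⟨mem_cycles.2 ⟨?_, ?_⟩, ?_, ?_⟩
    · intro a b hab
      exact add_right_cancel (hinj hab)
    · intro i
      have := hadj (i + r)
      rwa [show i + r + 1 = i + 1 + r by ring] at this
    · intro i
      have := hz2 (i + r)
      rwa [show i + r + 2 = i + 2 + r by ring] at this
    · refine le_trans ?_ hz3
      have : oddAttached G (fun i => z (i + r)) ⊆ oddAttached G z := by
        intro u hu
        simp only [oddAttached, nbrIdx, mem_filter, mem_univ, true_and] at hu ⊢
        obtain ⟨i, hi, j, hj, hij⟩ := hu
        refine ⟨i + r, hi, j + r, hj, fun h => hij ?_⟩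
        rcases h with h | h | h
        · left; linear_combination h
        · right; left; linear_combination h
        · right; right; linear_combination h
      exact_mod_cast card_le_card this
  · intro z hz
    rw [hS, mem_filter] at hz
    exact hcon z hz.1 (hz.2.2.trans (mul_le_mul_of_nonneg_right hξη hnpos.le))

/-! ### The twin classes of a good cycle form a near blow-up. -/

theorem card_filter_mem_pair_le {V ι : Type*} [Fintype V] [Fintype ι] [DecidableEq ι] {i j : ι}
    (hij : i ≠ j) (X : ι → Finset V) (E : Finset (V × V)) (C : ℝ)
    (hC : ∀ l, ((X l).card : ℝ) ≤ C) :
    ((univ.filter fun z : ι → V => (∀ l, z l ∈ X l) ∧ (z i, z j) ∈ E).card : ℝ)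
      ≤ E.card * C ^ (Fintype.card ι - 2) := by
  have h1 : (univ.filter fun z : ι → V => (∀ l, z l ∈ X l) ∧ (z i, z j) ∈ E).card
      ≤ (∏ l ∈ (univ.erase i).erase j, (X l).card) * E.card := by
    refine card_le_mul_card_image_of_maps_to (f := fun z : ι → V => (z i, z j)) (t := E)
      (fun z hz => (mem_filter.1 hz).2.2) _ ?_
    rintro ⟨a, b⟩ -
    have : (filter (fun z : ι → V => (z i, z j) = (a, b))
        (univ.filter fun z : ι → V => (∀ l, z l ∈ X l) ∧ (z i, z j) ∈ E))
        ⊆ Fintype.piFinset fun l => if l = i then {a} else if l = j then {b} else X l := by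
      intro z hz
      simp only [mem_filter, mem_univ, true_and, Prod.mk.injEq] at hz
      rw [Fintype.mem_piFinset]
      intro l
      split_ifs with h1 h2
      · subst h1; simp [hz.2.1]
      · subst h2; simp [hz.2.2]
      · exact hz.1.1 l
    refine (card_le_card this).trans ?_
    rw [Fintype.card_piFinset, ← mul_prod_erase univ _ (mem_univ i),
      ← mul_prod_erase (univ.erase i) _ (mem_erase.2 ⟨hij.symm, mem_univ j⟩)]
    simp only [if_pos, hij.symm, if_false, card_singleton, one_mul]
    refine le_of_eq (prod_congr rfl fun l hl => ?_)
    simp only [mem_erase, mem_univ, and_true] at hl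
    rw [if_neg hl.2, if_neg hl.1]
  have h2 : ∏ l ∈ (univ.erase i).erase j, ((X l).card : ℝ) ≤ C ^ (Fintype.card ι - 2) := by
    refine (prod_le_prod (fun l _ => by positivity) (g := fun _ => C) fun l _ => hC l).trans
      (le_of_eq ?_)
    rw [prod_const, card_erase_of_mem (mem_erase.2 ⟨hij.symm, mem_univ j⟩),
      card_erase_of_mem (mem_univ i), card_univ, Nat.sub_sub]
  have h1' : ((univ.filter fun z : ι → V => (∀ l, z l ∈ X l) ∧ (z i, z j) ∈ E).card : ℝ)
      ≤ (∏ l ∈ (univ.erase i).erase j, ((X l).card : ℝ)) * E.card := by exact_mod_cast h1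
  refine h1'.trans ?_
  rw [mul_comm]
  exact mul_le_mul_of_nonneg_left h2 (by positivity)

/-- Edges between classes that are not consecutive. -/
noncomputable def crossEdges {V : Type*} [Fintype V] {k : ℕ} (G : SimpleGraph V)
    (cl : V → Option (ZMod k)) : Finset (V × V) :=
  univ.filter fun e => G.Adj e.1 e.2 ∧ ∃ i j, cl e.1 = some i ∧ cl e.2 = some j ∧ ¬ Consec i j

/-- A cycle meets an unclassified vertex, uses a cross edge, or has a dihedral colour pattern. In
the last case it contains an edge between classes `a` and `b`, and its other `k - 2` vertices have
at most `C` choices each. -/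
theorem card_cycles_le_of_classes {V : Type*} [Fintype V] {k : ℕ} [NeZero k] (hk : 7 ≤ k)
    (hodd : Odd k) (G : SimpleGraph V) (cl : V → Option (ZMod k)) {a b : ZMod k}
    (hab : Consec a b) (C : ℝ) (hC : ∀ i, ((cls cl i).card : ℝ) ≤ C) :
    ((cycles G k).card : ℝ) ≤
      k * ((univ.filter fun v => cl v = none).card * (Fintype.card V : ℝ) ^ (k - 1))
      + k * ((crossEdges G cl).card * (Fintype.card V : ℝ) ^ (k - 2))
      + 2 * k * (((cls cl a ×ˢ cls cl b).filter fun e => G.Adj e.1 e.2).card * C ^ (k - 2)) := by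
  have n1 : (1 : ZMod k) ≠ 0 := (natCast_even_ne hk hodd).1
  set B := univ.filter fun v => cl v = none with hB
  set E := (cls cl a ×ˢ cls cl b).filter fun e => G.Adj e.1 e.2 with hE
  set ZB : Finset (ZMod k → V) := univ.biUnion fun i : ZMod k =>
    univ.filter fun z : ZMod k → V => z i ∈ B with hZB
  set ZE : Finset (ZMod k → V) := univ.biUnion fun i : ZMod k =>
    univ.filter fun z : ZMod k → V => (z i, z (i + 1)) ∈ crossEdges G cl with hZE
  let Zt : (ZMod k → ZMod k) → Finset (ZMod k → V) := fun t =>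
    (cycles G k).filter fun z => ∀ i, z i ∈ cls cl (t i)
  have hcover : cycles G k ⊆ ZB ∪ ZE ∪ (dihedral k).biUnion Zt := by
    intro z hz
    obtain ⟨hinj, hadj⟩ := mem_cycles.1 hz
    rw [mem_union, mem_union]
    by_cases h1 : z ∈ ZB
    · exact Or.inl (Or.inl h1)
    by_cases h2 : z ∈ ZE
    · exact Or.inl (Or.inr h2)
    right
    have hex : ∀ i, ∃ c, cl (z i) = some c := by
      intro i
      apply Option.ne_none_iff_exists'.1
      intro h
      apply h1
      rw [hZB, mem_biUnion]
      exact ⟨i, mem_univ _, by simp [hB, h]⟩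
    choose t ht using hex
    rw [mem_biUnion]
    refine ⟨t, mem_dihedral_of_consec hodd t fun i => ?_, mem_filter.2 ⟨hz, fun i => mem_cls.2 (ht i)⟩⟩
    by_contra hcon
    apply h2
    rw [hZE, mem_biUnion]
    refine ⟨i, mem_univ _, ?_⟩
    simp only [crossEdges, mem_filter, mem_univ, true_and]
    exact ⟨hadj i, t i, t (i + 1), ht i, ht _, hcon⟩
  have h1 : ZB.card ≤ k * (B.card * Fintype.card V ^ (k - 1)) := by
    refine card_biUnion_le.trans ((sum_le_card_nsmul _ _ (B.card * Fintype.card V ^ (k - 1))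
      fun i _ => ?_).trans (le_of_eq ?_))
    · have := card_filter_apply_mem_le (V := V) i B
      rwa [ZMod.card] at this
    · rw [card_univ, ZMod.card, smul_eq_mul]
  have h2 : ZE.card ≤ k * ((crossEdges G cl).card * Fintype.card V ^ (k - 2)) := by
    refine card_biUnion_le.trans ((sum_le_card_nsmul _ _
      ((crossEdges G cl).card * Fintype.card V ^ (k - 2)) fun i _ => ?_).trans (le_of_eq ?_))
    · have hi : i ≠ i + 1 := by simpa using n1
      have := card_filter_apply_pair_le (V := V) hi (crossEdges G cl)
      rwa [ZMod.card] at this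
    · rw [card_univ, ZMod.card, smul_eq_mul]
  have h3 : ∀ t ∈ dihedral k, ((Zt t).card : ℝ) ≤ E.card * C ^ (k - 2) := by
    intro t ht
    obtain ⟨i, hi⟩ := (bijective_of_mem_dihedral ht).2 a
    obtain ⟨j, hj⟩ := (bijective_of_mem_dihedral ht).2 b
    have hij : Consec i j := consec_succ_of_consec_dihedral ht (by rw [hi, hj]; exact hab)
    have hne : i ≠ j := by
      rintro rfl
      rcases hij with h | h <;> exact n1 (by simpa using h)
    have hsub : Zt t ⊆ univ.filter fun z : ZMod k → V =>
        (∀ l, z l ∈ cls cl (t l)) ∧ (z i, z j) ∈ E := by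
      intro z hz
      simp only [Zt, mem_filter] at hz
      obtain ⟨hz, hzt⟩ := hz
      obtain ⟨hinj, hadj⟩ := mem_cycles.1 hz
      rw [mem_filter]
      refine ⟨mem_univ _, hzt, ?_⟩
      rw [hE, mem_filter, mem_product]
      refine ⟨⟨hi ▸ hzt i, hj ▸ hzt j⟩, ?_⟩
      rcases hij with h | h
      · rw [h]; exact hadj i
      · rw [h]; exact (hadj j).symm
    have h4 := card_filter_mem_pair_le hne (fun l => cls cl (t l)) E C (fun l => hC _)
    rw [ZMod.card] at h4
    refine le_trans ?_ h4
    exact_mod_cast card_le_card hsub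
  have h4 : (((dihedral k).biUnion Zt).card : ℝ) ≤ 2 * k * (E.card * C ^ (k - 2)) := by
    have e1 : (((dihedral k).biUnion Zt).card : ℝ) ≤ ∑ t ∈ dihedral k, ((Zt t).card : ℝ) := by
      exact_mod_cast card_biUnion_le
    have e2 := sum_le_card_nsmul _ _ _ h3
    rw [card_dihedral (by omega), nsmul_eq_mul] at e2
    push_cast at e2
    linarith
  have h5 := (card_le_card hcover).trans ((card_union_le _ _).trans
    (Nat.add_le_add_right (card_union_le _ _) _))
  have h5' : ((cycles G k).card : ℝ) ≤ ZB.card + ZE.card + ((dihedral k).biUnion Zt).card := by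
    exact_mod_cast h5
  have h1' : (ZB.card : ℝ) ≤ k * (B.card * (Fintype.card V : ℝ) ^ (k - 1)) := by exact_mod_cast h1
  have h2' : (ZE.card : ℝ) ≤ k * ((crossEdges G cl).card * (Fintype.card V : ℝ) ^ (k - 2)) := by
    exact_mod_cast h2
  linarith

/-- The class of a vertex according to its neighbours on the cycle `z`. -/
noncomputable def twinClass {V : Type*} [Fintype V] {k : ℕ} [NeZero k] (G : SimpleGraph V)
    (z : ZMod k → V) (u : V) : Option (ZMod k) :=
  if h : u ∉ oddAttached G z ∧ ∃ i, G.Adj u (z (i - 1)) ∧ G.Adj u (z (i + 1))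
  then some h.2.choose else none

theorem twinClass_adj {V : Type*} [Fintype V] {k : ℕ} [NeZero k] {G : SimpleGraph V}
    {z : ZMod k → V} {u : V} {i : ZMod k} (h : twinClass G z u = some i) :
    G.Adj u (z (i - 1)) ∧ G.Adj u (z (i + 1)) := by
  unfold twinClass at h
  split_ifs at h with h1
  have := h1.2.choose_spec
  rwa [Option.some.inj h] at this

/-- Outside `oddAttached` the neighbours on the cycle surround a single centre, so the choice made
by `twinClass` is forced. -/
theorem twinClass_eq_some {V : Type*} [Fintype V] {k : ℕ} [NeZero k] (hk : 7 ≤ k)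
    {G : SimpleGraph V} {z : ZMod k → V} {u : V} {i : ZMod k} (hu : u ∉ oddAttached G z)
    (h1 : G.Adj u (z (i - 1))) (h2 : G.Adj u (z (i + 1))) : twinClass G z u = some i := by
  have hex : ∃ j, twinClass G z u = some j := by
    unfold twinClass
    rw [dif_pos ⟨hu, i, h1, h2⟩]
    exact ⟨_, rfl⟩
  obtain ⟨j, hj⟩ := hex
  rw [hj]
  obtain ⟨h3, h4⟩ := twinClass_adj hj
  obtain ⟨n2, n4, n6⟩ := natCast_sub_ne hk
  obtain ⟨c, hc⟩ := exists_center hk {i | G.Adj u (z i)} (by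
    intro a ha b hb
    by_contra hcon
    apply hu
    simp only [oddAttached, nbrIdx, mem_filter, mem_univ, true_and]
    exact ⟨a, ha, b, hb, hcon⟩)
  have key : ∀ a, G.Adj u (z (a - 1)) → G.Adj u (z (a + 1)) → a = c := by
    intro a ha hb
    rcases hc _ hb with h | h
    · exact add_right_cancel h
    · exfalso
      rcases hc _ ha with h' | h'
      · apply n4; linear_combination h - h'
      · apply n2; linear_combination h - h'
  rw [key i h1 h2, key j h3 h4]

theorem codeg_le_card_twinClass {V : Type*} [Fintype V] {k : ℕ} [NeZero k] (hk : 7 ≤ k)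
    {G : SimpleGraph V} {z : ZMod k → V} (i : ZMod k) :
    codeg G (z i) (z (i + 2)) ≤ (cls (twinClass G z) (i + 1)).card + (oddAttached G z).card := by
  refine le_trans (card_le_card ?_) (card_union_le _ _)
  intro u hu
  simp only [mem_filter, mem_univ, true_and] at hu
  rw [mem_union, mem_cls]
  by_cases h : u ∈ oddAttached G z
  · exact Or.inr h
  · left
    apply twinClass_eq_some hk h
    · simpa using hu.1.symm
    · rw [show i + 1 + 1 = i + 2 by ring]; exact hu.2.symm

theorem card_crossEdges_twinClass_le {V : Type*} [Fintype V] {k : ℕ} [NeZero k] (hk : 7 ≤ k)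
    (hodd : Odd k) {G : SimpleGraph V} (hfree : (SimpleGraph.cycleGraph (k - 2)).Free G)
    {z : ZMod k → V} (hz : z ∈ cycles G k) :
    (crossEdges G (twinClass G z)).card ≤ 2 * k ^ 4 * Fintype.card V := by
  obtain ⟨n1, n2, n3, n4, n6, n8⟩ := natCast_even_ne hk hodd
  let X : ZMod k × ZMod k → Finset (V × V) := fun q =>
    if ¬ (q.2 = q.1 + 1 ∨ q.2 = q.1 - 1 ∨ q.2 = q.1 + 3 ∨ q.2 = q.1 - 3) then
      univ.filter fun e : V × V => G.Adj (z q.1) e.1 ∧ G.Adj (z q.2) e.2 ∧ G.Adj e.1 e.2 else ∅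
  have hsub : crossEdges G (twinClass G z) ⊆ univ.biUnion X := by
    rintro ⟨u, v⟩ he
    simp only [crossEdges, mem_filter, mem_univ, true_and] at he
    obtain ⟨huv, i, j, hi, hj, hij⟩ := he
    have ai := twinClass_adj hi
    have aj := twinClass_adj hj
    unfold Consec at hij
    push Not at hij
    -- A non-consecutive difference `j - i` other than `±3` is kept by taking the successors of
    -- both. A difference `±3` is stretched to `±5`, which differs from `±1` and `±3` modulo `k`.
    have hpick : ∃ a b, G.Adj u (z a) ∧ G.Adj v (z b) ∧
        ¬ (b = a + 1 ∨ b = a - 1 ∨ b = a + 3 ∨ b = a - 3) := by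
      by_cases c1 : j = i + 3
      · refine ⟨i - 1, j + 1, ai.1, aj.2, ?_⟩
        rintro (h | h | h | h)
        · apply n4; linear_combination h - c1
        · apply n6; linear_combination h - c1
        · apply n2; linear_combination h - c1
        · apply n8; linear_combination h - c1
      by_cases c2 : j = i - 3
      · refine ⟨i + 1, j - 1, ai.2, aj.1, ?_⟩
        rintro (h | h | h | h)
        · apply n6; linear_combination c2 - h
        · apply n4; linear_combination c2 - h
        · apply n8; linear_combination c2 - h
        · apply n2; linear_combination c2 - h
      · refine ⟨i + 1, j + 1, ai.2, aj.2, ?_⟩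
        rintro (h | h | h | h)
        · apply hij.1; linear_combination h
        · apply hij.2; linear_combination -h
        · apply c1; linear_combination h
        · apply c2; linear_combination h
    obtain ⟨a, b, ha, hb, hab⟩ := hpick
    rw [mem_biUnion]
    refine ⟨(a, b), mem_univ _, ?_⟩
    simp only [X]
    rw [if_pos hab, mem_filter]
    exact ⟨mem_univ _, ha.symm, hb.symm, huv⟩
  refine (card_le_card hsub).trans (card_biUnion_le.trans ?_)
  refine (sum_le_card_nsmul _ _ (2 * k ^ 2 * Fintype.card V) ?_).trans (le_of_eq ?_)
  · rintro ⟨i, j⟩ -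
    simp only [X]
    split_ifs with h
    · simp
    · refine (card_adj_nbrs_le hk hodd hfree hz i j h).trans ?_
      gcongr
      omega
  · rw [card_univ, Fintype.card_prod, ZMod.card, smul_eq_mul]; ring

/-- Discard the classified vertices missing many neighbours in a neighbouring class. -/
noncomputable def trimClass {V : Type*} [Fintype V] {k : ℕ} (G : SimpleGraph V)
    (cl : V → Option (ZMod k)) (m : ℝ) (v : V) : Option (ZMod k) :=
  if ∀ i j, cl v = some i → Consec i j →
    (((cls cl j).filter fun u => ¬ G.Adj v u).card : ℝ) ≤ m then cl v else none

theorem trimClass_some {V : Type*} [Fintype V] {k : ℕ} {G : SimpleGraph V}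
    {cl : V → Option (ZMod k)} {m : ℝ} {v : V} {i : ZMod k} :
    trimClass G cl m v = some i ↔ cl v = some i ∧ ∀ j, Consec i j →
      (((cls cl j).filter fun u => ¬ G.Adj v u).card : ℝ) ≤ m := by
  unfold trimClass
  split_ifs with h
  · exact ⟨fun h1 => ⟨h1, fun j hj => h i j h1 hj⟩, fun h1 => h1.1⟩
  · constructor
    · intro h1; cases h1
    · rintro ⟨h1, h2⟩
      exfalso
      apply h
      intro i' j hi' hj
      rw [h1] at hi'
      rw [← Option.some.inj hi'] at hj
      exact h2 j hj

/-- By Markov at most `(κ/γ)n` vertices of a class miss more than `γn` of a given neighbouring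
class, and there are two of these. -/
theorem isNear_trimClass {V : Type*} [Fintype V] {k : ℕ} {G : SimpleGraph V}
    {cl : V → Option (ZMod k)} {g κ γ : ℝ} (hγ : 0 < γ) (hn : 0 < Fintype.card V)
    (hsize : ∀ i, (1 / k - g) * Fintype.card V ≤ ((cls cl i).card : ℝ))
    (hmiss : ∀ i j, Consec i j →
      (((cls cl i ×ˢ cls cl j).filter fun e => ¬ G.Adj e.1 e.2).card : ℝ)
        ≤ κ * (Fintype.card V : ℝ) ^ 2)
    (hκ : g + 2 * (κ / γ) ≤ γ) :
    IsNear G (trimClass G cl (γ * Fintype.card V)) γ where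
  size i := by
    set n : ℝ := (Fintype.card V : ℝ) with hn_def
    have hnpos : 0 < n := by rw [hn_def]; exact_mod_cast hn
    let Bad : ZMod k → Finset V := fun j => (cls cl i).filter fun v =>
      γ * n < (((cls cl j).filter fun u => ¬ G.Adj v u).card : ℝ)
    have hBad : ∀ j, Consec i j → ((Bad j).card : ℝ) ≤ κ / γ * n := by
      intro j hj
      have h1 := card_nsmul_le_sum (Bad j)
        (fun v => (((cls cl j).filter fun u => ¬ G.Adj v u).card : ℝ)) (γ * n)
        (fun v hv => (mem_filter.1 hv).2.le)
      have h2 : ∑ v ∈ Bad j, ((cls cl j).filter fun u => ¬ G.Adj v u).card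
          ≤ ((cls cl i ×ˢ cls cl j).filter fun e => ¬ G.Adj e.1 e.2).card := by
        rw [← card_sigma]
        refine card_le_card_of_injOn (fun p => (p.1, p.2)) ?_ ?_
        · rintro ⟨u, v⟩ hp
          simp only [coe_sigma, Set.mem_sigma_iff, mem_coe, mem_filter, Bad, mem_product] at hp ⊢
          exact ⟨⟨hp.1.1, hp.2.1⟩, hp.2.2⟩
        · rintro ⟨u, w⟩ _ ⟨u', w'⟩ _ h
          simp only [Prod.mk.injEq] at h
          obtain ⟨rfl, rfl⟩ := h
          rfl
      have h2' : ∑ v ∈ Bad j, (((cls cl j).filter fun u => ¬ G.Adj v u).card : ℝ)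
          ≤ (((cls cl i ×ˢ cls cl j).filter fun e => ¬ G.Adj e.1 e.2).card : ℝ) := by
        exact_mod_cast h2
      rw [nsmul_eq_mul] at h1
      have h3 := h1.trans (h2'.trans (hmiss i j hj))
      apply le_of_mul_le_mul_right _ (by positivity : 0 < γ * n)
      refine h3.trans (le_of_eq ?_)
      field_simp
    have hsub : cls cl i ⊆ cls (trimClass G cl (γ * n)) i ∪ (Bad (i + 1) ∪ Bad (i - 1)) := by
      intro v hv
      rw [mem_union, mem_union]
      by_cases h : ∀ j, Consec i j → (((cls cl j).filter fun u => ¬ G.Adj v u).card : ℝ) ≤ γ * n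
      · left
        rw [mem_cls, trimClass_some]
        exact ⟨mem_cls.1 hv, h⟩
      · right
        push Not at h
        obtain ⟨j, hj, hlt⟩ := h
        rcases hj with h' | h'
        · left
          rw [← h']; exact mem_filter.2 ⟨hv, hlt⟩
        · right
          have : i - 1 = j := by rw [h']; ring
          rw [this]; exact mem_filter.2 ⟨hv, hlt⟩
    have h1 := (card_le_card hsub).trans ((card_union_le _ _).trans
      (Nat.add_le_add_left (card_union_le _ _) _))
    have h1' : ((cls cl i).card : ℝ) ≤ (cls (trimClass G cl (γ * n)) i).card
      + ((Bad (i + 1)).card + (Bad (i - 1)).card) := by exact_mod_cast h1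
    have h2 := hBad (i + 1) (Or.inl rfl)
    have h3 := hBad (i - 1) (Or.inr (by ring))
    have h4 := hsize i
    have h5 := mul_le_mul_of_nonneg_right hκ hnpos.le
    nlinarith
  miss v i j hv hij := by
    rw [trimClass_some] at hv
    refine le_trans ?_ (hv.2 j hij)
    have : ((cls (trimClass G cl (γ * Fintype.card V)) j).filter fun u => ¬ G.Adj v u)
        ⊆ (cls cl j).filter fun u => ¬ G.Adj v u := by
      apply filter_subset_filter
      intro u hu
      rw [mem_cls, trimClass_some] at hu
      exact mem_cls.2 hu.1
    exact_mod_cast card_le_card this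

/-- The twin classes of a good cycle have almost the right size and few cross edges. If two
consecutive classes missed more than `κn²` pairs, `card_cycles_le_of_classes` would give too few
cycles. Trimming turns density between classes into a bound for every classified vertex. -/
theorem exists_isNear (k : ℕ) [NeZero k] (hk : 7 ≤ k) (hodd : Odd k) (γ : ℝ) (hγ : 0 < γ) :
    ∃ n₀ : ℕ, ∀ {V : Type*} [Fintype V] (G : SimpleGraph V),
      n₀ ≤ Fintype.card V → (SimpleGraph.cycleGraph (k - 2)).Free G →
      2 * k * (Fintype.card V / k) ^ k ≤ (cycles G k).card →
      ∃ cl : V → Option (ZMod k), IsNear G cl γ := by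
  have hk0 : (0 : ℝ) < k := by exact_mod_cast NeZero.pos k
  -- Then `κ/γ = γ/4`, so `g ≤ γ/2` suffices for trimming. At `g = 0` the inequality in `hev` is
  -- strict because of `κ`; continuity gives it for small `g`.
  set κ : ℝ := γ ^ 2 / 4 with hκ
  have hκpos : 0 < κ := by positivity
  -- choice of the closeness parameter `g`
  have hev : ∀ᶠ g in 𝓝[>] (0 : ℝ), 2 * k * (((1 / k + k * g) ^ 2 - κ) * (1 / k + k * g) ^ (k - 2))
      < 2 * k * (1 / k - g) ^ k - (k ^ 2 * g + 2 * k ^ 5 * g) := by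
    apply Filter.Eventually.filter_mono nhdsWithin_le_nhds
    apply ContinuousAt.eventually_lt
    · fun_prop
    · fun_prop
    · have h1 : (1 / k : ℝ) ^ k = (1 / k) ^ 2 * (1 / k) ^ (k - 2) := by
        rw [← pow_add]; congr 1; omega
      simp only [mul_zero, add_zero, sub_zero]
      rw [h1]
      have : (0 : ℝ) < (1 / k) ^ (k - 2) := by positivity
      have : (0 : ℝ) < 2 * k * (κ * (1 / k) ^ (k - 2)) := by positivity
      linarith
  have hev2 : ∀ᶠ g in 𝓝[>] (0 : ℝ), 0 < g := eventually_mem_nhdsWithin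
  have hev3 : ∀ᶠ g in 𝓝[>] (0 : ℝ), g < min (γ / 2) (1 / k) :=
    Filter.Eventually.filter_mono nhdsWithin_le_nhds (eventually_lt_nhds (by positivity))
  obtain ⟨g, hg, hgpos, hgmin⟩ := (hev.and (hev2.and hev3)).exists
  have hgγ : g ≤ γ / 2 := (hgmin.le).trans (min_le_left _ _)
  have hgk : g ≤ 1 / k := (hgmin.le).trans (min_le_right _ _)
  -- The permitted class deficit `gn` is split evenly between the codegrees and the odd-attached
  -- vertices.
  obtain ⟨n₁, hn₁⟩ := exists_good_cycle k hk hodd (g * k / 2) (g / 2) (by positivity) (by positivity)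
  obtain ⟨n₂, hn₂⟩ := exists_nat_gt (1 / g)
  refine ⟨max n₁ (max n₂ k), fun {V} _ G hn hfree hL => ?_⟩
  obtain ⟨z, hz, hodda, hcod⟩ := hn₁ G ((le_max_left _ _).trans hn) hfree hL
  have hkn : k ≤ Fintype.card V := ((le_max_right _ _).trans (le_max_right _ _)).trans hn
  have hn2 : n₂ ≤ Fintype.card V := ((le_max_left _ _).trans (le_max_right _ _)).trans hn
  have hL' := pow_card_mul_le_of_le_cycles hkn hL
  set n : ℝ := (Fintype.card V : ℝ) with hn_def
  have hnpos : 0 < n := by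
    have : (k : ℝ) ≤ n := by rw [hn_def]; exact_mod_cast hkn
    linarith
  have hginv : 1 / n ≤ g := by
    have : (n₂ : ℝ) ≤ n := by rw [hn_def]; exact_mod_cast hn2
    rw [div_le_iff₀ hnpos]
    rw [div_lt_iff₀ hgpos] at hn₂
    nlinarith
  set cl := twinClass G z with hcl
  have hsize : ∀ i, (1 / k - g) * n ≤ ((cls cl i).card : ℝ) := by
    intro i
    have h1 := codeg_le_card_twinClass hk (G := G) (z := z) (i - 1)
    rw [show i - 1 + 1 = i by ring] at h1
    have h2 : (codeg G (z (i - 1)) (z (i - 1 + 2)) : ℝ)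
      ≤ (cls cl i).card + (oddAttached G z).card := by exact_mod_cast h1
    have h3 := hcod (i - 1)
    have h4 : (1 - g * k / 2) * (n / k) = (1 / k - g / 2) * n := by field_simp
    rw [h4] at h3
    linarith
  have hupper := card_cls_le_of_le_card_cls hsize hgpos.le
  have hnone := card_none_le_of_le_card_cls hsize
  have hcross : ((crossEdges G cl).card : ℝ) ≤ 2 * k ^ 4 * n := by
    rw [hn_def]
    exact_mod_cast card_crossEdges_twinClass_le hk hodd hfree hz
  refine ⟨_, isNear_trimClass (g := g) (κ := κ) hγ (by omega) hsize ?_ ?_⟩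
  · intro a b hab
    by_contra hcon
    push Not at hcon
    have h1 := card_cycles_le_of_classes hk hodd G cl hab _ hupper
    have h2 := card_filter_add_card_filter_not (s := cls cl a ×ˢ cls cl b)
      (fun e => G.Adj e.1 e.2)
    rw [card_product] at h2
    set E := (cls cl a ×ˢ cls cl b).filter fun e => G.Adj e.1 e.2 with hE
    set N := (cls cl a ×ˢ cls cl b).filter fun e => ¬ G.Adj e.1 e.2 with hN
    have h2' : (E.card : ℝ) + N.card = (cls cl a).card * (cls cl b).card := by exact_mod_cast h2
    set C : ℝ := 1 / k + k * g with hC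
    have hCpos : 0 < C := by positivity
    have h3 : (E.card : ℝ) ≤ (C ^ 2 - κ) * n ^ 2 := by
      have : ((cls cl a).card : ℝ) * (cls cl b).card ≤ (C * n) * (C * n) :=
        mul_le_mul (hupper a) (hupper b) (by positivity) (by positivity)
      linarith
    have p1 : n ^ k = n * n ^ (k - 1) := by rw [← pow_succ']; congr 1; omega
    have p2 : n ^ k = n ^ 2 * n ^ (k - 2) := by rw [← pow_add]; congr 1; omega
    have p3 : n ^ (k - 1) = n * n ^ (k - 2) := by rw [← pow_succ']; congr 1; omega
    have t1 : k * ((univ.filter fun v => cl v = none).card * n ^ (k - 1)) ≤ k ^ 2 * g * n ^ k := by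
      calc _ ≤ k * ((k * g * n) * n ^ (k - 1)) := by gcongr
        _ = _ := by rw [p1]; ring
    have t2 : k * ((crossEdges G cl).card * n ^ (k - 2)) ≤ 2 * k ^ 5 * g * n ^ k := by
      calc _ ≤ k * ((2 * k ^ 4 * n) * n ^ (k - 2)) := by gcongr
        _ = 2 * k ^ 5 * (1 / n) * n ^ k := by rw [p2]; field_simp
        _ ≤ _ := by gcongr
    have t3 : 2 * k * (E.card * (C * n) ^ (k - 2)) ≤ 2 * k * ((C ^ 2 - κ) * C ^ (k - 2)) * n ^ k := by
      calc _ ≤ 2 * k * (((C ^ 2 - κ) * n ^ 2) * (C * n) ^ (k - 2)) := by gcongr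
        _ = _ := by rw [p2, mul_pow]; ring
    have t4 : 2 * k * (1 / k - g) ^ k * n ^ k ≤ ((cycles G k).card : ℝ) := by
      refine le_trans ?_ hL'
      have : 0 ≤ 1 / (k : ℝ) - g := by linarith
      gcongr
    have hnk : 0 < n ^ k := by positivity
    have t5 := mul_lt_mul_of_pos_right hg hnk
    linarith
  · have : κ / γ = γ / 4 := by rw [hκ]; field_simp
    rw [this]; linarith

/-! ### The extremal graphs and the numerical bound. -/

theorem card_cycles_le_iff_copyCount_le {V : Type*} [Fintype V] {k : ℕ} [NeZero k] (hk : 2 ≤ k)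
    (G G' : SimpleGraph V) : (cycles G' k).card ≤ (cycles G k).card ↔
      G'.copyCount (SimpleGraph.cycleGraph k) ≤ G.copyCount (SimpleGraph.cycleGraph k) := by
  rw [card_cycles_eq_labelledCopyCount _ _ hk, card_cycles_eq_labelledCopyCount _ _ hk,
    labelledCopyCount_eq_copyCount_mul, labelledCopyCount_eq_copyCount_mul]
  have : Nonempty (SimpleGraph.cycleGraph k ≃g SimpleGraph.cycleGraph k) := ⟨RelIso.refl _⟩
  have : Finite (SimpleGraph.cycleGraph k ≃g SimpleGraph.cycleGraph k) := DFunLike.finite _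
  exact Nat.mul_le_mul_right_iff Nat.card_pos

theorem exists_coloring_forall_div_le_card (V : Type*) [Fintype V] (k : ℕ) [NeZero k] :
    ∃ c : V → ZMod k, ∀ i, Fintype.card V / k ≤ (univ.filter fun v => c v = i).card := by
  refine ⟨fun v => ((Fintype.equivFin V v : ℕ) : ZMod k), fun i => ?_⟩
  have hb : ∀ j : Fin (Fintype.card V / k), k * j + i.val < Fintype.card V := by
    intro j
    have h1 := i.val_lt
    have h2 : k * (j + 1) ≤ k * (Fintype.card V / k) := Nat.mul_le_mul_left _ j.2
    have h3 := Nat.mul_div_le (Fintype.card V) k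
    rw [mul_add] at h2
    omega
  conv_lhs => rw [← Fintype.card_fin (Fintype.card V / k), ← card_univ]
  refine card_le_card_of_injOn (fun j => (Fintype.equivFin V).symm ⟨k * j + i.val, hb j⟩) ?_ ?_
  · intro j _
    simp
  · intro a _ b _ hab
    have h := congrArg Fin.val ((Fintype.equivFin V).symm.injective hab)
    simp only [add_left_inj] at h
    exact Fin.ext (Nat.eq_of_mul_eq_mul_left (NeZero.pos k) h)

theorem exists_mem_cycles_blowup_of_consec {V : Type*} [Fintype V] {k : ℕ} [NeZero k]
    (hk : 2 ≤ k) {c : V → ZMod k} (hc : Function.Surjective c) {x y : V} (h : c y = c x + 1) :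
    ∃ z ∈ cycles (blowup hk c) k, z (c x) = x ∧ z (c x + 1) = y := by
  choose s hs using hc
  set z : ZMod k → V := fun i => if i = c x then x else if i = c x + 1 then y else s i with hz
  have hcz : ∀ i, c (z i) = i := by
    intro i
    simp only [hz]
    split_ifs with h1 h2
    · exact h1.symm
    · rw [h2, h]
    · exact hs i
  have h1 : (1 : ZMod k) ≠ 0 := by
    exact_mod_cast natCast_ne_zero_of_lt (k := k) (a := 1) (by omega) (by omega)
  refine ⟨z, mem_cycles.2 ⟨fun i j hij => ?_, fun i => ?_⟩, by simp [hz], by simp [hz, h1]⟩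
  · rw [← hcz i, ← hcz j, hij]
  · left
    rw [hcz, hcz]

/-- When all classes are nonempty, every edge of the blow-up lies on a `k`-cycle, so losing an edge
loses a cycle. -/
theorem eq_blowup_of_card_cycles_le {V : Type*} [Fintype V] {k : ℕ} [NeZero k]
    (hk : 2 ≤ k) {G : SimpleGraph V} {c : V → ZMod k} (hc : Function.Surjective c)
    (hG : ∀ u v, G.Adj u v → Consec (c u) (c v))
    (hcard : (cycles (blowup hk c) k).card ≤ (cycles G k).card) : G = blowup hk c := by
  have heq : cycles G k = cycles (blowup hk c) k := by
    apply eq_of_subset_of_card_le _ hcard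
    intro z hz
    rw [mem_cycles] at hz ⊢
    exact ⟨hz.1, fun i => hG _ _ (hz.2 i)⟩
  have key : ∀ x y, c y = c x + 1 → G.Adj x y := by
    intro x y h
    obtain ⟨z, hz, hx, hy⟩ := exists_mem_cycles_blowup_of_consec hk hc h
    rw [← heq, mem_cycles] at hz
    simpa [hx, hy] using hz.2 (c x)
  ext u v
  refine ⟨hG u v, fun h => ?_⟩
  rcases h with h | h
  · exact key u v h
  · exact (key v u h).symm

/-- Moving a vertex from a class of size `A` to one of size `B ≤ A - 2` replaces `AB` by the larger
`(A - 1)(B + 1)`; the other factors are positive by surjectivity. -/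
theorem card_le_card_add_one_of_prod_le {V W : Type*} [Fintype V] [Fintype W] [DecidableEq W]
    (c : V → W)
    (hc : Function.Surjective c)
    (hmax : ∀ c' : V → W, ∏ i, (univ.filter fun v => c' v = i).card
      ≤ ∏ i, (univ.filter fun v => c v = i).card) (a b : W) :
    (univ.filter fun v => c v = a).card ≤ (univ.filter fun v => c v = b).card + 1 := by
  by_contra! hcon
  have hab : a ≠ b := by rintro rfl; omega
  obtain ⟨v, rfl⟩ := hc a
  have h := hmax (Function.update c v b)
  have hmem : b ∈ univ.erase (c v) := mem_erase.2 ⟨hab.symm, mem_univ _⟩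
  rw [← mul_prod_erase univ _ (mem_univ (c v)), ← mul_prod_erase _ _ hmem,
    ← mul_prod_erase univ _ (mem_univ (c v)), ← mul_prod_erase _ _ hmem] at h
  have e1 : (univ.filter fun u => Function.update c v b u = c v)
      = (univ.filter fun u => c u = c v).erase v := by
    ext u
    by_cases hu : u = v
    · subst hu; simp [hab.symm]
    · simp [hu]
  have e2 : (univ.filter fun u => Function.update c v b u = b)
      = insert v (univ.filter fun u => c u = b) := by
    ext u
    by_cases hu : u = v
    · subst hu; simp
    · simp [hu]
  have e3 : ∏ i ∈ (univ.erase (c v)).erase b, (univ.filter fun u => Function.update c v b u = i).card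
      = ∏ i ∈ (univ.erase (c v)).erase b, (univ.filter fun u => c u = i).card := by
    refine prod_congr rfl fun i hi => ?_
    rw [mem_erase, mem_erase] at hi
    congr 1
    ext u
    by_cases hu : u = v
    · subst hu; simp [hi.1.symm, hi.2.1.symm]
    · simp [hu]
  have hpos : 0 < ∏ i ∈ (univ.erase (c v)).erase b, (univ.filter fun u => c u = i).card := by
    refine prod_pos fun i _ => card_pos.2 ?_
    obtain ⟨u, hu⟩ := hc i
    exact ⟨u, by simp [hu]⟩
  rw [e1, e2, e3, card_erase_of_mem (by simp), card_insert_of_notMem (by simp [hab]),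
    ← mul_assoc, ← mul_assoc] at h
  have h' := Nat.le_of_mul_le_mul_right h hpos
  set A := (univ.filter fun u => c u = c v).card
  set B := (univ.filter fun u => c u = b).card
  obtain ⟨m, hm⟩ := Nat.exists_eq_add_of_lt hcon
  rw [hm, show B + 1 + m + 1 - 1 = B + 1 + m by omega] at h'
  nlinarith

/-- `δ` is half of the permitted `1/(6k)`, the other half being left for `kγ`. With `δ` fixed, the
last inequality is strict at `γ = 0` and persists for small `γ`. -/
theorem exists_blowup_parameters (k : ℕ) (hk : 7 ≤ k) : ∃ γ δ : ℝ, 0 < γ ∧ γ ≤ δ ∧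
    δ + k * γ ≤ 1 / (6 * k) ∧
    2 * k * ((1 / k + k * γ - δ) * (1 / k + k * γ) ^ (k - 2)) + k ^ 3 * γ
      < 2 * k * (1 / k - γ) ^ (k - 1) := by
  have hk0 : (0 : ℝ) < k := by exact_mod_cast (by omega : 0 < k)
  set δ : ℝ := 1 / (12 * k) with hδ
  have hδ0 : 0 < δ := by positivity
  have hev : ∀ᶠ g in 𝓝[>] (0 : ℝ), 2 * k * ((1 / k + k * g - δ) * (1 / k + k * g) ^ (k - 2))
      + k ^ 3 * g < 2 * k * (1 / k - g) ^ (k - 1) := by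
    apply Filter.Eventually.filter_mono nhdsWithin_le_nhds
    apply ContinuousAt.eventually_lt
    · fun_prop
    · fun_prop
    · have h1 : (1 / k : ℝ) ^ (k - 1) = (1 / k) * (1 / k) ^ (k - 2) := by
        rw [← pow_succ']; congr 1; omega
      simp only [mul_zero, add_zero, sub_zero]
      rw [h1]
      have : (0 : ℝ) < (1 / k) ^ (k - 2) := by positivity
      have : (0 : ℝ) < 2 * k * (δ * (1 / k) ^ (k - 2)) := by positivity
      linarith
  have hev2 : ∀ᶠ g in 𝓝[>] (0 : ℝ), 0 < g := eventually_mem_nhdsWithin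
  have hev3 : ∀ᶠ g in 𝓝[>] (0 : ℝ), g < min δ (δ / k) :=
    Filter.Eventually.filter_mono nhdsWithin_le_nhds (eventually_lt_nhds (by positivity))
  obtain ⟨g, hg, hg0, hgmin⟩ := (hev.and (hev2.and hev3)).exists
  refine ⟨g, δ, hg0, hgmin.le.trans (min_le_left _ _), ?_, hg⟩
  have h2 : k * g ≤ δ := by
    rw [mul_comm, ← le_div_iff₀ hk0]
    exact hgmin.le.trans (min_le_right _ _)
  have h3 : (1 : ℝ) / (6 * k) = δ + δ := by rw [hδ]; field_simp; norm_num
  rw [h3]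
  linarith

/-- For large `n`, a `C_{k-2}`-free graph with the most `k`-cycles is a blow-up of the `k`-cycle
whose classes are nonempty and have almost equal sizes. -/
theorem exists_eq_blowup_of_isMaximizer (k : ℕ) [NeZero k] (hk : 7 ≤ k) (hodd : Odd k) :
    ∃ n₀ : ℕ, ∀ {V : Type*} [Fintype V] (G : SimpleGraph V), n₀ ≤ Fintype.card V →
      IsMaximizer G (SimpleGraph.cycleGraph k) (SimpleGraph.cycleGraph (k - 2)) →
      ∃ c : V → ZMod k, G = blowup (by omega : 2 ≤ k) c ∧
        ∀ a b, (univ.filter fun v => c v = a).card ≤ (univ.filter fun v => c v = b).card + 1 := by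
  obtain ⟨γ, δ, hγ, hγδ, hδ, hstrict⟩ := exists_blowup_parameters k hk
  obtain ⟨n₁, hn₁⟩ := exists_isNear k hk hodd γ hγ
  refine ⟨max n₁ (2 * k ^ 2), fun {V} _ G hn hG => ?_⟩
  have hk2 : 2 ≤ k := by omega
  have hcard : 2 * k ^ 2 ≤ Fintype.card V := (le_max_right _ _).trans hn
  have hmax : ∀ c : V → ZMod k, (cycles (blowup hk2 c) k).card ≤ (cycles G k).card := by
    intro c
    rw [card_cycles_le_iff_copyCount_le hk2]
    refine hG.2 _ (blowup_free hk2 c ?_ (by omega) (by omega))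
    obtain ⟨m, rfl⟩ := hodd
    exact ⟨m - 1, by omega⟩
  have hlow : 2 * k * (Fintype.card V / k) ^ k ≤ (cycles G k).card := by
    obtain ⟨c, hc⟩ := exists_coloring_forall_div_le_card V k
    refine le_trans ?_ (hmax c)
    rw [card_cycles_blowup (by omega) hodd]
    refine Nat.mul_le_mul_left _ ?_
    calc (Fintype.card V / k) ^ k = ∏ _i : ZMod k, Fintype.card V / k := by simp [ZMod.card]
      _ ≤ _ := prod_le_prod' fun i _ => hc i
  obtain ⟨cl, hcl⟩ := hn₁ G ((le_max_left _ _).trans hn) hG.1 hlow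
  obtain ⟨c, hc⟩ := exists_classes_of_isNear hk hodd hG.1 hmax hγ hγδ hδ hstrict hcl hcard
  have hle : (cycles G k).card ≤ (cycles (blowup hk2 c) k).card := by
    refine card_le_card fun z hz => ?_
    rw [mem_cycles] at hz ⊢
    exact ⟨hz.1, fun i => hc _ _ (hz.2 i)⟩
  -- An empty class would leave the blow-up without `k`-cycles.
  have hsurj : Function.Surjective c := by
    intro i
    have hdiv : 0 < Fintype.card V / k := Nat.div_pos (by nlinarith) (by omega)
    have h1 : 0 < (cycles (blowup hk2 c) k).card :=
      lt_of_lt_of_le (by positivity) (hlow.trans hle)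
    rw [card_cycles_blowup (by omega) hodd] at h1
    have h2 := Nat.pos_of_mul_pos_left h1
    by_contra hi
    push Not at hi
    refine h2.ne' (prod_eq_zero (mem_univ i) ?_)
    rw [card_eq_zero, filter_eq_empty_iff]
    exact fun v _ => hi v
  refine ⟨c, eq_blowup_of_card_cycles_le hk2 hsurj hc (hmax c),
    card_le_card_add_one_of_prod_le c hsurj fun c' => ?_⟩
  have h := (hmax c').trans hle
  rw [card_cycles_blowup (by omega) hodd, card_cycles_blowup (by omega) hodd] at h
  exact Nat.le_of_mul_le_mul_left h (by omega)

theorem isBalancedBlowup_blowup {V : Type*} [Fintype V] {k : ℕ} [NeZero k] (hk : 2 ≤ k)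
    {c : V → ZMod k}
    (hc : ∀ a b, (univ.filter fun v => c v = a).card ≤ (univ.filter fun v => c v = b).card + 1) :
    IsBalancedBlowup (blowup hk c) (SimpleGraph.cycleGraph k) := by
  obtain ⟨e, he⟩ := exists_equiv_cycleGraph k hk
  refine ⟨fun v => e.symm (c v), fun v w => ?_, fun a b => ?_⟩
  · rw [he]
    simp [blowup_adj, Consec]
  · have h : ∀ a : Fin k, {v | e.symm (c v) = a}.ncard = (univ.filter fun v => c v = e a).card := by
      intro a
      rw [← Set.ncard_coe_finset]
      congr 1
      ext v
      simp [Equiv.symm_apply_eq]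
    rw [h, h]
    exact hc _ _

/-- A lower bound suffices, since the automorphism count is only divided by to bound unlabelled
copies from above. -/
theorem two_mul_le_card_iso_cycleGraph {k : ℕ} [NeZero k] (hk : 3 ≤ k) :
    2 * k ≤ Nat.card (SimpleGraph.cycleGraph k ≃g SimpleGraph.cycleGraph k) := by
  obtain ⟨e, he⟩ := exists_equiv_cycleGraph k (by omega)
  have hadj : ∀ t ∈ dihedral k, ∀ a b : ZMod k,
      (t b = t a + 1 ∨ t a = t b + 1) ↔ (b = a + 1 ∨ a = b + 1) := by
    intro t ht a b
    rw [mem_dihedral] at ht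
    rcases ht with ht | ht
    · rw [ht a, ht b]
      simp [add_assoc]
    · rw [ht a, ht b, or_comm]
      apply or_congr <;> constructor <;> intro h <;> linear_combination h
  let f : dihedral k → (SimpleGraph.cycleGraph k ≃g SimpleGraph.cycleGraph k) := fun t =>
    { toEquiv := (e.trans (Equiv.ofBijective t.1 (bijective_of_mem_dihedral t.2))).trans e.symm
      map_rel_iff' := by
        intro a b
        rw [he, he]
        simpa using hadj t.1 t.2 (e a) (e b) }
  have hf : Function.Injective f := by
    intro s t hst
    apply Subtype.ext
    funext i
    have := congrArg (fun g => g (e.symm i)) hst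
    simpa [f] using this
  have : Finite (SimpleGraph.cycleGraph k ≃g SimpleGraph.cycleGraph k) := DFunLike.finite _
  have h := Nat.card_le_card_of_injective f hf
  rwa [Nat.card_eq_fintype_card, Fintype.card_coe, card_dihedral hk] at h

theorem prod_card_fiber_le {V W : Type*} [Fintype V] [Fintype W] [DecidableEq W] [Nonempty W]
    (c : V → W) :
    ((∏ i, (univ.filter fun v => c v = i).card : ℕ) : ℝ)
      ≤ ((Fintype.card V : ℝ) / Fintype.card W) ^ Fintype.card W := by
  have hW : (0 : ℝ) < Fintype.card W := by exact_mod_cast Fintype.card_pos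
  have h := Real.geom_mean_le_arith_mean univ (fun _ : W => (1 : ℝ))
    (fun i => ((univ.filter fun v => c v = i).card : ℝ)) (fun _ _ => zero_le_one)
    (by simpa using hW) (fun _ _ => by positivity)
  have hsum : ∑ i, ((univ.filter fun v => c v = i).card : ℝ) = Fintype.card V := by
    exact_mod_cast (card_eq_sum_card_fiberwise (s := univ) (t := univ) (f := c) (by simp)).symm
  simp only [Real.rpow_one, one_mul, sum_const, card_univ, nsmul_eq_mul, mul_one, hsum] at h
  push_cast
  have h0 : 0 ≤ ∏ i, ((univ.filter fun v => c v = i).card : ℝ) := by positivity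
  calc _ = ((∏ i, ((univ.filter fun v => c v = i).card : ℝ)) ^ (Fintype.card W : ℝ)⁻¹)
        ^ Fintype.card W := (Real.rpow_inv_natCast_pow h0 Fintype.card_ne_zero).symm
    _ ≤ _ := by gcongr

theorem copyCount_blowup_le {V : Type*} [Fintype V] {k : ℕ} [NeZero k] (hk : 3 ≤ k)
    (hodd : Odd k) (c : V → ZMod k) :
    ((blowup (by omega : 2 ≤ k) c).copyCount (SimpleGraph.cycleGraph k) : ℝ)
      ≤ ((Fintype.card V : ℝ) / k) ^ k := by
  have h1 := card_cycles_eq_labelledCopyCount (blowup (by omega : 2 ≤ k) c) k (by omega)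
  rw [labelledCopyCount_eq_copyCount_mul, card_cycles_blowup hk hodd, mul_comm] at h1
  have h2 := prod_card_fiber_le c
  rw [ZMod.card] at h2
  refine le_trans ?_ h2
  have h3 := Nat.mul_le_mul_left ((blowup (by omega : 2 ≤ k) c).copyCount
    (SimpleGraph.cycleGraph k)) (two_mul_le_card_iso_cycleGraph hk)
  rw [← h1] at h3
  exact_mod_cast Nat.le_of_mul_le_mul_right h3 (by omega)

theorem exists_isMaximizer_copyCount_eq {α β : Type*} {n : ℕ} {T : SimpleGraph α}
    {H : SimpleGraph β} (h : ∃ G : SimpleGraph (Fin n), H.Free G) :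
    ∃ G : SimpleGraph (Fin n), IsMaximizer G T H ∧ genExtremalNumber n T H = G.copyCount T := by
  obtain ⟨G₀, hG₀⟩ := h
  obtain ⟨G, hG, hmax⟩ := exists_max_image (univ.filter fun G : SimpleGraph (Fin n) => H.Free G)
    (fun G => G.copyCount T) ⟨G₀, mem_filter.2 ⟨mem_univ _, hG₀⟩⟩
  refine ⟨G, ⟨by simpa using hG, fun G' hG' => hmax G' (mem_filter.2 ⟨mem_univ _, hG'⟩)⟩, ?_⟩
  unfold genExtremalNumber
  refine le_antisymm (Finset.sup_le fun G' hG' => hmax G' ?_) ?_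
  · simpa using hG'
  · exact Finset.le_sup (f := fun G : SimpleGraph (Fin n) => G.copyCount T) (by simpa using hG)

end GeneralizedTuran

theorem theorem1 (k : ℕ) (hk : 7 ≤ k) (hodd : Odd k) :
    ∃ n₀ : ℕ,
      (∀ n : ℕ, n₀ ≤ n → ∀ (V : Type*) [Fintype V], Fintype.card V = n →
        ∀ G : SimpleGraph V,
          GeneralizedTuran.IsMaximizer G (SimpleGraph.cycleGraph k)
            (SimpleGraph.cycleGraph (k - 2)) →
          GeneralizedTuran.IsBalancedBlowup G (SimpleGraph.cycleGraph k)) ∧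
      (∀ n : ℕ, n₀ ≤ n →
        (GeneralizedTuran.genExtremalNumber n (SimpleGraph.cycleGraph k)
          (SimpleGraph.cycleGraph (k - 2)) : ℝ) ≤ ((n : ℝ) / (k : ℝ)) ^ k) := by
  have : NeZero k := ⟨by omega⟩
  obtain ⟨n₁, hn₁⟩ := GeneralizedTuran.exists_eq_blowup_of_isMaximizer k hk hodd
  -- The same result is used at two universe levels, that of `V` and that of `Fin n`, which yield
  -- separate thresholds.
  obtain ⟨n₂, hn₂⟩ := GeneralizedTuran.exists_eq_blowup_of_isMaximizer k hk hodd
  refine ⟨max n₁ n₂, fun n hn V _ hV G hG => ?_, fun n hn => ?_⟩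
  · obtain ⟨c, rfl, hc⟩ := hn₁ G (by rw [hV]; exact (le_max_left _ _).trans hn) hG
    exact GeneralizedTuran.isBalancedBlowup_blowup _ hc
  · have hfree : (SimpleGraph.cycleGraph (k - 2)).Free (⊥ : SimpleGraph (Fin n)) := by
      refine SimpleGraph.free_bot fun h => ?_
      obtain ⟨e, he⟩ := GeneralizedTuran.exists_equiv_cycleGraph (k - 2) (by omega)
      have := (he (e.symm 0) (e.symm 1)).2 (by simp)
      simp [h] at this
    obtain ⟨G, hG, hGeq⟩ := GeneralizedTuran.exists_isMaximizer_copyCount_eq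
      (T := SimpleGraph.cycleGraph k) ⟨_, hfree⟩
    obtain ⟨c, rfl, -⟩ := hn₂ G (by simpa using (le_max_right _ _).trans hn) hG
    rw [hGeq]
    simpa using GeneralizedTuran.copyCount_blowup_le (by omega) hodd c
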